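/- Let $M$ be a hyperbolic 3-manifold, i.e. a complete connected metric space, with its path metric, that is locally isometric to $\mathbb{H}^3$. A \emph{carrier graph} for $M$ is a continuous map $f\colon X\to M$ from a connected finite graph $X$ (loops and multiple edges allowed) that takes edges to rectifiable paths, such that $f_*\colon\pi_1(X)\to\pi_1(M)$ is surjective and $\mathrm{rank}(\pi_1(X))=\mathrm{rank}(\pi_1(M))<\infty$, where the rank of a group is the least cardinality of a generating set. Its length is the sum of the lengths of the paths $f|_e$ over the edges $e$ of $X$; it is a \emph{minimal length carrier graph} if its length is at most that of every other carrier graph for $M$. Carrier graphs $f\colon X\to M$ and $g\colon Y\to M$ are \emph{strongly equivalent} if $f=g\circ\eta$ for some homeomorphism $\eta\colon X\to Y$. (1) Suppose that $\mathrm{rank}(\pi_1(M))=2$, that $f\colon X\to M$ is a minimal length carrier graph, and that $h\colon M\to M$ is a fixed-point-free isometry of finite order not divisible by $3$. Then $h\circ f$ is a minimal length carrier graph for $M$ that is not strongly equivalent to $f$. (2) In particular, minimal length carrier graphs are not unique. Let $M$ be the figure-8 knot complement with its complete hyperbolic metric, that is, $M=\mathbb{H}^3/\Gamma$ where $\Gamma\subset\mathrm{SL}_2(\mathbb{C})$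 is generated by $\begin{pmatrix}1&1\\0&1\end{pmatrix}$ and $\begin{pmatrix}1&0\\-\omega&1\end{pmatrix}$ with $\omega=e^{2\pi i/3}$. Then $M$ is a hyperbolic 3-manifold, $\mathrm{rank}(\pi_1(M))=2$, $M$ has a fixed-point-free isometry of order $2$, and $M$ has two minimal length carrier graphs that are not strongly equivalent to each other. -/

import Mathlib

open scoped ENNReal MatrixGroups

namespace Carrier

/-! ### Hyperbolic 3-space -/

/-- Hyperbolic 3-space `ℍ³` in the upper half-space model: points `(z, t)` with `z ∈ ℂ`, `t > 0`. -/
@[ext]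
structure H3 where
  /-- the horizontal coordinate -/
  z : ℂ
  /-- the height -/
  t : ℝ
  t_pos : 0 < t

namespace H3

/-- The hyperbolic cosine of the distance:
`cosh d((z,t),(w,s)) = 1 + (|z - w|² + (t - s)²) / (2 t s)`. -/
noncomputable def coshDist (x y : H3) : ℝ :=
  1 + (‖x.z - y.z‖ ^ 2 + (x.t - y.t) ^ 2) / (2 * x.t * y.t)

lemma one_le_coshDist (x y : H3) : 1 ≤ coshDist x y := by
  have := x.t_pos
  have := y.t_pos
  have h : 0 ≤ (‖x.z - y.z‖ ^ 2 + (x.t - y.t) ^ 2) / (2 * x.t * y.t) := by positivity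
  unfold coshDist
  linarith

lemma coshDist_comm (x y : H3) : coshDist x y = coshDist y x := by
  unfold coshDist
  rw [norm_sub_rev]
  ring

lemma coshDist_self (x : H3) : coshDist x x = 1 := by
  simp [coshDist]

lemma eq_of_coshDist {x y : H3} (h : coshDist x y = 1) : x = y := by
  have hx := x.t_pos
  have hy := y.t_pos
  have h0 : (‖x.z - y.z‖ ^ 2 + (x.t - y.t) ^ 2) / (2 * x.t * y.t) = 0 := by
    unfold coshDist at h
    linarith
  have hne : 2 * x.t * y.t ≠ 0 := by positivity
  have h1 : ‖x.z - y.z‖ ^ 2 + (x.t - y.t) ^ 2 = 0 := by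
    rcases div_eq_zero_iff.mp h0 with h | h
    · exact h
    · exact absurd h hne
  have h2 : ‖x.z - y.z‖ = 0 := by
    have := sq_nonneg ‖x.z - y.z‖
    have := sq_nonneg (x.t - y.t)
    exact pow_eq_zero_iff (two_ne_zero) |>.mp (by linarith)
  have h3 : x.t - y.t = 0 := by
    have := sq_nonneg ‖x.z - y.z‖
    have := sq_nonneg (x.t - y.t)
    exact pow_eq_zero_iff (two_ne_zero) |>.mp (by linarith)
  exact H3.ext (sub_eq_zero.mp (norm_eq_zero.mp h2)) (sub_eq_zero.mp h3)

lemma norm_sq_eq (a : ℂ) : ‖a‖ ^ 2 = a.re ^ 2 + a.im ^ 2 := by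
  rw [Complex.sq_norm, Complex.normSq_apply]
  ring

/-- Cauchy-Schwarz in the tangent space at the middle point. -/
lemma coshDist_triangle (u v w : H3) :
    coshDist u w ≤ coshDist u v * coshDist v w +
      √(coshDist u v ^ 2 - 1) * √(coshDist v w ^ 2 - 1) := by
  obtain ⟨a, r, hr⟩ := u
  obtain ⟨b, s, hs⟩ := v
  obtain ⟨c, t, ht⟩ := w
  have key : (coshDist ⟨a, r, hr⟩ ⟨c, t, ht⟩ -
      coshDist ⟨a, r, hr⟩ ⟨b, s, hs⟩ * coshDist ⟨b, s, hs⟩ ⟨c, t, ht⟩) ^ 2 ≤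
      (coshDist ⟨a, r, hr⟩ ⟨b, s, hs⟩ ^ 2 - 1) * (coshDist ⟨b, s, hs⟩ ⟨c, t, ht⟩ ^ 2 - 1) := by
    set p₁ := (a.re - b.re) / r with hp₁
    set p₂ := (a.im - b.im) / r with hp₂
    set p₃ := ((a.re - b.re) ^ 2 + (a.im - b.im) ^ 2 + r ^ 2 - s ^ 2) / (2 * r * s) with hp₃
    set q₁ := (c.re - b.re) / t with hq₁
    set q₂ := (c.im - b.im) / t with hq₂
    set q₃ := ((c.re - b.re) ^ 2 + (c.im - b.im) ^ 2 + t ^ 2 - s ^ 2) / (2 * t * s) with hq₃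
    have e₁ : coshDist ⟨a, r, hr⟩ ⟨b, s, hs⟩ ^ 2 - 1 = p₁ ^ 2 + p₂ ^ 2 + p₃ ^ 2 := by
      simp only [coshDist, norm_sq_eq, Complex.sub_re, Complex.sub_im, hp₁, hp₂, hp₃]
      field_simp
      ring
    have e₂ : coshDist ⟨b, s, hs⟩ ⟨c, t, ht⟩ ^ 2 - 1 = q₁ ^ 2 + q₂ ^ 2 + q₃ ^ 2 := by
      simp only [coshDist, norm_sq_eq, Complex.sub_re, Complex.sub_im, hq₁, hq₂, hq₃]
      field_simp
      ring
    have e₃ : coshDist ⟨a, r, hr⟩ ⟨c, t, ht⟩ -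
        coshDist ⟨a, r, hr⟩ ⟨b, s, hs⟩ * coshDist ⟨b, s, hs⟩ ⟨c, t, ht⟩ =
        -(p₁ * q₁ + p₂ * q₂ + p₃ * q₃) := by
      simp only [coshDist, norm_sq_eq, Complex.sub_re, Complex.sub_im, hp₁, hp₂, hp₃,
        hq₁, hq₂, hq₃]
      field_simp
      ring
    rw [e₁, e₂, e₃]
    nlinarith [sq_nonneg (p₁ * q₂ - p₂ * q₁), sq_nonneg (p₁ * q₃ - p₃ * q₁),
      sq_nonneg (p₂ * q₃ - p₃ * q₂)]
  have h1 : 0 ≤ coshDist ⟨a, r, hr⟩ ⟨b, s, hs⟩ ^ 2 - 1 := by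
    nlinarith [one_le_coshDist ⟨a, r, hr⟩ ⟨b, s, hs⟩]
  rw [← Real.sqrt_mul h1]
  have := Real.le_sqrt_of_sq_le key
  linarith

/-- The hyperbolic metric on `ℍ³`. -/
noncomputable instance : MetricSpace H3 where
  dist x y := Real.arcosh (coshDist x y)
  dist_self x := by
    simp [coshDist_self]
  dist_comm x y := by
    rw [coshDist_comm]
  dist_triangle x y z := by
    have h1 := one_le_coshDist x y
    have h2 := one_le_coshDist y z
    have h3 := one_le_coshDist x z
    have hn := add_nonneg (Real.arcosh_nonneg h1) (Real.arcosh_nonneg h2)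
    rw [← Real.arcosh_cosh hn,
      Real.arcosh_le_arcosh (by linarith) (Real.cosh_pos _), Real.cosh_add,
      Real.cosh_arcosh h1, Real.cosh_arcosh h2, Real.sinh_arcosh h1, Real.sinh_arcosh h2]
    exact coshDist_triangle x y z
  eq_of_dist_eq_zero {x y} h :=
    eq_of_coshDist ((Real.arcosh_eq_zero_iff (one_le_coshDist x y)).mp h)

lemma denom_pos (g : SL(2, ℂ)) (x : H3) :
    0 < ‖g 1 0 * x.z + g 1 1‖ ^ 2 + ‖g 1 0‖ ^ 2 * x.t ^ 2 := by
  have ht := x.t_pos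
  by_cases hc : g 1 0 = 0
  · have hd : g 1 1 ≠ 0 := by
      intro hd
      have := g.det_coe
      rw [Matrix.det_fin_two, hc, hd] at this
      simp at this
    have : 0 < ‖g 1 1‖ := norm_pos_iff.mpr hd
    simp only [hc, zero_mul, zero_add, norm_zero]
    positivity
  · have : 0 < ‖g 1 0‖ := norm_pos_iff.mpr hc
    positivity

/-- The Poincaré extension to `ℍ³` of the Möbius transformation of
`g = !![a, b; c, d] ∈ SL(2, ℂ)`:
`(z, t) ↦ (((a z + b) conj (c z + d) + a conj(c) t²) / D, t / D)` with
`D = |c z + d|² + |c|² t²`. -/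
noncomputable def mobius (g : SL(2, ℂ)) (x : H3) : H3 where
  z := ((g 0 0 * x.z + g 0 1) * (starRingEnd ℂ) (g 1 0 * x.z + g 1 1) +
      g 0 0 * (starRingEnd ℂ) (g 1 0) * (x.t : ℂ) ^ 2) /
    ((‖g 1 0 * x.z + g 1 1‖ ^ 2 + ‖g 1 0‖ ^ 2 * x.t ^ 2 : ℝ) : ℂ)
  t := x.t / (‖g 1 0 * x.z + g 1 1‖ ^ 2 + ‖g 1 0‖ ^ 2 * x.t ^ 2)
  t_pos := div_pos x.t_pos (denom_pos g x)

end H3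

/-! ### Hyperbolic 3-manifolds -/

/-- The metric space `M` is a (complete, connected) hyperbolic 3-manifold with its path metric:
it is locally isometric to `ℍ³`, and distances are infima of lengths of paths. -/
structure IsHyperbolic3Manifold (M : Type*) [MetricSpace M] : Prop where
  connected : ConnectedSpace M
  complete : CompleteSpace M
  locally_hyperbolic : ∀ x : M, ∃ (r : ℝ) (o : H3), 0 < r ∧
    Nonempty (Metric.ball x r ≃ᵢ Metric.ball o r)
  length_metric : ∀ (x y : M) (ε : ℝ), 0 < ε → ∃ γ : Path x y,
    eVariationOn γ Set.univ ≤ ENNReal.ofReal (dist x y + ε)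

/-- `M` is isometric to the quotient `ℍ³ / Γ` with its quotient metric. -/
def IsQuotientOfH3 (Γ : Subgroup SL(2, ℂ)) (M : Type*) [MetricSpace M] : Prop :=
  ∃ p : H3 → M, Function.Surjective p ∧
    (∀ x y, p x = p y ↔ ∃ g ∈ Γ, y = H3.mobius g x) ∧
    (∀ x y, dist (p x) (p y) = ⨅ g : Γ, dist x (H3.mobius g y))

/-- `exp(2πi/3)`, a primitive cube root of unity. -/
noncomputable def omega : ℂ := Complex.exp (2 * Real.pi * Complex.I / 3)

/-- The image of the figure-8 knot group under its discrete faithful representation; the two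
generators are the images of two meridians. -/
noncomputable def figureEightGroup : Subgroup SL(2, ℂ) :=
  Subgroup.closure
    {⟨!![1, 1; 0, 1], by simp [Matrix.det_fin_two]⟩,
     ⟨!![1, 0; -omega, 1], by simp [Matrix.det_fin_two]⟩}

/-- `M` is the figure-8 knot complement with its complete hyperbolic metric. -/
def IsFigureEightComplement (M : Type*) [MetricSpace M] : Prop :=
  IsQuotientOfH3 figureEightGroup M

/-! ### Finite graphs and carrier graphs -/

/-- The group `G` is finitely generated, and `n` is the least cardinality of a generating set. -/
def HasRank (G : Type*) [Group G] (n : ℕ) : Prop :=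
  ∃ _ : Group.FG G, Group.rank G = n

/-- The structure of a finite graph (a finite one-dimensional CW complex; loops and multiple edges
are allowed) on the topological space `X`. As `X` is Hausdorff and the edges are
finitely many compact arcs or loops, it carries the quotient topology. -/
structure FiniteGraph (X : Type) [TopologicalSpace X] where
  t2 : T2Space X
  /-- the vertices -/
  V : Set X
  finite_V : V.Finite
  /-- the edges -/
  E : Type
  fintype_E : Fintype E
  /-- the characteristic maps of the edges -/
  edge : E → C(unitInterval, X)
  edge_zero_mem : ∀ e, edge e 0 ∈ V
  edge_one_mem : ∀ e, edge e 1 ∈ V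
  edge_notMem : ∀ e, ∀ s ∈ Set.Ioo (0 : unitInterval) 1, edge e s ∉ V
  edge_inj : ∀ e e', ∀ s ∈ Set.Ioo (0 : unitInterval) 1, ∀ s' ∈ Set.Ioo (0 : unitInterval) 1,
    edge e s = edge e' s' → e = e' ∧ s = s'
  covers : ∀ x, x ∈ V ∨ ∃ e, ∃ s ∈ Set.Ioo (0 : unitInterval) 1, edge e s = x

attribute [instance] FiniteGraph.fintype_E

section

variable {M : Type*} [MetricSpace M] {X : Type} [TopologicalSpace X]

/-- The length of the edge `e` under `f`: the length of the path `f ∘ e`. -/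
noncomputable def edgeLength (Γ : FiniteGraph X) (f : C(X, M)) (e : Γ.E) : ℝ≥0∞ :=
  eVariationOn (fun s : unitInterval => f (Γ.edge e s)) Set.univ

/-- The length of a graph under `f`: the sum of the lengths of the edges. -/
noncomputable def graphLength (Γ : FiniteGraph X) (f : C(X, M)) : ℝ≥0∞ :=
  ∑ e : Γ.E, edgeLength Γ f e

/-- `f : X → M` is a carrier graph (of minimal rank): `X` is a connected finite graph, `f` is
surjective on fundamental groups, `rank π₁(X) = rank π₁(M)`, and edges go to rectifiable
paths. -/
structure IsCarrierGraph (Γ : FiniteGraph X) (f : C(X, M)) : Prop where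
  connected : ConnectedSpace X
  surjective : ∀ x : X, Function.Surjective (FundamentalGroup.map f x)
  rank_eq : ∀ x : X, ∃ n : ℕ,
    HasRank (FundamentalGroup X x) n ∧ HasRank (FundamentalGroup M (f x)) n
  rectifiable : ∀ e, edgeLength Γ f e ≠ ∞

/-- `f : X → M` is a minimal length carrier graph: its length is at most that of any other
(minimal rank) carrier graph for `M`. -/
def IsMinimalLength (Γ : FiniteGraph X) (f : C(X, M)) : Prop :=
  IsCarrierGraph Γ f ∧
    ∀ (Y : Type) [TopologicalSpace Y] (Δ : FiniteGraph Y) (g : C(Y, M)),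
      IsCarrierGraph Δ g → graphLength Γ f ≤ graphLength Δ g

/-- `f : X → M` and `g : Y → M` are strongly equivalent: `f = g ∘ η` for a homeomorphism
`η : X → Y`. -/
def StronglyEquivalent {Y : Type} [TopologicalSpace Y] (f : C(X, M)) (g : C(Y, M)) : Prop :=
  ∃ η : X ≃ₜ Y, ∀ x, f x = g (η x)

/-- The composition `h ∘ f` with an isometry `h` of `M`. -/
def compIsometry (h : M ≃ᵢ M) (f : C(X, M)) : C(X, M) :=
  ⟨fun x => h (f x), h.continuous.comp f.continuous⟩

end

end Carrier

/-! Part (1). Lengths and surjectivity on fundamental groups are preserved by an isometry, so only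
inequivalence needs an idea. Suppose h ∘ f = f ∘ η with η a homeomorphism of X. A fixed point of η
would give one of h, and a fixed point of η³ one of h³. Since 3 does not divide the order of h, h is
a power of h³, so neither fixed point exists. Now X is a connected graph with two-dimensional first
cohomology, and a fixed-point-free self-map of it has Lefschetz number zero, so η and η³ both have
trace 1 on cohomology (`FiniteGraph.trace_cohomologyMap`). In dimension two, tr A³ = (tr A)³ - 3 (tr
A)(det A), so det A = 0, although A is invertible (`not_trace_eq_one_of_finrank_two`).

The Lefschetz argument is carried out with real cellular cochains. A cochain is integrated over a
path by lifting circle-valued edge coordinates; `FiniteGraph.path_induction` reduces statements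
about all paths to paths inside one edge; after a fine subdivision all diagonal entries vanish. The
Betti number equals the rank of the fundamental group because E - V + 1 bounds the rank from both
sides (`FiniteGraph.card_edge_le`, `FiniteGraph.exists_generators`).

Part (2). The figure-8 group lies in SL(2, ℤ[ω]), so it is discrete. An element fixing a point of ℍ³
is ±1 or has trace 0 or ±1; a finite computation modulo 4 (`codeSpec_of_mem`) excludes ±1 as traces,
and trace 0 would make some x of norm 3 modulo 4 divide a² + 1, which the two-squares theorem
forbids (`Eisenstein.norm_emod_four_ne_three`). Hence the action is free up to sign, and the
quotient is a complete hyperbolic manifold whose fundamental group is the opposite of the deck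
group. It has rank two since the two generators do not commute. The symmetry of order two comes from
the glide reflection (z, t) ↦ (conj z + ω, t): it normalizes the group, its square lies in the
group, and a fixed point in the quotient is again excluded modulo 4 (`glide_ne_smul`).

Existence of a minimal length carrier graph is a compactness argument. Lifting the edges to ℍ³ turns
a carrier graph into a graph with edges labelled by group elements and vertices placed in ℍ³
(`exists_labels`). Deleting vertices of degree one and straightening at vertices of degree two
leaves two vertices and three edges, with two labels generating the group
(`ThetaGraph.exists_of_fullOn`). For bounded length such a graph can be moved so that one vertex
lies in a compact set: height in the cusp is bounded because the two labels cannot both fix the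
cusp. Then finitely many labels occur and a minimum is attained (`exists_shortest_thetaGraph`).
Conversely every generating theta graph is realized by a carrier graph no longer than it
(`ThetaGraph.Generates.exists_isCarrierGraph`). Part (1) then gives the second minimal graph. -/

namespace Carrier
-- The Hermitian matrix model and the isometric action of SL(2, ℂ)
namespace H3

open Matrix ComplexConjugate

/-- The point `x` of `ℍ³` as a positive definite Hermitian matrix of determinant one. -/
noncomputable def herm (x : H3) : Matrix (Fin 2) (Fin 2) ℂ :=
  !![((‖x.z‖ ^ 2 + x.t ^ 2) / x.t : ℝ), x.z / x.t; conj x.z / x.t, (1 / x.t : ℝ)]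

lemma t_ne (x : H3) : (x.t : ℂ) ≠ 0 := by exact_mod_cast x.t_pos.ne'

lemma ofReal_norm_sq (a : ℂ) : ((‖a‖ ^ 2 : ℝ) : ℂ) = a * conj a := by
  rw [Complex.mul_conj, Complex.normSq_eq_norm_sq]

lemma det_herm (x : H3) : x.herm.det = 1 := by
  have := x.t_ne
  have h := ofReal_norm_sq x.z
  rw [herm, det_fin_two]
  push_cast at h
  simp
  rw [h]
  field_simp
  ring

lemma herm_injective : Function.Injective herm := by
  intro x y h
  have h1 := congr_fun (congr_fun h 1) 1
  have h2 := congr_fun (congr_fun h 0) 1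
  simp only [herm, of_apply, cons_val', cons_val_one, cons_val_fin_one, cons_val_zero,
    Complex.ofReal_inj] at h1 h2
  have ht : x.t = y.t := by simpa using h1
  rw [ht] at h2
  have := y.t_ne
  ext1
  · field_simp at h2
    exact h2
  · exact ht

lemma det_SL (g : SL(2, ℂ)) : g 0 0 * g 1 1 - g 0 1 * g 1 0 = 1 := by
  rw [← det_fin_two, g.det_coe]

/-- Only the right-hand column needs computing. Both sides are Hermitian of determinant one with
nonzero lower right entry, and this determines the other two entries. -/
lemma herm_mobius (g : SL(2, ℂ)) (x : H3) :
    herm (mobius g x) = g.1 * herm x * g.1ᴴ := by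
  have hx := x.t_ne
  set D : ℝ := ‖g 1 0 * x.z + g 1 1‖ ^ 2 + ‖g 1 0‖ ^ 2 * x.t ^ 2 with hD
  have hD0 : (D : ℂ) ≠ 0 := by exact_mod_cast (denom_pos g x).ne'
  have hDc : (D : ℂ) = (g 1 0 * x.z + g 1 1) * conj (g 1 0 * x.z + g 1 1) +
      g 1 0 * conj (g 1 0) * x.t ^ 2 := by
    rw [hD, Complex.ofReal_add, Complex.ofReal_mul, ofReal_norm_sq, ofReal_norm_sq]
    push_cast
    ring
  have h11 : herm (mobius g x) 1 1 = (g.1 * herm x * g.1ᴴ) 1 1 := by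
    have hz := ofReal_norm_sq x.z
    push_cast at hz
    have : herm (mobius g x) 1 1 = D / x.t := by
      simp [herm, mobius, hD]
    rw [this, hDc]
    simp [herm, mul_apply, Fin.sum_univ_two, hz]
    field_simp
    ring
  have h01 : herm (mobius g x) 0 1 = (g.1 * herm x * g.1ᴴ) 0 1 := by
    have hz := ofReal_norm_sq x.z
    push_cast at hz
    have : herm (mobius g x) 0 1 = ((g 0 0 * x.z + g 0 1) * conj (g 1 0 * x.z + g 1 1) +
      g 0 0 * conj (g 1 0) * (x.t : ℂ) ^ 2) / x.t := by
      simp only [herm, mobius, ← hD]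
      simp
      field_simp
    rw [this]
    simp [herm, mul_apply, Fin.sum_univ_two, hz]
    field_simp
    ring
  have hH : (g.1 * herm x * g.1ᴴ).IsHermitian := by
    have : (herm x).IsHermitian := by
      ext i j
      fin_cases i <;> fin_cases j <;> simp [herm]
    exact isHermitian_mul_mul_conjTranspose _ this
  have h10 : herm (mobius g x) 1 0 = (g.1 * herm x * g.1ᴴ) 1 0 := by
    rw [← hH.apply, ← h01]
    simp [herm]
  have hne : herm (mobius g x) 1 1 ≠ 0 := by
    have := (mobius g x).t_ne
    simp [herm, this]
  have hdet : (g.1 * herm x * g.1ᴴ).det = 1 := by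
    rw [det_mul, det_mul, det_conjTranspose, det_herm, g.det_coe]
    simp
  have h00 : herm (mobius g x) 0 0 = (g.1 * herm x * g.1ᴴ) 0 0 := by
    have h := det_herm (mobius g x)
    rw [det_fin_two] at h hdet
    rw [← h11, ← h01, ← h10] at hdet
    exact mul_right_cancel₀ hne (by linear_combination h - hdet)
  ext i j
  fin_cases i <;> fin_cases j
  exacts [h00, h01, h10, h11]

noncomputable instance : MulAction SL(2, ℂ) H3 where
  smul := mobius
  one_smul x := herm_injective (by
    change herm (mobius 1 x) = herm x
    rw [herm_mobius]
    simp)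
  mul_smul g h x := herm_injective (by
    change herm (mobius (g * h) x) = herm (mobius g (mobius h x))
    rw [herm_mobius, herm_mobius, herm_mobius]
    simp [Matrix.mul_assoc])

lemma smul_def (g : SL(2, ℂ)) (x : H3) : g • x = mobius g x := rfl

/-- The polarized determinant is the Lorentz form on Hermitian matrices. In this form, invariance
under X ↦ g X gᴴ is cyclicity of the trace. -/
lemma coshDist_eq_trace (x y : H3) :
    (coshDist x y : ℂ) = (herm x * adjugate (herm y)).trace / 2 := by
  have hx := x.t_ne
  have hy := y.t_ne
  have h := ofReal_norm_sq (x.z - y.z)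
  have h1 := ofReal_norm_sq x.z
  have h2 := ofReal_norm_sq y.z
  rw [coshDist, adjugate_fin_two]
  push_cast at *
  simp [herm, trace_fin_two, h, h1, h2]
  field_simp
  ring

lemma coshDist_smul (g : SL(2, ℂ)) (x y : H3) : coshDist (g • x) (g • y) = coshDist x y := by
  have h : (coshDist (g • x) (g • y) : ℂ) = coshDist x y := by
    rw [coshDist_eq_trace, coshDist_eq_trace, smul_def, smul_def, herm_mobius, herm_mobius,
      adjugate_mul_distrib, adjugate_mul_distrib]
    have e1 : (g.1)ᴴ * adjugate (g.1)ᴴ = 1 := by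
      rw [mul_adjugate, det_conjTranspose, g.det_coe]; simp
    have e2 : adjugate g.1 * g.1 = 1 := by rw [adjugate_mul, g.det_coe]; simp
    calc _ = (g.1 * (herm x * ((g.1)ᴴ * adjugate (g.1)ᴴ) * adjugate (herm y)) *
          adjugate g.1).trace / 2 := by simp only [Matrix.mul_assoc]
      _ = (adjugate g.1 * (g.1 * (herm x * adjugate (herm y)))).trace / 2 := by
          rw [e1, Matrix.mul_one, trace_mul_comm]
      _ = _ := by rw [← Matrix.mul_assoc, e2, Matrix.one_mul]
  exact_mod_cast h

lemma dist_def (x y : H3) : dist x y = Real.arcosh (coshDist x y) := rfl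

lemma cosh_dist (x y : H3) : Real.cosh (dist x y) = coshDist x y :=
  Real.cosh_arcosh (one_le_coshDist x y)

instance : IsIsometricSMul SL(2, ℂ) H3 :=
  ⟨fun g => Isometry.of_dist_eq fun x y => by rw [dist_def, dist_def, coshDist_smul]⟩

/-- Complex conjugation of the horizontal coordinate. -/
def conjH (x : H3) : H3 := ⟨conj x.z, x.t, x.t_pos⟩

lemma conjH_conjH (x : H3) : conjH (conjH x) = x := by
  ext1 <;> simp [conjH]

lemma coshDist_conjH (x y : H3) : coshDist (conjH x) (conjH y) = coshDist x y := by
  simp only [coshDist, conjH]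
  rw [← map_sub, RCLike.norm_conj]

/-- The entrywise complex conjugate. -/
noncomputable def conjSL : SL(2, ℂ) →* SL(2, ℂ) := SpecialLinearGroup.map (starRingEnd ℂ)

lemma conjH_smul (g : SL(2, ℂ)) (x : H3) : conjH (g • x) = conjSL g • conjH x := by
  have h : ∀ a : ℂ, ‖conj a‖ = ‖a‖ := RCLike.norm_conj
  have hd : ‖conj (g 1 0) * conj x.z + conj (g 1 1)‖ = ‖g 1 0 * x.z + g 1 1‖ := by
    rw [← map_mul, ← map_add, h]
  rw [smul_def, smul_def]
  ext1
  · simp only [conjH, mobius, conjSL, SpecialLinearGroup.map_apply_coe, RingHom.mapMatrix_apply,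
      map_apply, h, hd]
    simp
  · simp only [conjH, mobius, conjSL, SpecialLinearGroup.map_apply_coe, RingHom.mapMatrix_apply,
      map_apply, h, hd]

/-- Complex conjugation as an isometry. -/
noncomputable def conjIso : H3 ≃ᵢ H3 :=
  IsometryEquiv.mk' conjH conjH conjH_conjH
    (Isometry.of_dist_eq fun x y => by rw [dist_def, dist_def, coshDist_conjH])

end H3
end Carrier

namespace Carrier
namespace H3

open ComplexConjugate

/-! ### Geodesics -/

/-- Exhibits the hyperbolic cosine of the distance as a bilinear form in the hyperboloid coordinates
(|z|² + t²)/t, 1/t and z/t. -/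
lemma coshDist_eq (x y : H3) : coshDist x y =
    (((x.z.re ^ 2 + x.z.im ^ 2 + x.t ^ 2) / x.t) * (1 / y.t) +
      (1 / x.t) * ((y.z.re ^ 2 + y.z.im ^ 2 + y.t ^ 2) / y.t)) / 2 -
      ((x.z.re / x.t) * (y.z.re / y.t) + (x.z.im / x.t) * (y.z.im / y.t)) := by
  have := x.t_pos.ne'
  have := y.t_pos.ne'
  rw [coshDist, norm_sq_eq, Complex.sub_re, Complex.sub_im]
  field_simp
  ring

/-- The point of `ℍ³` proportional to a nonnegative combination of `x` and `y` in the hyperboloid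
model. -/
noncomputable def combo (x y : H3) (α β : ℝ) (h : 0 < α / x.t + β / y.t) : H3 where
  z := ⟨(α * x.z.re / x.t + β * y.z.re / y.t) / (α / x.t + β / y.t),
    (α * x.z.im / x.t + β * y.z.im / y.t) / (α / x.t + β / y.t)⟩
  t := 1 / (α / x.t + β / y.t)
  t_pos := by positivity

/-- By `h1` the vector αx + βy has Lorentz norm one, so it already lies on the hyperboloid and no
rescaling occurs; the rest is bilinearity. -/
lemma coshDist_combo_left (x y w : H3) {α β : ℝ} (h : 0 < α / x.t + β / y.t)
    (h1 : α ^ 2 + β ^ 2 + 2 * α * β * coshDist x y = 1) :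
    coshDist (combo x y α β h) w = α * coshDist x w + β * coshDist y w := by
  have hx := x.t_pos.ne'
  have hy := y.t_pos.ne'
  set q := α / x.t + β / y.t with hq
  have hP : ((combo x y α β h).z.re ^ 2 + (combo x y α β h).z.im ^ 2 +
      (combo x y α β h).t ^ 2) / (combo x y α β h).t =
      α * ((x.z.re ^ 2 + x.z.im ^ 2 + x.t ^ 2) / x.t) +
      β * ((y.z.re ^ 2 + y.z.im ^ 2 + y.t ^ 2) / y.t) := by
    have : ((combo x y α β h).z.re ^ 2 + (combo x y α β h).z.im ^ 2 +
      (combo x y α β h).t ^ 2) / (combo x y α β h).t =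
        ((α * x.z.re / x.t + β * y.z.re / y.t) ^ 2 +
          (α * x.z.im / x.t + β * y.z.im / y.t) ^ 2 + 1) / q := by
      simp only [combo, ← hq]
      field_simp
    rw [this, div_eq_iff h.ne', ← h1, hq, coshDist_eq]
    field_simp
    ring
  have hW1 : (combo x y α β h).z.re / (combo x y α β h).t =
      α * (x.z.re / x.t) + β * (y.z.re / y.t) := by
    simp only [combo, ← hq]; field_simp
  have hW2 : (combo x y α β h).z.im / (combo x y α β h).t =
      α * (x.z.im / x.t) + β * (y.z.im / y.t) := by
    simp only [combo, ← hq]; field_simp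
  have hQ : 1 / (combo x y α β h).t = α * (1 / x.t) + β * (1 / y.t) := by
    simp only [combo]; field_simp
  rw [coshDist_eq, hP, hW1, hW2, hQ, coshDist_eq, coshDist_eq]
  ring

/-- Spherical interpolation with hyperbolic functions: the weights sinh((1-s)L)/sinh L and
sinh(sL)/sinh L stay on the hyperboloid, and addition formulas give the product of two such points.
-/
lemma exists_geodesic (x y : H3) : ∃ γ : unitInterval → H3, γ 0 = x ∧ γ 1 = y ∧
    ∀ s s', dist (γ s) (γ s') = |(s : ℝ) - s'| * dist x y := by
  rcases eq_or_ne x y with rfl | hxy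
  · exact ⟨fun _ => x, rfl, rfl, fun _ _ => by simp⟩
  set L := dist x y with hL
  have hLpos : 0 < L := dist_pos.mpr hxy
  have hC : coshDist x y = Real.cosh L := (cosh_dist x y).symm
  have hS : 0 < Real.sinh L := Real.sinh_pos_iff.mpr hLpos
  set α : unitInterval → ℝ := fun s => Real.sinh ((1 - s) * L) / Real.sinh L with hα
  set β : unitInterval → ℝ := fun s => Real.sinh (s * L) / Real.sinh L with hβ
  have hα0 : ∀ s, 0 ≤ α s := fun s => div_nonneg
    (Real.sinh_nonneg_iff.mpr (mul_nonneg (by linarith [s.2.2]) hLpos.le)) hS.le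
  have hβ0 : ∀ s, 0 ≤ β s := fun s => div_nonneg
    (Real.sinh_nonneg_iff.mpr (mul_nonneg s.2.1 hLpos.le)) hS.le
  have key : ∀ s s', α s * α s' + β s * β s' + (α s * β s' + α s' * β s) * Real.cosh L =
      Real.cosh ((s - s') * L) := by
    intro s s'
    have e : ∀ s : unitInterval, α s = (Real.sinh L * Real.cosh (s * L) -
        Real.cosh L * Real.sinh (s * L)) / Real.sinh L := by
      intro s
      simp only [hα]
      rw [sub_mul, one_mul, Real.sinh_sub]
    rw [e, e, sub_mul, Real.cosh_sub]
    simp only [hβ]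
    generalize (s : ℝ) * L = u
    generalize (s' : ℝ) * L = u'
    field_simp
    linear_combination (-Real.sinh u * Real.sinh u') * Real.cosh_sq L
  have hq : ∀ s, 0 < α s / x.t + β s / y.t := by
    intro s
    have hx := x.t_pos
    have hy := y.t_pos
    rcases (hα0 s).eq_or_lt with h | h
    · rcases (hβ0 s).eq_or_lt with h' | h'
      · have := key s s
        rw [← h, ← h'] at this
        simp at this
      · have := div_nonneg (hα0 s) hx.le
        have := div_pos h' hy
        linarith
    · have := div_nonneg (hβ0 s) hy.le
      have := div_pos h hx
      linarith
  have h1 : ∀ s, α s ^ 2 + β s ^ 2 + 2 * α s * β s * coshDist x y = 1 := by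
    intro s
    have := key s s
    rw [sub_self, zero_mul, Real.cosh_zero] at this
    rw [hC]
    linarith
  have hB : ∀ s s', coshDist (combo x y (α s) (β s) (hq s)) (combo x y (α s') (β s') (hq s')) =
      Real.cosh ((s - s') * L) := by
    intro s s'
    rw [coshDist_combo_left _ _ _ _ (h1 s), coshDist_comm x, coshDist_comm y,
      coshDist_combo_left _ _ _ _ (h1 s'), coshDist_combo_left _ _ _ _ (h1 s'), ← key,
      coshDist_self, coshDist_self, coshDist_comm y x, hC]
    ring
  refine ⟨fun s => combo x y (α s) (β s) (hq s), ?_, ?_, ?_⟩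
  · apply eq_of_coshDist
    rw [coshDist_combo_left _ _ _ _ (h1 _)]
    have hα1 : α 0 = 1 := by simp [hα, hS.ne']
    have hβ1 : β 0 = 0 := by simp [hβ]
    rw [hα1, hβ1, coshDist_self]
    ring
  · apply eq_of_coshDist
    rw [coshDist_combo_left _ _ _ _ (h1 _)]
    have hα1 : α 1 = 0 := by simp [hα]
    have hβ1 : β 1 = 1 := by simp [hβ, hS.ne']
    rw [hα1, hβ1, coshDist_self]
    ring
  · intro s s'
    rw [dist_def, hB, ← Real.cosh_abs, Real.arcosh_cosh (abs_nonneg _), abs_mul,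
      abs_of_pos hLpos]

lemma exists_path_eVariationOn_le (x y : H3) : ∃ γ : Path x y,
    eVariationOn γ Set.univ ≤ ENNReal.ofReal (dist x y) := by
  obtain ⟨γ, h0, h1, hd⟩ := exists_geodesic x y
  have hlip : LipschitzWith (Real.toNNReal (dist x y)) γ := by
    apply LipschitzWith.of_dist_le_mul
    intro s s'
    rw [hd, Real.coe_toNNReal _ dist_nonneg, mul_comm, Subtype.dist_eq, Real.dist_eq]
  refine ⟨⟨⟨γ, hlip.continuous⟩, h0, h1⟩, ?_⟩
  have hid : eVariationOn (fun s : unitInterval => (s : ℝ)) Set.univ ≤ 1 := by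
    have := MonotoneOn.eVariationOn_eq (f := fun s : unitInterval => (s : ℝ)) (s := Set.univ)
      (fun _ _ _ _ h => h) (Set.mem_univ 0) (Set.mem_univ 1)
    simp only [Set.Icc.coe_one, Set.Icc.coe_zero] at this
    have h2 : (Set.univ : Set unitInterval) ∩ Set.Icc 0 1 = Set.univ := by
      ext s
      exact ⟨fun _ => Set.mem_univ _, fun _ => ⟨Set.mem_univ _, s.2.1, s.2.2⟩⟩
    rw [h2] at this
    simp [this]
  refine iSup_le fun p => ?_
  calc _ ≤ ∑ i ∈ Finset.range p.1, ENNReal.ofReal (dist x y) *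
        edist ((p.2.1 (i + 1) : unitInterval) : ℝ) (p.2.1 i : unitInterval) := by
        refine Finset.sum_le_sum fun i _ => ?_
        exact hlip _ _
    _ = ENNReal.ofReal (dist x y) * ∑ i ∈ Finset.range p.1,
        edist ((p.2.1 (i + 1) : unitInterval) : ℝ) (p.2.1 i : unitInterval) := by
        rw [Finset.mul_sum]
    _ ≤ ENNReal.ofReal (dist x y) * 1 := by
        gcongr
        exact (eVariationOn.sum_le (f := fun s : unitInterval => (s : ℝ)) p.2.2.1
          (fun _ => Set.mem_univ _)).trans hid
    _ = _ := mul_one _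

/-! ### Topology -/

/-- The hyperbolic cosine of the left side is `coshDist` with the horizontal term dropped. -/
lemma abs_log_sub_log_le (x y : H3) : |Real.log x.t - Real.log y.t| ≤ dist x y := by
  have hx := x.t_pos
  have hy := y.t_pos
  rw [← Real.arcosh_cosh (abs_nonneg _), dist_def,
    Real.arcosh_le_arcosh (Real.cosh_pos _) (by linarith [one_le_coshDist x y]), Real.cosh_abs,
    Real.cosh_eq, neg_sub, Real.exp_sub, Real.exp_sub, Real.exp_log hx, Real.exp_log hy, coshDist]
  have : (x.t / y.t + y.t / x.t) / 2 = 1 + (0 + (x.t - y.t) ^ 2) / (2 * x.t * y.t) := by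
    field_simp
    ring
  rw [this]
  gcongr
  positivity

lemma norm_sub_sq_le (x y : H3) :
    ‖x.z - y.z‖ ^ 2 ≤ 2 * x.t * y.t * (Real.cosh (dist x y) - 1) := by
  have hx := x.t_pos
  have hy := y.t_pos
  rw [cosh_dist, coshDist, add_sub_cancel_left, mul_div_cancel₀ _ (by positivity)]
  nlinarith [sq_nonneg (x.t - y.t)]

lemma continuous_t : Continuous (fun x : H3 => x.t) := by
  have : Continuous (fun x : H3 => Real.log x.t) :=
    LipschitzWith.continuous (K := 1) (LipschitzWith.of_dist_le_mul fun x y => by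
      simpa [Real.dist_eq] using abs_log_sub_log_le x y)
  exact (Real.continuous_exp.comp this).congr fun x => Real.exp_log x.t_pos

lemma continuous_z : Continuous (fun x : H3 => x.z) := by
  rw [continuous_iff_continuousAt]
  intro y
  have h1 : Filter.Tendsto (fun x : H3 => √(2 * x.t * y.t * (Real.cosh (dist x y) - 1)))
      (nhds y) (nhds 0) := by
    have : Continuous (fun x : H3 => √(2 * x.t * y.t * (Real.cosh (dist x y) - 1))) := by
      have := continuous_t
      fun_prop
    simpa using this.tendsto y
  rw [ContinuousAt, tendsto_iff_norm_sub_tendsto_zero]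
  exact squeeze_zero (fun _ => norm_nonneg _)
    (fun x => Real.le_sqrt_of_sq_le (norm_sub_sq_le x y)) h1

lemma continuous_mk : Continuous (fun p : ℂ × ℝ => (⟨p.1, Real.exp p.2, Real.exp_pos _⟩ : H3)) := by
  rw [continuous_iff_continuousAt]
  intro q
  rw [ContinuousAt, tendsto_iff_dist_tendsto_zero]
  have : Continuous (fun p : ℂ × ℝ => dist (⟨p.1, Real.exp p.2, Real.exp_pos _⟩ : H3)
      ⟨q.1, Real.exp q.2, Real.exp_pos _⟩) := by
    refine Real.continuousOn_arcosh.comp_continuous ?_ fun p => one_le_coshDist _ _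
    unfold coshDist
    refine continuous_const.add (Continuous.div (by fun_prop) (by fun_prop) fun p => ?_)
    positivity
  simpa using this.tendsto q

/-- Coordinates on `ℍ³`. -/
noncomputable def homeo : H3 ≃ₜ ℂ × ℝ where
  toFun x := (x.z, Real.log x.t)
  invFun p := ⟨p.1, Real.exp p.2, Real.exp_pos _⟩
  left_inv x := by ext1 <;> simp [Real.exp_log x.t_pos]
  right_inv p := by simp
  continuous_toFun := continuous_z.prodMk (continuous_t.log fun x => x.t_pos.ne')
  continuous_invFun := continuous_mk

instance : ContractibleSpace H3 := homeo.contractibleSpace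

/-- On a ball the height varies by a bounded factor, and then the horizontal displacement is bounded
too. Properness supplies the compact sets for the minimization. -/
instance : ProperSpace H3 where
  isCompact_closedBall x r := by
    rcases lt_or_ge r 0 with hr | hr
    · rw [Metric.closedBall_eq_empty.mpr hr]
      exact isCompact_empty
    rw [← homeo.isCompact_image]
    set R := x.t * Real.exp r with hR
    refine (isCompact_closedBall (homeo x) (max r (√(2 * R * x.t * (Real.cosh r - 1))))).of_isClosed_subset
      (homeo.isClosedMap _ Metric.isClosed_closedBall) ?_
    rintro _ ⟨y, hy, rfl⟩
    rw [Metric.mem_closedBall] at hy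
    rw [Metric.mem_closedBall, Prod.dist_eq, max_comm]
    refine max_le_max ?_ ?_
    · rw [Real.dist_eq]
      exact (abs_log_sub_log_le y x).trans hy
    · rw [dist_eq_norm]
      refine Real.le_sqrt_of_sq_le ((norm_sub_sq_le y x).trans ?_)
      have hx := x.t_pos
      have hyp := y.t_pos
      have h1 : y.t ≤ R := by
        have := (abs_le.mp ((abs_log_sub_log_le y x).trans hy)).2
        rw [hR, ← Real.exp_log hx, ← Real.exp_add, ← Real.log_le_iff_le_exp hyp]
        linarith
      have h2 : Real.cosh (dist y x) ≤ Real.cosh r := by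
        rw [Real.cosh_le_cosh, abs_of_nonneg dist_nonneg, abs_of_nonneg hr]
        exact hy
      have h3 := Real.one_le_cosh (dist y x)
      have h4 : 0 ≤ Real.cosh (dist y x) - 1 := by linarith
      gcongr

end H3
end Carrier

namespace Carrier

open ComplexConjugate Matrix

/-! ### Eisenstein integers -/

/-- The ring `ℤ[ω]` of Eisenstein integers, with `ω² = -1 - ω`. -/
abbrev Eisenstein := QuadraticAlgebra ℤ (-1) (-1)

namespace Eisenstein

lemma omega_eq : Carrier.omega = ⟨-1 / 2, √3 / 2⟩ := by
  have h : 2 * Real.pi * Complex.I / 3 = ((2 * Real.pi / 3 : ℝ) : ℂ) * Complex.I := by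
    push_cast; ring
  rw [Carrier.omega, h]
  have h3 : 2 * Real.pi / 3 = Real.pi - Real.pi / 3 := by ring
  apply Complex.ext
  · rw [Complex.exp_ofReal_mul_I_re, h3, Real.cos_pi_sub, Real.cos_pi_div_three]; norm_num
  · rw [Complex.exp_ofReal_mul_I_im, h3, Real.sin_pi_sub, Real.sin_pi_div_three]

lemma omega_mul_omega : Carrier.omega * Carrier.omega = -1 - Carrier.omega := by
  have h3 : √3 * √3 = 3 := Real.mul_self_sqrt (by norm_num)
  rw [omega_eq]
  apply Complex.ext
  · simp; nlinarith
  · simp; nlinarith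

lemma conj_omega : conj Carrier.omega = -1 - Carrier.omega := by
  rw [omega_eq]
  apply Complex.ext
  · simp; norm_num
  · simp

/-- The embedding of the Eisenstein integers into `ℂ`. -/
noncomputable def toComplex : Eisenstein →+* ℂ :=
  (QuadraticAlgebra.lift ⟨Carrier.omega, by
    rw [omega_mul_omega]; simp; ring⟩ : Eisenstein →ₐ[ℤ] ℂ).toRingHom

lemma toComplex_apply (x : Eisenstein) : toComplex x = x.re + x.im * Carrier.omega := by
  change x.re • (1 : ℂ) + x.im • Carrier.omega = _
  simp

lemma normSq_toComplex (x : Eisenstein) : Complex.normSq (toComplex x) = x.norm := by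
  have h3 : √3 * √3 = 3 := Real.mul_self_sqrt (by norm_num)
  rw [toComplex_apply, omega_eq, Complex.normSq_apply, QuadraticAlgebra.norm_def]
  push_cast
  simp
  linear_combination (x.im : ℝ) ^ 2 / 4 * h3

lemma norm_toComplex_sq (x : Eisenstein) : ‖toComplex x‖ ^ 2 = x.norm := by
  rw [← Complex.normSq_eq_norm_sq, normSq_toComplex]

lemma norm_nonneg (x : Eisenstein) : 0 ≤ x.norm := by
  have := Complex.normSq_nonneg (toComplex x)
  rw [normSq_toComplex] at this
  exact_mod_cast this

lemma norm_eq_zero {x : Eisenstein} (h : x.norm = 0) : x = 0 := by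
  rw [QuadraticAlgebra.norm_def] at h
  have h2 : (2 * x.re - x.im) ^ 2 + 3 * x.im ^ 2 = 0 := by linear_combination 4 * h
  have hi : x.im = 0 := by
    have := sq_nonneg (2 * x.re - x.im)
    have := sq_nonneg x.im
    exact pow_eq_zero_iff two_ne_zero |>.mp (by linarith)
  rw [hi] at h2
  have hr : x.re = 0 := by
    have : x.re ^ 2 = 0 := by linarith
    exact pow_eq_zero_iff two_ne_zero |>.mp this
  ext <;> simpa

lemma toComplex_injective : Function.Injective toComplex := by
  rw [injective_iff_map_eq_zero]
  intro x hx
  have := normSq_toComplex x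
  rw [hx, map_zero] at this
  exact norm_eq_zero (by exact_mod_cast this.symm)

/-- The norm is a positive integer. This gap at zero is what controls the cusp in
`t_le_of_dist_smul_le`. -/
lemma one_le_norm_toComplex {x : Eisenstein} (hx : x ≠ 0) : 1 ≤ ‖toComplex x‖ := by
  have h1 : (1 : ℤ) ≤ x.norm :=
    Int.add_one_le_iff.mpr (lt_of_le_of_ne (norm_nonneg x) fun h => hx (norm_eq_zero h.symm))
  have h2 : (1 : ℝ) ≤ ‖toComplex x‖ ^ 2 := by
    rw [norm_toComplex_sq]; exact_mod_cast h1
  nlinarith [_root_.norm_nonneg (toComplex x)]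

lemma finite_norm_toComplex_le (K : ℝ) : {x : Eisenstein | ‖toComplex x‖ ≤ K}.Finite := by
  obtain ⟨N, hN⟩ := exists_nat_ge (2 * K ^ 2)
  have hfin : ((Set.Icc (-N : ℤ) N) ×ˢ (Set.Icc (-N : ℤ) N)).Finite :=
    (Set.finite_Icc _ _).prod (Set.finite_Icc _ _)
  refine (hfin.preimage (f := fun x : Eisenstein => (x.re, x.im)) ?_).subset ?_
  · intro x _ y _ h
    simp only [Prod.mk.injEq] at h
    exact QuadraticAlgebra.ext h.1 h.2
  · intro x hx
    have h1 : (x.norm : ℝ) ≤ K ^ 2 := by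
      rw [← norm_toComplex_sq]
      exact pow_le_pow_left₀ (_root_.norm_nonneg _) hx 2
    have h2 : 2 * x.norm ≤ (N : ℤ) := by
      have : (2 * x.norm : ℝ) ≤ N := by linarith
      exact_mod_cast this
    have h3 : x.re ^ 2 + x.im ^ 2 ≤ 2 * x.norm := by
      rw [QuadraticAlgebra.norm_def]
      nlinarith [sq_nonneg (x.re - x.im)]
    have h4 : ∀ a : ℤ, a ≤ a ^ 2 ∧ -a ≤ a ^ 2 := fun a => by
      have := Int.le_self_sq a
      have := Int.le_self_sq (-a)
      rw [neg_sq] at this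
      exact ⟨by assumption, this⟩
    have := h4 x.re
    have := h4 x.im
    have := sq_nonneg x.re
    have := sq_nonneg x.im
    simp only [Set.mem_preimage, Set.mem_prod, Set.mem_Icc]
    omega

lemma toComplex_star (x : Eisenstein) : toComplex (star x) = conj (toComplex x) := by
  rw [toComplex_apply, toComplex_apply, map_add, map_mul, conj_omega]
  simp
  ring

/-- Every complex number is within distance `√3/2` of an Eisenstein integer. -/
lemma exists_norm_sub_sq_le (z : ℂ) : ∃ x : Eisenstein, ‖z - toComplex x‖ ^ 2 ≤ 3 / 4 := by
  have h3 : √3 * √3 = 3 := Real.mul_self_sqrt (by norm_num)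
  have h3' : 0 < √3 := by positivity
  -- u and v are the coordinates of z in the real basis 1, ω. After rounding, the error has norm p²
  -- - pq + q² with |p|, |q| ≤ 1/2.
  set v := 2 * z.im / √3 with hv
  set u := z.re + v / 2 with hu
  refine ⟨⟨round u, round v⟩, ?_⟩
  have e1 := abs_le.mp (abs_sub_round u)
  have e2 := abs_le.mp (abs_sub_round v)
  set p := u - round u
  set q := v - round v
  have hre : (z - toComplex ⟨round u, round v⟩).re = p - q / 2 := by
    rw [toComplex_apply, omega_eq]
    simp [p, q, hu]
    ring
  have him : (z - toComplex ⟨round u, round v⟩).im = √3 / 2 * q := by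
    rw [toComplex_apply, omega_eq]
    simp [q, hv]
    field_simp
  have hp : p ^ 2 ≤ 1 / 4 := by nlinarith
  have hq : q ^ 2 ≤ 1 / 4 := by nlinarith
  have hpq : (√3 / 2 * q) ^ 2 = 3 / 4 * q ^ 2 := by linear_combination q ^ 2 / 4 * h3
  rw [H3.norm_sq_eq, hre, him, hpq]
  nlinarith [sq_nonneg (p + q)]

/-- If `x` divides `a² + 1`, then the norm of `x` is not `3` modulo `4`. -/
lemma norm_emod_four_ne_three {a x y : Eisenstein} (h : x * y = -(a * a + 1)) :
    x.norm % 4 ≠ 3 := by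
  intro hx
  -- Split off the content, x = n(p + qω) with p, q coprime. Then n²m is 3 modulo 4, hence so is m,
  -- the norm of p + qω; it remains to see that m is a sum of two squares.
  set n := Int.gcd x.re x.im with hn
  have hn0 : n ≠ 0 := by
    intro h0
    rw [hn, Int.gcd_eq_zero_iff] at h0
    rw [QuadraticAlgebra.norm_def, h0.1, h0.2] at hx
    simp at hx
  obtain ⟨p, hp⟩ : (n : ℤ) ∣ x.re := Int.gcd_dvd_left ..
  obtain ⟨q, hq⟩ : (n : ℤ) ∣ x.im := Int.gcd_dvd_right ..
  have hcop : IsCoprime p q := by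
    rw [Int.isCoprime_iff_gcd_eq_one]
    have h1 : n = n * Int.gcd p q := by
      conv_lhs => rw [hn, hp, hq, Int.gcd_mul_left]
      simp
    exact (Nat.eq_of_mul_eq_mul_left (Nat.pos_of_ne_zero hn0) (by omega)).symm
  set m : ℤ := p * p - p * q + q * q with hm
  have hxm : x.norm = n * n * m := by
    rw [QuadraticAlgebra.norm_def, hp, hq, hm]; ring
  have hm3 : m % 4 = 3 := by
    rw [hxm, Int.mul_emod, Int.mul_emod (n : ℤ)] at hx
    have h1 : (n : ℤ) % 4 = 0 ∨ (n : ℤ) % 4 = 1 ∨ (n : ℤ) % 4 = 2 ∨ (n : ℤ) % 4 = 3 := by omega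
    rcases h1 with h1 | h1 | h1 | h1 <;> rw [h1] at hx <;> omega
  have hm0 : 0 ≤ m := by nlinarith [sq_nonneg (p - q), sq_nonneg p, sq_nonneg q]
  obtain ⟨k, hk⟩ := Int.eq_ofNat_of_zero_le hm0
  have hmk : (p * p - p * q + q * q : ZMod k) = 0 := by
    have : ((m : ℤ) : ZMod k) = 0 := by rw [hk]; simp
    rw [hm] at this
    push_cast at this
    exact this
  obtain ⟨r, s, hrs⟩ := hcop.pow (m := 2) (n := 1)
  -- Modulo k, p² = q(p - q), so the Bézout relation between p² and q becomes a multiple of q.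
  have hu : ∃ v : ZMod k, (q : ZMod k) * v = 1 := by
    refine ⟨s + r * (p - q), ?_⟩
    have h1 : ((r * p ^ 2 + s * q ^ 1 : ℤ) : ZMod k) = 1 := by rw [hrs]; simp
    push_cast at h1
    linear_combination h1 - (r : ZMod k) * hmk
  obtain ⟨v, hv⟩ := hu
  -- Reduction with ω ↦ -p/q, a root of T² + T + 1 modulo k. It kills x, so the divisibility makes
  -- -1 the square of the image of a.
  let φ : Eisenstein →ₐ[ℤ] ZMod k := QuadraticAlgebra.lift ⟨-(p * v), by
    have : ((p : ZMod k) * v) * (p * v) - p * v + 1 = 0 := by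
      linear_combination v * v * hmk + (p * v - q * v - 1) * hv
    simp
    linear_combination this⟩
  have hφ : ∀ z : Eisenstein, φ z = z.re + z.im * -(p * v) := by
    intro z
    change z.re • (1 : ZMod k) + z.im • (-(p * v) : ZMod k) = _
    simp
  have hφx : φ x = 0 := by
    rw [hφ, hp, hq]
    push_cast
    linear_combination (-(n : ZMod k) * p) * hv
  have hsq : IsSquare (-1 : ZMod k) := by
    refine ⟨φ a, ?_⟩
    have := congrArg φ h
    rw [map_mul, hφx, map_neg, map_add, map_mul, map_one] at this
    linear_combination -this
  obtain ⟨c, d, hcd⟩ := Nat.eq_sq_add_sq_of_isSquare_mod_neg_one hsq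
  have : k % 4 = 3 := by omega
  rw [hcd, Nat.add_mod, Nat.pow_mod, Nat.pow_mod d] at this
  have h1 : c % 4 < 4 := Nat.mod_lt _ (by norm_num)
  have h2 : d % 4 < 4 := Nat.mod_lt _ (by norm_num)
  interval_cases c % 4 <;> interval_cases d % 4 <;> omega

end Eisenstein
end Carrier

namespace Carrier

open ComplexConjugate Matrix

/-! ### The figure-8 group modulo four -/

namespace Eisenstein

/-- The residue of an Eisenstein integer modulo `4`, coded as a number below `16`. -/
def residue (x : Eisenstein) : ℕ := (x.re : ZMod 4).val + 4 * (x.im : ZMod 4).val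

/-- Addition of residues. -/
def resAdd (p q : ℕ) : ℕ := (p % 4 + q % 4) % 4 + 4 * ((p / 4 + q / 4) % 4)

/-- Multiplication of residues. -/
def resMul (p q : ℕ) : ℕ :=
  (p % 4 * (q % 4) + 3 * (p / 4 * (q / 4))) % 4 +
    4 * ((p % 4 * (q / 4) + p / 4 * (q % 4) + 3 * (p / 4 * (q / 4))) % 4)

/-- Conjugation of residues. -/
def resStar (p : ℕ) : ℕ := (p % 4 + 3 * (p / 4)) % 4 + 4 * (3 * (p / 4) % 4)

/-- Norm of residues. -/
def resNorm (p : ℕ) : ℕ := (p % 4 * (p % 4) + 3 * (p % 4 * (p / 4)) + p / 4 * (p / 4)) % 4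

lemma residue_mod (x : Eisenstein) : residue x % 4 = (x.re : ZMod 4).val := by
  have := ZMod.val_lt (x.re : ZMod 4)
  rw [residue]; omega

lemma residue_div (x : Eisenstein) : residue x / 4 = (x.im : ZMod 4).val := by
  have := ZMod.val_lt (x.re : ZMod 4)
  rw [residue]; omega

lemma val_eq {a : ℤ} {n : ℕ} (h : (a : ZMod 4) = n) : (a : ZMod 4).val = n % 4 := by
  rw [h, ZMod.val_natCast]

lemma four_eq : (4 : ZMod 4) = 0 := rfl

lemma residue_add (x y : Eisenstein) : residue (x + y) = resAdd (residue x) (residue y) := by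
  rw [resAdd, residue_mod, residue_mod, residue_div, residue_div, residue]
  congr 2
  · exact val_eq (by simp)
  · exact val_eq (by simp)

lemma residue_mul (x y : Eisenstein) : residue (x * y) = resMul (residue x) (residue y) := by
  rw [resMul, residue_mod, residue_mod, residue_div, residue_div, residue]
  congr 2
  · refine val_eq ?_
    simp
    linear_combination (-(x.im : ZMod 4) * y.im) * four_eq
  · refine val_eq ?_
    simp
    linear_combination (-(x.im : ZMod 4) * y.im) * four_eq

lemma residue_star (x : Eisenstein) : residue (star x) = resStar (residue x) := by
  rw [resStar, residue_mod, residue_div, residue]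
  congr 2
  · refine val_eq ?_
    simp
    linear_combination (-(x.im : ZMod 4)) * four_eq
  · refine val_eq ?_
    simp
    linear_combination (-(x.im : ZMod 4)) * four_eq

lemma norm_emod_four (x : Eisenstein) : x.norm % 4 = resNorm (residue x) := by
  rw [resNorm, residue_mod, residue_div]
  rw [← val_eq (a := x.norm)]
  · exact (ZMod.val_intCast x.norm).symm
  · rw [QuadraticAlgebra.norm_def]
    simp
    linear_combination (-(x.re : ZMod 4) * x.im) * four_eq

end Eisenstein

open Eisenstein

/-- The code of a `2 × 2` matrix of residues. -/
def matCode (a b c d : ℕ) : ℕ := ((a * 16 + b) * 16 + c) * 16 + d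

/-- The code of a matrix modulo `4`. -/
def codeSL (g : SL(2, Eisenstein)) : ℕ :=
  matCode (residue (g 0 0)) (residue (g 0 1)) (residue (g 1 0)) (residue (g 1 1))

/-- The codes of the elements of the figure-8 group modulo `4`. -/
def figureEightCodes : List ℕ := [
  1106, 1111, 1112, 1117, 1744, 1751, 1754, 1757, 3314, 3319, 3320, 3325, 3696, 3703, 3706, 3709,
  4097, 4161, 4225, 4289, 4353, 4421, 4489, 4557, 4609, 4681, 4737, 4809, 4865, 4941, 5001, 5061,
  6177, 6251, 6305, 6379, 6435, 6509, 6571, 6629, 6689, 6755, 6817, 6883, 6947, 7013, 7083, 7149,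
  9296, 9306, 9429, 9439, 9813, 9823, 9938, 9944, 11381, 11391, 11504, 11514, 11890, 11896, 12021,
  12031, 12291, 12355, 12419, 12483, 12547, 12623, 12683, 12743, 12803, 12875, 12931, 13003,
  13059, 13127, 13195, 13263, 14371, 14441, 14499, 14569, 14625, 14695, 14761, 14831, 14883,
  14945, 15011, 15073, 15137, 15215, 15273, 15335, 20801, 20829, 20841, 20853, 21441, 21461,
  21481, 21501, 21709, 21714, 21735, 21752, 22085, 22098, 22127, 22136, 22985, 23007, 23009,
  23031, 23369, 23383, 23393, 23423, 23629, 23640, 23655, 23666, 24261, 24280, 24303, 24306,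
  29023, 29047, 29123, 29163, 29507, 29547, 29655, 29695, 29776, 29818, 29903, 29925, 30279,
  30317, 30416, 30458, 31051, 31075, 31197, 31221, 31573, 31613, 31691, 31715, 31823, 31845,
  31962, 31984, 32346, 32368, 32455, 32493, 33872, 33882, 34037, 34047, 34421, 34431, 34514,
  34520, 35925, 35935, 36080, 36090, 36466, 36472, 36565, 36575, 36905, 36937, 37033, 37065,
  37129, 37221, 37249, 37357, 37417, 37441, 37545, 37569, 37641, 37741, 37761, 37861, 38921,
  39011, 39049, 39139, 39211, 39245, 39331, 39365, 39433, 39531, 39561, 39659, 39723, 39749,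
  39843, 39885, 42066, 42072, 42103, 42109, 42704, 42714, 42743, 42749, 44247, 44253, 44274,
  44280, 44631, 44637, 44656, 44666, 45099, 45131, 45227, 45259, 45323, 45423, 45443, 45543,
  45611, 45635, 45739, 45763, 45835, 45927, 45955, 46063, 47115, 47201, 47243, 47329, 47401,
  47431, 47521, 47567, 47627, 47721, 47755, 47849, 47913, 47951, 48033, 48071, 53589, 53629,
  53697, 53737, 54081, 54121, 54237, 54261, 54352, 54394, 54469, 54511, 54861, 54887, 54992,
  55034, 55625, 55649, 55767, 55807, 56159, 56183, 56265, 56289, 56389, 56431, 56538, 56560,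
  56922, 56944, 57037, 57063, 61763, 61783, 61803, 61823, 62403, 62431, 62443, 62455, 62663,
  62674, 62701, 62712, 63055, 63058, 63077, 63096, 63947, 63957, 63971, 63997, 64331, 64349,
  64355, 64373, 64583, 64600, 64621, 64626, 65231, 65240, 65253, 65266]

/-- The properties of the codes of the elements of the figure-8 group: closed under right
multiplication by the generators; trace not `±1`; trace `0` only with an entry of norm `3`;
`(g T) conj (g T) ≠ ±1` where `T` is the translation by `ω`. -/
def CodeSpec (m : ℕ) : Prop :=
  let a := m / 4096
  let b := m / 256 % 16
  let c := m / 16 % 16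
  let d := m % 16
  let b' := resAdd (resMul a 4) b
  let d' := resAdd (resMul c 4) d
  matCode a (resAdd a b) c (resAdd c d) ∈ figureEightCodes ∧
  matCode (resAdd a (resMul b 12)) b (resAdd c (resMul d 12)) d ∈ figureEightCodes ∧
  resAdd a d ≠ 1 ∧ resAdd a d ≠ 3 ∧
  (resAdd a d = 0 → resNorm b = 3 ∨ resNorm c = 3) ∧
  ¬ (resAdd (resMul a (resStar b')) (resMul b' (resStar d')) = 0 ∧
    resAdd (resMul c (resStar a)) (resMul d' (resStar c)) = 0 ∧
    resAdd (resMul c (resStar b')) (resMul d' (resStar d')) =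
      resAdd (resMul a (resStar a)) (resMul b' (resStar c)))

instance (m : ℕ) : Decidable (CodeSpec m) := by unfold CodeSpec; infer_instance

-- A finite check in the kernel. It supplies all the congruence information modulo 4 needed both for
-- freeness and for the glide reflection.
set_option maxRecDepth 100000 in
lemma codeSpec_of_mem : ∀ m ∈ figureEightCodes, CodeSpec m := by
  decide +kernel

end Carrier

/-! ### The figure-8 group as a group of matrices over the Eisenstein integers -/

namespace Carrier

open ComplexConjugate Matrix Eisenstein

/-- The embedding of `SL(2, ℤ[ω])` into `SL(2, ℂ)`. -/
noncomputable def embSL : SL(2, Eisenstein) →* SL(2, ℂ) := SpecialLinearGroup.map toComplex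

lemma embSL_apply (g : SL(2, Eisenstein)) (i j : Fin 2) : embSL g i j = toComplex (g i j) := rfl

/-- The element with the given entries. -/
def mkSL (a b c d : Eisenstein) (h : a * d - b * c = 1) : SL(2, Eisenstein) :=
  ⟨!![a, b; c, d], by rw [det_fin_two_of, h]⟩

/-- The first generator of the figure-8 group. -/
def genA : SL(2, Eisenstein) := mkSL 1 1 0 1 (by simp)

/-- The second generator of the figure-8 group. -/
def genB : SL(2, Eisenstein) := mkSL 1 0 ⟨0, -1⟩ 1 (by simp)

/-- The figure-8 group as a group of matrices over the Eisenstein integers. -/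
def eisensteinGroup : Subgroup SL(2, Eisenstein) := Subgroup.closure {genA, genB}

lemma genA_mem : genA ∈ eisensteinGroup := Subgroup.subset_closure (by simp)

lemma genB_mem : genB ∈ eisensteinGroup := Subgroup.subset_closure (by simp)

lemma map_eisensteinGroup : eisensteinGroup.map embSL = figureEightGroup := by
  rw [eisensteinGroup, figureEightGroup, MonoidHom.map_closure, Set.image_pair]
  congr 2
  · ext i j
    rw [embSL_apply]
    fin_cases i <;> fin_cases j <;> simp [genA, mkSL]
  · congr 1
    ext i j
    rw [embSL_apply]
    have h : toComplex ⟨0, -1⟩ = -omega := by simp [toComplex_apply]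
    fin_cases i <;> fin_cases j <;> simp [genB, mkSL, h]

lemma det_eisenstein (g : SL(2, Eisenstein)) : g 0 0 * g 1 1 - g 0 1 * g 1 0 = 1 := by
  rw [← det_fin_two, g.det_coe]

lemma SL_ext {R : Type*} [CommRing R] {g h : SL(2, R)} (h00 : g 0 0 = h 0 0) (h01 : g 0 1 = h 0 1)
    (h10 : g 1 0 = h 1 0) (h11 : g 1 1 = h 1 1) : g = h := by
  ext i j
  fin_cases i <;> fin_cases j
  exacts [h00, h01, h10, h11]

lemma residue_lt (x : Eisenstein) : residue x < 16 := by
  have := ZMod.val_lt (x.re : ZMod 4)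
  have := ZMod.val_lt (x.im : ZMod 4)
  rw [residue]; omega

lemma codeSL_decode (g : SL(2, Eisenstein)) :
    codeSL g / 4096 = residue (g 0 0) ∧ codeSL g / 256 % 16 = residue (g 0 1) ∧
      codeSL g / 16 % 16 = residue (g 1 0) ∧ codeSL g % 16 = residue (g 1 1) := by
  have := residue_lt (g 0 0)
  have := residue_lt (g 0 1)
  have := residue_lt (g 1 0)
  have := residue_lt (g 1 1)
  rw [codeSL, matCode]
  omega

lemma SL_mul_apply {R : Type*} [CommRing R] (g h : SL(2, R)) (i j : Fin 2) :
    (g * h) i j = g i 0 * h 0 j + g i 1 * h 1 j := by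
  change (g.1 * h.1) i j = _
  rw [mul_apply, Fin.sum_univ_two]

lemma SL_inv_apply {R : Type*} [CommRing R] (g : SL(2, R)) :
    g⁻¹ 0 0 = g 1 1 ∧ g⁻¹ 0 1 = -g 0 1 ∧ g⁻¹ 1 0 = -g 1 0 ∧ g⁻¹ 1 1 = g 0 0 := by
  rw [SpecialLinearGroup.SL2_inv_expl]
  simp

lemma codeSL_mul_genA_mem {g : SL(2, Eisenstein)} (hg : codeSL g ∈ figureEightCodes) :
    codeSL (g * genA) ∈ figureEightCodes := by
  have h := (codeSpec_of_mem _ hg).1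
  obtain ⟨h1, h2, h3, h4⟩ := codeSL_decode g
  rw [h1, h2, h3, h4, ← residue_add, ← residue_add] at h
  rw [codeSL]
  simp only [SL_mul_apply]
  simpa [genA, mkSL] using h

lemma codeSL_mul_genB_mem {g : SL(2, Eisenstein)} (hg : codeSL g ∈ figureEightCodes) :
    codeSL (g * genB) ∈ figureEightCodes := by
  have h := (codeSpec_of_mem _ hg).2.1
  obtain ⟨h1, h2, h3, h4⟩ := codeSL_decode g
  have h12 : residue ⟨0, -1⟩ = 12 := by decide
  rw [h1, h2, h3, h4, ← h12, ← residue_mul, ← residue_mul, ← residue_add, ← residue_add] at h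
  rw [codeSL]
  simp only [SL_mul_apply]
  simpa [genB, mkSL] using h

/-- The code depends only on the entries modulo `4`. -/
lemma codeSL_congr {g h : SL(2, Eisenstein)}
    (H : ∀ i j, residue (g i j) = residue (h i j)) : codeSL g = codeSL h := by
  rw [codeSL, codeSL, H, H, H, H]

/-- The list contains the identity and is closed under right multiplication by the generators.
Inverses need no separate check: the generators are unipotent, so modulo 4 the inverse is the cube.
-/
lemma codeSL_mem (g : SL(2, Eisenstein)) (hg : g ∈ eisensteinGroup) :
    codeSL g ∈ figureEightCodes := by
  have hmod : ∀ (g h k : SL(2, Eisenstein)), (∀ i j, residue (h i j) = residue (k i j)) →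
      codeSL (g * h) = codeSL (g * k) := fun g h k H => codeSL_congr fun i j => by
    rw [SL_mul_apply, SL_mul_apply, residue_add, residue_add, residue_mul, residue_mul,
      residue_mul, residue_mul, H, H]
  induction hg using Subgroup.closure_induction_right with
  | one =>
    have : codeSL 1 = 4097 := by decide
    rw [this]
    decide
  | mul_right x hx y hy ih =>
    rcases hy with rfl | rfl
    · exact codeSL_mul_genA_mem ih
    · exact codeSL_mul_genB_mem ih
  | mul_inv_cancel x hx y hy ih =>
    rcases hy with rfl | rfl
    · rw [hmod x genA⁻¹ (genA * genA * genA) (by decide), ← mul_assoc, ← mul_assoc]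
      exact codeSL_mul_genA_mem (codeSL_mul_genA_mem (codeSL_mul_genA_mem ih))
    · rw [hmod x genB⁻¹ (genB * genB * genB) (by decide), ← mul_assoc, ← mul_assoc]
      exact codeSL_mul_genB_mem (codeSL_mul_genB_mem (codeSL_mul_genB_mem ih))

/-! ### Fixed points -/

namespace H3

/-- The base point `(0, 1)`. -/
def j : H3 := ⟨0, 1, one_pos⟩

lemma herm_j : herm j = 1 := by
  ext i k
  fin_cases i <;> fin_cases k <;> simp [herm, j]

lemma exists_smul_j (x : H3) : ∃ g : SL(2, ℂ), g • j = x := by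
  have ht : 0 < √x.t := Real.sqrt_pos.mpr x.t_pos
  have ht2 : √x.t ^ 2 = x.t := Real.sq_sqrt x.t_pos.le
  have ht' : ((√x.t : ℝ) : ℂ) ≠ 0 := by exact_mod_cast ht.ne'
  refine ⟨⟨!![(√x.t : ℂ), x.z / √x.t; 0, 1 / √x.t], ?_⟩, ?_⟩
  · rw [det_fin_two_of]
    field_simp
    simp
  · change mobius _ _ = _
    ext1
    · simp [mobius, j]
      field_simp
    · simp [mobius, j, abs_of_pos ht, ht2]

lemma neg_one_smul (x : H3) : (-1 : SL(2, ℂ)) • x = x := by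
  apply herm_injective
  rw [smul_def, herm_mobius]
  simp

/-- An element with a fixed point is `±1` or its trace is real and of absolute value below `2`. -/
lemma trace_of_smul_eq {g : SL(2, ℂ)} {x : H3} (h : g • x = x) :
    g = 1 ∨ g = -1 ∨ ∃ r : ℝ, |r| < 2 ∧ g 0 0 + g 1 1 = r := by
  obtain ⟨P, rfl⟩ := exists_smul_j x
  -- Conjugation moves the fixed point to `j`, whose stabilizer is SU(2). There the trace is twice
  -- the real part of u₀₀, and |u₀₀|² + |u₁₀|² = 1.
  set u := P⁻¹ * g * P with hu
  have huj : u • j = j := by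
    rw [hu, mul_smul, mul_smul, h, inv_smul_smul]
  have hg : g = P * u * P⁻¹ := by rw [hu]; group
  have htr : g 0 0 + g 1 1 = u 0 0 + u 1 1 := by
    have h1 : g * P = P * u := by rw [hg]; group
    have h2 : (g.1 * P.1) = P.1 * u.1 := congrArg Subtype.val h1
    have h3 : P.1 * (P⁻¹).1 = 1 := congrArg Subtype.val (mul_inv_cancel P)
    have h4 : (P⁻¹).1 * P.1 = 1 := congrArg Subtype.val (inv_mul_cancel P)
    change g.1 0 0 + g.1 1 1 = u.1 0 0 + u.1 1 1
    rw [← trace_fin_two, ← trace_fin_two, ← Matrix.mul_one g.1, ← h3, ← Matrix.mul_assoc, h2,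
      trace_mul_comm, ← Matrix.mul_assoc, h4, Matrix.one_mul]
  have h1 : u.1 * u.1ᴴ = 1 := by
    have := herm_mobius u j
    rw [← smul_def, huj, herm_j] at this
    simpa using this.symm
  have h2 : u.1ᴴ = adjugate u.1 := by
    have h3 : adjugate u.1 * u.1 = 1 := by rw [adjugate_mul, u.det_coe]; simp
    calc u.1ᴴ = adjugate u.1 * u.1 * u.1ᴴ := by rw [h3, Matrix.one_mul]
      _ = adjugate u.1 := by rw [Matrix.mul_assoc, h1, Matrix.mul_one]
  rw [adjugate_fin_two] at h2
  have e00 : conj (u 0 0) = u 1 1 := by simpa using congr_fun (congr_fun h2 0) 0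
  have e10 : conj (u 1 0) = -u 0 1 := by simpa using congr_fun (congr_fun h2 0) 1
  have hn : ‖u 0 0‖ ^ 2 + ‖u 1 0‖ ^ 2 = 1 := by
    have := det_SL u
    rw [← e00, show u 0 1 = -conj (u 1 0) by rw [e10, neg_neg]] at this
    have h4 := ofReal_norm_sq (u 0 0)
    have h5 := ofReal_norm_sq (u 1 0)
    have h6 : ((‖u 0 0‖ ^ 2 + ‖u 1 0‖ ^ 2 : ℝ) : ℂ) = 1 := by
      rw [Complex.ofReal_add, h4, h5]
      linear_combination this
    exact_mod_cast h6
  rw [norm_sq_eq, norm_sq_eq] at hn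
  have htr2 : g 0 0 + g 1 1 = ((2 * (u 0 0).re : ℝ) : ℂ) := by
    rw [htr, ← e00, Complex.add_conj]
  by_cases hr : |2 * (u 0 0).re| < 2
  · exact Or.inr (Or.inr ⟨_, hr, htr2⟩)
  -- If the trace has absolute value at least 2, the real part of u₀₀ uses up the whole unit vector,
  -- and u is ±1.
  · have h4 : 1 ≤ (u 0 0).re ^ 2 := by
      rw [abs_mul, abs_two, not_lt] at hr
      rw [← sq_abs]
      nlinarith
    have p1 := sq_nonneg (u 0 0).im
    have p2 := sq_nonneg (u 1 0).re
    have p3 := sq_nonneg (u 1 0).im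
    have q1 : (u 0 0).im = 0 := pow_eq_zero_iff two_ne_zero |>.mp (by linarith)
    have q2 : (u 1 0).re = 0 := pow_eq_zero_iff two_ne_zero |>.mp (by linarith)
    have q3 : (u 1 0).im = 0 := pow_eq_zero_iff two_ne_zero |>.mp (by linarith)
    have q4 : u 1 0 = 0 := Complex.ext q2 q3
    have q5 : u 0 1 = 0 := by rw [q4, map_zero] at e10; exact neg_eq_zero.mp e10.symm
    have q6 : (u 0 0).re ^ 2 = 1 := by linarith
    rcases sq_eq_sq_iff_eq_or_eq_neg.mp (q6.trans (one_pow 2).symm) with q7 | q7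
    · have q8 : u 0 0 = 1 := Complex.ext q7 q1
      left
      have : u = 1 := SL_ext (by simp [q8]) (by simp [q5]) (by simp [q4]) (by simp [← e00, q8])
      rw [hg, this]; simp
    · have q8 : u 0 0 = -1 := Complex.ext (by simp [q7]) (by simp [q1])
      right; left
      have : u = -1 := SL_ext (by simp [q8]) (by simp [q5]) (by simp [q4]) (by simp [← e00, q8])
      rw [hg, this]; simp

end H3

/-- The figure-8 group acts freely on `ℍ³`, up to sign. -/
lemma eq_one_or_neg_one_of_smul_eq {g : SL(2, Eisenstein)} (hg : g ∈ eisensteinGroup) {x : H3}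
    (h : embSL g • x = x) : g = 1 ∨ g = -1 := by
  have hinj : Function.Injective embSL := by
    intro g h hgh
    have H : ∀ i j, g i j = h i j := fun i j =>
      toComplex_injective (by rw [← embSL_apply, ← embSL_apply, hgh])
    exact SL_ext (H _ _) (H _ _) (H _ _) (H _ _)
  rcases H3.trace_of_smul_eq h with h1 | h1 | ⟨r, hr, h1⟩
  · exact Or.inl (hinj (by rw [h1, map_one]))
  · refine Or.inr (hinj ?_)
    rw [h1]
    refine SL_ext ?_ ?_ ?_ ?_ <;> simp [embSL_apply]
  · exfalso
    rw [embSL_apply, embSL_apply, ← map_add] at h1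
    set s := g 0 0 + g 1 1 with hs
    rw [toComplex_apply, omega_eq] at h1
    have him : s.im = 0 := by
      have h2 := congrArg Complex.im h1
      simpa using h2
    have hre : (s.re : ℝ) = r := by
      have h2 := congrArg Complex.re h1
      simpa [him] using h2
    rw [← hre] at hr
    have hr' : |s.re| < 2 := by exact_mod_cast hr
    rw [abs_lt] at hr'
    obtain ⟨-, -, c1, c2, c3, -⟩ := codeSpec_of_mem _ (codeSL_mem g hg)
    obtain ⟨d1, d2, d3, d4⟩ := codeSL_decode g
    rw [d1, d4, ← residue_add, ← hs] at c1 c2 c3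
    rw [d2, d3] at c3
    have hres : residue s = (s.re : ZMod 4).val := by rw [residue, him]; simp
    rw [hres] at c1 c2 c3
    -- A real Eisenstein integer is a rational integer, so only three traces remain.
    have hcases : s.re = -1 ∨ s.re = 0 ∨ s.re = 1 := by omega
    rcases hcases with h2 | h2 | h2
    · rw [h2] at c2; exact c2 (by decide)
    · have hs0 : s = 0 := by ext <;> simp [h2, him]
      -- For trace zero the determinant says bc = -(a² + 1), while the code forces b or c to have
      -- norm 3 modulo 4.
      have hd : g 1 1 = -g 0 0 := by rw [eq_neg_iff_add_eq_zero, add_comm, ← hs, hs0]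
      have hdet := det_eisenstein g
      rw [hd] at hdet
      rcases c3 (by rw [h2]; decide) with h3 | h3
      · refine norm_emod_four_ne_three (a := g 0 0) (x := g 0 1) (y := g 1 0)
          (by linear_combination -hdet) ?_
        rw [norm_emod_four, h3]; rfl
      · refine norm_emod_four_ne_three (a := g 0 0) (x := g 1 0) (y := g 0 1)
          (by linear_combination -hdet) ?_
        rw [norm_emod_four, h3]; rfl
    · rw [h2] at c1; exact c1 (by decide)

end Carrier

/-! ### The action of SL(2, ℤ[ω]) on ℍ³ -/

namespace Carrier

open ComplexConjugate Matrix Eisenstein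

section

variable {a b c d : Eisenstein} (h : a * d - b * c = 1)

lemma mkSL_zero_zero : mkSL a b c d h 0 0 = a := rfl
lemma mkSL_zero_one : mkSL a b c d h 0 1 = b := rfl
lemma mkSL_one_zero : mkSL a b c d h 1 0 = c := rfl
lemma mkSL_one_one : mkSL a b c d h 1 1 = d := rfl

end

/-- `SL(2, ℤ[ω])` acts on `ℍ³`. -/
noncomputable instance : MulAction SL(2, Eisenstein) H3 := MulAction.compHom H3 embSL

lemma eis_smul_def (g : SL(2, Eisenstein)) (x : H3) : g • x = embSL g • x := rfl

instance : IsIsometricSMul SL(2, Eisenstein) H3 :=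
  ⟨fun g => isometry_smul H3 (embSL g)⟩

/-! ### An orientation-reversing symmetry -/

/-- Entrywise conjugation. -/
def starSL : SL(2, Eisenstein) →* SL(2, Eisenstein) :=
  SpecialLinearGroup.map (starRingEnd Eisenstein)

lemma starSL_apply (g : SL(2, Eisenstein)) (i j : Fin 2) : starSL g i j = star (g i j) := rfl

lemma conjSL_embSL (g : SL(2, Eisenstein)) : H3.conjSL (embSL g) = embSL (starSL g) := by
  have h : ∀ i j, H3.conjSL (embSL g) i j = embSL (starSL g) i j := fun i j => by
    rw [embSL_apply, starSL_apply, toComplex_star, ← embSL_apply]; rfl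
  exact SL_ext (h _ _) (h _ _) (h _ _) (h _ _)

lemma conjH_eis_smul (g : SL(2, Eisenstein)) (x : H3) :
    H3.conjH (g • x) = starSL g • H3.conjH x := by
  rw [eis_smul_def, H3.conjH_smul, conjSL_embSL, eis_smul_def]

/-- The translation by `ω`. -/
def transOmega : SL(2, Eisenstein) := mkSL 1 ⟨0, 1⟩ 0 1 (by simp)

/-- The orientation-reversing isometry `(z, t) ↦ (conj z + ω, t)`. -/
noncomputable def glide (x : H3) : H3 := transOmega • H3.conjH x

lemma dist_glide (x y : H3) : dist (glide x) (glide y) = dist x y := by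
  rw [glide, glide, dist_smul]
  exact H3.conjIso.isometry.dist_eq x y

/-- Because ω + conj ω = -1. Hence the square of the glide reflection is an element of the figure-8
group. -/
lemma transOmega_mul_star : transOmega * starSL transOmega = genA⁻¹ :=
  SL_ext (by decide) (by decide) (by decide) (by decide)

lemma glide_glide (x : H3) : glide (glide x) = genA⁻¹ • x := by
  rw [glide, glide, conjH_eis_smul, H3.conjH_conjH, ← mul_smul, transOmega_mul_star]

/-- The automorphism induced by conjugation with the glide reflection. -/
def glideConj : SL(2, Eisenstein) →* SL(2, Eisenstein) :=
  (MulAut.conj transOmega).toMonoidHom.comp starSL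

lemma glideConj_apply (g : SL(2, Eisenstein)) :
    glideConj g = transOmega * starSL g * transOmega⁻¹ := rfl

lemma glide_smul (g : SL(2, Eisenstein)) (x : H3) : glide (g • x) = glideConj g • glide x := by
  rw [glide, glide, conjH_eis_smul, glideConj_apply, mul_smul, mul_smul, inv_smul_smul]

/-- This lets the glide reflection descend to the quotient. It suffices to write the images of the
two generators as words in the generators. -/
lemma glideConj_mem {g : SL(2, Eisenstein)} (hg : g ∈ eisensteinGroup) :
    glideConj g ∈ eisensteinGroup := by
  have hle : eisensteinGroup ≤ eisensteinGroup.comap glideConj := by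
    rw [eisensteinGroup, Subgroup.closure_le]
    rintro _ (rfl | rfl)
    · have : glideConj genA = genA := SL_ext (by decide) (by decide) (by decide) (by decide)
      change glideConj genA ∈ eisensteinGroup
      rw [this]
      exact genA_mem
    · have : glideConj genB = genA⁻¹ * genB * genA * genB⁻¹ * genA :=
        SL_ext (by decide) (by decide) (by decide) (by decide)
      change glideConj genB ∈ eisensteinGroup
      rw [this]
      have ha := genA_mem
      have hb := genB_mem
      exact mul_mem (mul_mem (mul_mem (mul_mem (inv_mem ha) hb) ha) (inv_mem hb)) ha
  exact hle hg

/-- With n = g⁻¹T, a coincidence says that n composed with conjugation fixes x, so n · conj n fixes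
x. This product lies in the group, so it is ±1 by freeness; but modulo 4 it is never scalar. -/
lemma glide_ne_smul {g : SL(2, Eisenstein)} (hg : g ∈ eisensteinGroup) (x : H3) :
    glide x ≠ g • x := by
  intro hx
  set m := g⁻¹ with hm
  have hmem : m ∈ eisensteinGroup := inv_mem hg
  set n := m * transOmega with hn
  have h1 : x = n • H3.conjH x := by
    rw [hn, mul_smul, hm, ← glide, hx, inv_smul_smul]
  have h2 : (n * starSL n) • x = x := by
    have h3 : H3.conjH x = starSL n • x := by
      conv_lhs => rw [h1, conjH_eis_smul, H3.conjH_conjH]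
    rw [mul_smul, ← h3, ← h1]
  have hmem2 : n * starSL n ∈ eisensteinGroup := by
    have : n * starSL n = m * glideConj m * genA⁻¹ := by
      rw [← transOmega_mul_star, glideConj_apply, hn, map_mul]
      group
    rw [this]
    exact mul_mem (mul_mem hmem (glideConj_mem hmem)) (inv_mem genA_mem)
  obtain ⟨-, -, -, -, -, c⟩ := codeSpec_of_mem _ (codeSL_mem m hmem)
  obtain ⟨d1, d2, d3, d4⟩ := codeSL_decode m
  rw [d1, d2, d3, d4] at c
  have hT : n 0 0 = m 0 0 ∧ n 0 1 = m 0 0 * ⟨0, 1⟩ + m 0 1 ∧ n 1 0 = m 1 0 ∧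
      n 1 1 = m 1 0 * ⟨0, 1⟩ + m 1 1 := by
    rw [hn]
    simp only [SL_mul_apply]
    simp [transOmega, mkSL]
  have h4 : residue ⟨0, 1⟩ = 4 := by decide
  obtain ⟨e1, e2, e3, e4⟩ := hT
  rw [← h4] at c
  simp only [← residue_mul, ← residue_add, ← residue_star, ← e2, ← e4] at c
  rw [← e1, ← e3] at c
  simp only [← starSL_apply, ← SL_mul_apply] at c
  rcases eq_one_or_neg_one_of_smul_eq hmem2 h2 with h | h
  · rw [h] at c
    exact c ⟨by decide, by decide, by decide⟩
  · rw [h] at c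
    exact c ⟨by decide, by decide, by decide⟩

/-! ### Discreteness and reduction -/

lemma H3.coshDist_smul_j (g : SL(2, ℂ)) : coshDist (g • j) j =
    (‖g 0 0‖ ^ 2 + ‖g 0 1‖ ^ 2 + ‖g 1 0‖ ^ 2 + ‖g 1 1‖ ^ 2) / 2 := by
  have h : (coshDist (g • j) j : ℂ) =
      ((‖g 0 0‖ ^ 2 + ‖g 0 1‖ ^ 2 + ‖g 1 0‖ ^ 2 + ‖g 1 1‖ ^ 2) / 2 : ℝ) := by
    have h0 : adjugate (1 : Matrix (Fin 2) (Fin 2) ℂ) = 1 := by simp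
    rw [coshDist_eq_trace, smul_def, herm_mobius, herm_j, h0, Matrix.mul_one, Matrix.mul_one,
      trace_fin_two, mul_apply, mul_apply, Fin.sum_univ_two, Fin.sum_univ_two,
      Complex.ofReal_div, Complex.ofReal_add, Complex.ofReal_add, Complex.ofReal_add,
      ofReal_norm_sq, ofReal_norm_sq, ofReal_norm_sq, ofReal_norm_sq]
    simp
    ring
  exact_mod_cast h

/-- Proper discontinuity: by `H3.coshDist_smul_j` the displacement of `j` bounds all four entries,
and Eisenstein integers of bounded size are finitely many. -/
lemma finite_dist_smul_le (x y : H3) (R : ℝ) :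
    {g : SL(2, Eisenstein) | dist x (g • y) ≤ R}.Finite := by
  set R' := R + dist x H3.j + dist y H3.j with hR'
  set K := √(2 * Real.cosh R') with hK
  have hF := finite_norm_toComplex_le K
  have hinj : Function.Injective (fun g : SL(2, Eisenstein) => (g 0 0, g 0 1, g 1 0, g 1 1)) := by
    intro g h hgh
    simp only [Prod.mk.injEq] at hgh
    exact SL_ext hgh.1 hgh.2.1 hgh.2.2.1 hgh.2.2.2
  refine ((hF.prod (hF.prod (hF.prod hF))).preimage
    (f := fun g : SL(2, Eisenstein) => (g 0 0, g 0 1, g 1 0, g 1 1)) hinj.injOn).subset ?_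
  intro g hg
  have hd : dist (g • H3.j) H3.j ≤ R' := by
    have h1 : dist (g • H3.j) (g • y) = dist y H3.j := by rw [dist_smul, dist_comm]
    have h2 := dist_triangle (g • H3.j) (g • y) H3.j
    have h3 := dist_triangle (g • y) x H3.j
    have h4 : dist (g • y) x ≤ R := by rw [dist_comm]; exact hg
    linarith
  have hc : H3.coshDist (g • H3.j) H3.j ≤ Real.cosh R' := by
    rw [← H3.cosh_dist, Real.cosh_le_cosh, abs_of_nonneg dist_nonneg]
    exact hd.trans (le_abs_self _)
  rw [eis_smul_def, H3.coshDist_smul_j] at hc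
  have p1 := sq_nonneg ‖embSL g 0 0‖
  have p2 := sq_nonneg ‖embSL g 0 1‖
  have p3 := sq_nonneg ‖embSL g 1 0‖
  have p4 := sq_nonneg ‖embSL g 1 1‖
  refine ⟨?_, ?_, ?_, ?_⟩
  all_goals
    change ‖toComplex _‖ ≤ K
    rw [← embSL_apply]
    exact Real.le_sqrt_of_sq_le (by linarith)

lemma H3.coshDist_j (y : H3) : coshDist j y = (‖y.z‖ ^ 2 + y.t ^ 2 + 1) / (2 * y.t) := by
  have := y.t_pos.ne'
  rw [coshDist]
  simp only [j, zero_sub, norm_neg]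
  field_simp
  ring

/-- The inversion. -/
def inversion : SL(2, Eisenstein) := mkSL 0 (-1) 1 0 (by simp)

lemma norm_sq_add_inversion (y : H3) :
    ‖(inversion • y).z‖ ^ 2 + (inversion • y).t ^ 2 = 1 / (‖y.z‖ ^ 2 + y.t ^ 2) := by
  have hD : 0 < ‖y.z‖ ^ 2 + y.t ^ 2 := by have := y.t_pos; positivity
  have h1 : (inversion • y).t = y.t / (‖y.z‖ ^ 2 + y.t ^ 2) := by
    rw [eis_smul_def, H3.smul_def]
    simp [H3.mobius, embSL_apply, inversion, mkSL_zero_zero, mkSL_zero_one, mkSL_one_zero,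
      mkSL_one_one]
  have h2 : ‖(inversion • y).z‖ = ‖y.z‖ / (‖y.z‖ ^ 2 + y.t ^ 2) := by
    rw [eis_smul_def, H3.smul_def]
    simp only [H3.mobius, embSL_apply, inversion, mkSL_zero_zero, mkSL_zero_one, mkSL_one_zero,
      mkSL_one_one]
    simp only [map_zero,
      map_one, zero_mul, one_mul, zero_add, add_zero, norm_one, one_pow, map_neg, neg_mul]
    rw [norm_div, norm_neg, RCLike.norm_conj, Complex.norm_real, Real.norm_of_nonneg hD.le]
  rw [h1, h2]
  field_simp

/-- Take an orbit point closest to `j`. Comparison with translates bounds |z|² by 3/4. If |z|² + t²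
≥ 1, the height is at least 1/2; otherwise apply the inversion, which fixes `j`, so minimality
persists, and inverts |z|² + t². -/
lemma exists_smul_mem_fundamental (x : H3) :
    ∃ g : SL(2, Eisenstein), ‖(g • x).z‖ ≤ 1 ∧ 1 / 2 ≤ (g • x).t := by
  obtain ⟨g, hg, hmin⟩ := Set.exists_min_image {g : SL(2, Eisenstein) | dist H3.j (g • x) ≤
    dist H3.j x} (fun g => dist H3.j (g • x)) (finite_dist_smul_le _ _ _) ⟨1, by simp⟩
  have hmin' : ∀ h : SL(2, Eisenstein), dist H3.j (g • x) ≤ dist H3.j (h • x) := by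
    intro h
    by_cases hh : dist H3.j (h • x) ≤ dist H3.j x
    · exact hmin h hh
    · exact hg.trans (not_le.mp hh).le
  have key : ∀ y : H3, (∀ h : SL(2, Eisenstein), dist H3.j y ≤ dist H3.j (h • y)) →
      ‖y.z‖ ^ 2 ≤ 3 / 4 := by
    intro y hy
    obtain ⟨β, hβ⟩ := exists_norm_sub_sq_le y.z
    have h1 := hy (mkSL 1 (-β) 0 1 (by simp))
    have h2 : mkSL 1 (-β) 0 1 (by simp) • y = (⟨y.z - toComplex β, y.t, y.t_pos⟩ : H3) := by
      rw [eis_smul_def, H3.smul_def]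
      ext1
      · simp [H3.mobius, embSL_apply, mkSL_zero_zero, mkSL_zero_one, mkSL_one_zero,
          mkSL_one_one, sub_eq_add_neg]
      · simp [H3.mobius, embSL_apply, mkSL_zero_zero, mkSL_zero_one, mkSL_one_zero,
          mkSL_one_one]
    rw [h2, H3.dist_def, H3.dist_def, Real.arcosh_le_arcosh
      (zero_lt_one.trans_le (H3.one_le_coshDist _ _))
      (zero_lt_one.trans_le (H3.one_le_coshDist _ _)), H3.coshDist_j, H3.coshDist_j] at h1
    have ht := y.t_pos
    rw [div_le_div_iff_of_pos_right (by positivity)] at h1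
    dsimp only at h1
    linarith
  have fin : ∀ y : H3, (∀ h : SL(2, Eisenstein), dist H3.j y ≤ dist H3.j (h • y)) →
      1 ≤ ‖y.z‖ ^ 2 + y.t ^ 2 → ‖y.z‖ ≤ 1 ∧ 1 / 2 ≤ y.t := by
    intro y hy h1
    have h2 := key y hy
    have := y.t_pos
    exact ⟨by nlinarith [norm_nonneg y.z], by nlinarith⟩
  have hy : ∀ h : SL(2, Eisenstein), dist H3.j (g • x) ≤ dist H3.j (h • g • x) := fun h => by
    rw [← mul_smul]; exact hmin' _
  by_cases h1 : 1 ≤ ‖(g • x).z‖ ^ 2 + (g • x).t ^ 2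
  · exact ⟨g, fin _ hy h1⟩
  · refine ⟨inversion * g, ?_⟩
    rw [mul_smul]
    refine fin _ (fun h => ?_) ?_
    · have h2 : dist H3.j (inversion • g • x) = dist H3.j (g • x) := by
        have h3 : inversion • H3.j = H3.j := by
          rw [eis_smul_def, H3.smul_def]
          ext1 <;> simp [H3.mobius, embSL_apply, inversion, mkSL_zero_zero, mkSL_zero_one,
            mkSL_one_zero, mkSL_one_one, H3.j]
        conv_lhs => rw [← h3, dist_smul]
      rw [h2, ← mul_smul]
      exact hy _
    · rw [norm_sq_add_inversion, le_div_iff₀ (by have := (g • x).t_pos; positivity)]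
      linarith

/-- Elements moving a point high in the cusp by a bounded amount fix the cusp. -/
lemma t_le_of_dist_smul_le {g : SL(2, Eisenstein)} (hg : g 1 0 ≠ 0) {y : H3} {R : ℝ}
    (h : dist y (g • y) ≤ R) : y.t ≤ Real.exp R := by
  have ht := y.t_pos
  have hc := one_le_norm_toComplex hg
  -- Since the lower left entry has absolute value at least 1, g inverts large heights; but
  -- log-height is 1-Lipschitz, so 2 log t ≤ R.
  have h1 : (g • y).t ≤ 1 / y.t := by
    rw [eis_smul_def, H3.smul_def]
    simp only [H3.mobius, embSL_apply]
    have h2 : y.t ^ 2 ≤ ‖toComplex (g 1 0) * y.z + toComplex (g 1 1)‖ ^ 2 +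
        ‖toComplex (g 1 0)‖ ^ 2 * y.t ^ 2 := by
      have : 1 ≤ ‖toComplex (g 1 0)‖ ^ 2 := one_le_pow₀ hc
      nlinarith [sq_nonneg ‖toComplex (g 1 0) * y.z + toComplex (g 1 1)‖, sq_nonneg y.t]
    calc _ ≤ y.t / y.t ^ 2 := by gcongr
      _ = 1 / y.t := by field_simp
  have h2 := (abs_le.mp ((H3.abs_log_sub_log_le y (g • y)).trans h)).2
  have h3 : Real.log (g • y).t ≤ -Real.log y.t := by
    rw [← Real.log_inv, inv_eq_one_div]
    exact Real.log_le_log (g • y).t_pos h1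
  have h4 : 0 ≤ R := dist_nonneg.trans h
  rw [← Real.log_le_iff_le_exp ht]
  linarith

/-- No conjugate of the figure-8 group is upper triangular. -/
lemma exists_conj_lower_ne_zero (k : SL(2, Eisenstein)) :
    ∃ g ∈ eisensteinGroup, (k * g * k⁻¹) 1 0 ≠ 0 := by
  by_contra! hk
  have hA := hk _ genA_mem
  have hB := hk _ genB_mem
  have hdet := det_eisenstein k
  simp only [SL_mul_apply, SL_inv_apply] at hA hB
  simp [genA, genB, mkSL] at hA hB
  -- For bottom row (r, s) of k, the lower left entries of the two conjugated generators are -r²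
  -- and, once r = 0, -ωs². Both vanishing contradicts the determinant.
  have hr : k 1 0 = 0 := by
    have : k 1 0 * k 1 0 = 0 := by linear_combination -hA
    have h2 : (k 1 0).norm * (k 1 0).norm = 0 := by rw [← map_mul, this]; simp
    exact norm_eq_zero (mul_self_eq_zero.mp h2)
  have hs : k 1 1 = 0 := by
    rw [hr] at hB
    have h2 : (k 1 1).norm * (k 1 1).norm = 0 := by
      have : k 1 1 * ⟨0, -1⟩ * k 1 1 = 0 := by linear_combination hB
      have := congrArg QuadraticAlgebra.norm this
      rw [map_mul, map_mul] at this
      have h3 : QuadraticAlgebra.norm (⟨0, -1⟩ : Eisenstein) = 1 := by decide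
      rw [h3] at this
      simpa using this
    exact norm_eq_zero (mul_self_eq_zero.mp h2)
  rw [hr, hs] at hdet
  simp at hdet

end Carrier

namespace Carrier

/-! ### Quotients of metric spaces by free discrete isometric actions -/

/-- The action is isometric, free, and orbits are uniformly discrete. -/
class FreeIsometricAction (G E : Type*) [Group G] [MetricSpace E] [MulAction G E] : Prop
    extends IsIsometricSMul G E where
  exists_le_dist : ∀ x : E, ∃ δ : ℝ, 0 < δ ∧ ∀ g : G, g ≠ 1 → δ ≤ dist x (g • x)

/-- The space of orbits of an action, to be endowed with the quotient metric. -/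
def OrbitSpace (G E : Type*) [Group G] [MulAction G E] := MulAction.orbitRel.Quotient G E

namespace OrbitSpace

section

variable {G E : Type*} [Group G] [MulAction G E]

/-- The projection to the space of orbits. -/
def proj (G : Type*) {E : Type*} [Group G] [MulAction G E] (x : E) : OrbitSpace G E :=
  Quotient.mk (MulAction.orbitRel G E) x

lemma proj_surjective : Function.Surjective (proj G : E → OrbitSpace G E) := Quotient.mk_surjective

lemma proj_eq_iff {x y : E} : proj G x = proj G y ↔ ∃ g : G, y = g • x := by
  rw [eq_comm]
  refine (Quotient.eq (r := MulAction.orbitRel G E)).trans ?_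
  rw [MulAction.orbitRel_apply, MulAction.mem_orbit_iff]
  exact exists_congr fun g => eq_comm

lemma proj_smul (g : G) (x : E) : proj G (g • x) = proj G x := (proj_eq_iff.mpr ⟨g, rfl⟩).symm

end

variable {G E : Type*} [Group G] [MetricSpace E] [MulAction G E]

lemma bddBelow_dist (x y : E) : BddBelow (Set.range fun g : G => dist x (g • y)) :=
  ⟨0, by rintro _ ⟨g, rfl⟩; exact dist_nonneg⟩

variable [FreeIsometricAction G E]

lemma iInf_dist_smul (a b : G) (x y : E) :
    ⨅ g : G, dist (a • x) (g • b • y) = ⨅ g : G, dist x (g • y) := by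
  have : ∀ g : G, dist (a • x) (g • b • y) = dist x ((a⁻¹ * g * b) • y) := fun g => by
    rw [← dist_smul a x, ← mul_smul, ← mul_smul]
    congr 2
    group
  simp_rw [this]
  exact (((Equiv.mulLeft a⁻¹).trans (Equiv.mulRight b)).iInf_comp
    (g := fun g : G => dist x (g • y)))

noncomputable instance : Dist (OrbitSpace G E) where
  dist := Quotient.lift₂ (fun x y => ⨅ g : G, dist x (g • y)) (by
    rintro x y _ _ ⟨a, rfl⟩ ⟨b, rfl⟩
    exact iInf_dist_smul a b _ _)

lemma dist_proj (x y : E) : dist (proj G x) (proj G y) = ⨅ g : G, dist x (g • y) := rfl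

lemma dist_proj_le_smul (x y : E) (g : G) : dist (proj G x) (proj G y) ≤ dist x (g • y) :=
  ciInf_le (bddBelow_dist x y) g

lemma dist_proj_le (x y : E) : dist (proj G x) (proj G y) ≤ dist x y := by
  simpa using dist_proj_le_smul (G := G) x y 1

lemma exists_dist_smul_lt {x y : E} {r : ℝ} (h : dist (proj G x) (proj G y) < r) :
    ∃ g : G, dist x (g • y) < r := exists_lt_of_ciInf_lt h

lemma le_dist_smul_smul {y : E} {δ : ℝ} (h : ∀ g : G, g ≠ 1 → δ ≤ dist y (g • y)) {g g' : G}
    (hg : g ≠ g') : δ ≤ dist (g • y) (g' • y) := by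
  have : dist (g • y) (g' • y) = dist y ((g⁻¹ * g') • y) := by
    rw [← dist_smul g⁻¹, inv_smul_smul, mul_smul]
  rw [this]
  exact h _ fun h1 => hg (inv_mul_eq_one.mp h1)

noncomputable instance : MetricSpace (OrbitSpace G E) where
  dist_self := by
    intro a
    obtain ⟨x, rfl⟩ := proj_surjective a
    refine le_antisymm ?_ (Real.iInf_nonneg fun _ => dist_nonneg)
    simpa using dist_proj_le (G := G) x x
  dist_comm := by
    intro a b
    obtain ⟨x, rfl⟩ := proj_surjective a
    obtain ⟨y, rfl⟩ := proj_surjective b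
    have : ∀ x y : E, dist (proj G x) (proj G y) ≤ dist (proj G y) (proj G x) := fun x y => by
      refine le_ciInf fun g => (dist_proj_le_smul x y g⁻¹).trans ?_
      rw [← dist_smul g, smul_inv_smul, dist_comm]
    exact le_antisymm (this _ _) (this _ _)
  dist_triangle := by
    intro a b c
    obtain ⟨x, rfl⟩ := proj_surjective a
    obtain ⟨y, rfl⟩ := proj_surjective b
    obtain ⟨z, rfl⟩ := proj_surjective c
    refine le_of_forall_pos_lt_add fun ε hε => ?_
    obtain ⟨g, hg⟩ := exists_dist_smul_lt (show dist (proj G x) (proj G y) <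
      dist (proj G x) (proj G y) + ε / 2 by linarith)
    obtain ⟨g', hg'⟩ := exists_dist_smul_lt (show dist (proj G y) (proj G z) <
      dist (proj G y) (proj G z) + ε / 2 by linarith)
    have h1 := dist_proj_le_smul x z (g * g')
    have h2 := dist_triangle x (g • y) ((g * g') • z)
    rw [mul_smul, dist_smul, ← mul_smul] at h2
    linarith
  eq_of_dist_eq_zero := by
    intro a b h
    obtain ⟨x, rfl⟩ := proj_surjective a
    obtain ⟨y, rfl⟩ := proj_surjective b
    -- If the infimum 0 were not attained at g, a strictly closer second translate would lie within
    -- δ of the first.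
    obtain ⟨δ, hδ, hy⟩ := FreeIsometricAction.exists_le_dist (G := G) y
    obtain ⟨g, hg⟩ := exists_dist_smul_lt (h.trans_lt (half_pos hδ))
    rcases eq_or_ne x (g • y) with hxy | hxy
    · rw [hxy, proj_smul]
    · exfalso
      have hpos := dist_pos.mpr hxy
      obtain ⟨g', hg'⟩ := exists_dist_smul_lt (h.trans_lt hpos)
      have hne : g ≠ g' := by rintro rfl; exact lt_irrefl _ hg'
      have := le_dist_smul_smul hy hne
      have := dist_triangle_left (g • y) (g' • y) x
      linarith

lemma lipschitzWith_proj : LipschitzWith 1 (proj G : E → OrbitSpace G E) :=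
  LipschitzWith.of_dist_le_mul fun x y => by simpa using dist_proj_le x y

lemma continuous_proj : Continuous (proj G : E → OrbitSpace G E) := lipschitzWith_proj.continuous

lemma image_ball (x : E) (r : ℝ) : proj G '' Metric.ball x r = Metric.ball (proj G x) r := by
  apply Set.Subset.antisymm
  · rintro _ ⟨y, hy, rfl⟩
    exact (dist_proj_le _ _).trans_lt hy
  · intro b hb
    obtain ⟨y, rfl⟩ := proj_surjective b
    rw [Metric.mem_ball, dist_comm] at hb
    obtain ⟨g, hg⟩ := exists_dist_smul_lt hb
    exact ⟨g • y, by rwa [Metric.mem_ball, dist_comm], proj_smul _ _⟩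

lemma isOpenMap_proj : IsOpenMap (proj G : E → OrbitSpace G E) := by
  intro U hU
  rw [Metric.isOpen_iff]
  rintro _ ⟨x, hx, rfl⟩
  obtain ⟨r, hr, h⟩ := Metric.isOpen_iff.mp hU x hx
  exact ⟨r, hr, by rw [← image_ball]; exact Set.image_mono h⟩

/-- The projection is isometric on small balls. -/
lemma exists_isometric_ball (x : E) : ∃ r : ℝ, 0 < r ∧ ∀ a ∈ Metric.ball x r,
    ∀ b ∈ Metric.ball x r, dist (proj G a) (proj G b) = dist a b := by
  obtain ⟨δ, hδ, h⟩ := FreeIsometricAction.exists_le_dist (G := G) x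
  refine ⟨δ / 4, by positivity, fun a ha b hb => le_antisymm (dist_proj_le _ _) ?_⟩
  refine le_ciInf fun g => ?_
  rcases eq_or_ne g 1 with rfl | hg
  · simp
  · have h1 := h g hg
    have h2 := dist_triangle4 x a (g • b) (g • x)
    rw [dist_smul] at h2
    have h3 := dist_triangle_right a b x
    rw [Metric.mem_ball] at ha hb
    rw [dist_comm] at ha
    rw [dist_comm a x] at h3
    linarith

/-- A ball of radius δ/2 is disjoint from its nontrivial translates. Path lifting and the
computation of the fundamental group rest on this. -/
theorem isQuotientCoveringMap : IsQuotientCoveringMap (proj G : E → OrbitSpace G E) G where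
  toIsQuotientMap := (isOpenMap_proj.isQuotientMap continuous_proj proj_surjective)
  continuous_const_smul g := (isometry_smul E g).continuous
  apply_eq_iff_mem_orbit {x y} := by
    rw [eq_comm, proj_eq_iff, MulAction.mem_orbit_iff]
    exact exists_congr fun g => eq_comm
  disjoint x := by
    obtain ⟨δ, hδ, h⟩ := FreeIsometricAction.exists_le_dist (G := G) x
    refine ⟨Metric.ball x (δ / 2), Metric.ball_mem_nhds _ (by positivity), fun g hg => ?_⟩
    by_contra hne
    obtain ⟨_, ⟨y, hy, rfl⟩, hz⟩ := hg
    have h1 := h g hne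
    have h2 := dist_triangle x (g • y) (g • x)
    rw [dist_smul] at h2
    rw [Metric.mem_ball] at hy hz
    rw [dist_comm] at hz
    linarith

/-- A rapidly Cauchy sequence is lifted term by term, each lift chosen close to the preceding one;
the lifts converge and the limit projects. -/
instance [CompleteSpace E] : CompleteSpace (OrbitSpace G E) := by
  refine Metric.complete_of_convergent_controlled_sequences (fun n => (1 / 2 : ℝ) ^ n)
    (fun n => by positivity) fun u hu => ?_
  have step : ∀ (n : ℕ) (x : {x : E // proj G x = u n}), ∃ y : {y : E // proj G y = u (n + 1)},
      dist x.1 y.1 ≤ (1 / 2 : ℝ) ^ n := by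
    rintro n ⟨x, hx⟩
    obtain ⟨y, hy⟩ := proj_surjective (u (n + 1))
    have h1 := hu n n (n + 1) le_rfl (Nat.le_succ n)
    rw [← hx, ← hy] at h1
    obtain ⟨g, hg⟩ := exists_dist_smul_lt h1
    exact ⟨⟨g • y, by rw [proj_smul, hy]⟩, hg.le⟩
  choose next hnext using step
  obtain ⟨x0, hx0⟩ := proj_surjective (u 0)
  let v : ∀ n, {x : E // proj G x = u n} := fun n =>
    Nat.rec (motive := fun n => {x : E // proj G x = u n}) ⟨x0, hx0⟩ (fun n x => next n x) n
  have hv : ∀ n, dist (v n).1 (v (n + 1)).1 ≤ 1 * (1 / 2 : ℝ) ^ n := fun n => by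
    rw [one_mul]; exact hnext n (v n)
  have hc : CauchySeq fun n => (v n).1 := cauchySeq_of_le_geometric _ _ (by norm_num) hv
  obtain ⟨a, ha⟩ := cauchySeq_tendsto_of_complete hc
  refine ⟨proj G a, ?_⟩
  have := (continuous_proj (G := G)).continuousAt.tendsto.comp ha
  refine this.congr fun n => (v n).2

end OrbitSpace

/-! ### The figure-8 knot complement -/

/-- The action of an element of `SL(2, ℤ[ω])` as an isometry. -/
noncomputable def toIsometry : SL(2, Eisenstein) →* (H3 ≃ᵢ H3) where
  toFun g := IsometryEquiv.constSMul g
  map_one' := by ext1 x; exact one_smul SL(2, Eisenstein) x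
  map_mul' g h := by ext1 x; exact mul_smul g h x

lemma toIsometry_apply (g : SL(2, Eisenstein)) (x : H3) : toIsometry g x = g • x := rfl

/-- The figure-8 group as a group of isometries of `ℍ³`. -/
noncomputable def isometryGroup : Subgroup (H3 ≃ᵢ H3) := eisensteinGroup.map toIsometry

noncomputable instance : MulAction isometryGroup H3 where
  smul g x := g.1 x
  one_smul _ := rfl
  mul_smul _ _ _ := rfl

/-- The isometry given by an element of the figure-8 group. -/
noncomputable def toIsometryGroup (g : SL(2, Eisenstein)) (hg : g ∈ eisensteinGroup) :
    isometryGroup := ⟨toIsometry g, Subgroup.mem_map_of_mem _ hg⟩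

lemma toIsometryGroup_smul (g : SL(2, Eisenstein)) (hg : g ∈ eisensteinGroup) (x : H3) :
    toIsometryGroup g hg • x = g • x := rfl

lemma exists_eq_toIsometryGroup (g : isometryGroup) : ∃ k, ∃ hk : k ∈ eisensteinGroup,
    g = toIsometryGroup k hk := by
  obtain ⟨_, k, hk, rfl⟩ := g
  exact ⟨k, hk, rfl⟩

/-- Passing from matrices to isometries identifies g with -g, so freeness up to sign becomes
freeness. -/
lemma isometryGroup_eq_one {g : isometryGroup} {x : H3} (h : g • x = x) : g = 1 := by
  obtain ⟨k, hk, rfl⟩ := exists_eq_toIsometryGroup g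
  apply Subtype.ext
  ext1 y
  change embSL k • y = y
  rcases eq_one_or_neg_one_of_smul_eq hk h with rfl | rfl
  · rw [map_one, one_smul]
  · have : embSL (-1) = -1 := by refine SL_ext ?_ ?_ ?_ ?_ <;> simp [embSL_apply]
    rw [this, H3.neg_one_smul]

/-- Only finitely many elements displace x by at most 1, so the nonzero displacements have a
positive minimum. -/
instance : FreeIsometricAction isometryGroup H3 where
  isometry_smul g := g.1.isometry
  exists_le_dist x := by
    set S := {g : SL(2, Eisenstein) | dist x (g • x) ≤ 1} ∩
      {g | g • x ≠ x} with hS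
    have hfin : S.Finite := (finite_dist_smul_le x x 1).subset Set.inter_subset_left
    have key : ∃ δ : ℝ, 0 < δ ∧ δ ≤ 1 ∧ ∀ g ∈ S, δ ≤ dist x (g • x) := by
      rcases S.eq_empty_or_nonempty with h | h
      · exact ⟨1, one_pos, le_rfl, by simp [h]⟩
      · obtain ⟨g, hg, hmin⟩ := Set.exists_min_image S (fun g => dist x (g • x)) hfin h
        exact ⟨_, dist_pos.mpr (Ne.symm hg.2), hg.1, hmin⟩
    obtain ⟨δ, h0, h1, hδ⟩ := key
    refine ⟨δ, h0, fun g hg => ?_⟩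
    by_contra! hlt
    obtain ⟨k, hk, rfl⟩ := exists_eq_toIsometryGroup g
    have hne : k • x ≠ x := fun h => hg (isometryGroup_eq_one (x := x) h)
    exact absurd (hδ k ⟨(hlt.trans_le h1).le, hne⟩) (not_le.mpr hlt)

/-- The figure-8 knot complement. -/
abbrev FigureEight := OrbitSpace isometryGroup H3

open OrbitSpace

theorem isFigureEightComplement : IsFigureEightComplement FigureEight := by
  have key : ∀ (g : SL(2, ℂ)), g ∈ figureEightGroup → ∃ k : isometryGroup,
      ∀ x : H3, k • x = H3.mobius g x := by
    intro g hg
    rw [← map_eisensteinGroup] at hg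
    obtain ⟨k, hk, rfl⟩ := hg
    exact ⟨toIsometryGroup k hk, fun x => rfl⟩
  have key' : ∀ k : isometryGroup, ∃ g ∈ figureEightGroup, ∀ x : H3, k • x = H3.mobius g x := by
    intro k
    obtain ⟨k, hk, rfl⟩ := exists_eq_toIsometryGroup k
    refine ⟨embSL k, ?_, fun x => rfl⟩
    rw [← map_eisensteinGroup]
    exact Subgroup.mem_map_of_mem _ hk
  refine ⟨proj isometryGroup, proj_surjective, fun x y => ?_, fun x y => ?_⟩
  · rw [proj_eq_iff]
    constructor
    · rintro ⟨g, rfl⟩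
      obtain ⟨k, hk, h⟩ := key' g
      exact ⟨k, hk, h x⟩
    · rintro ⟨g, hg, rfl⟩
      obtain ⟨k, h⟩ := key g hg
      exact ⟨k, (h x).symm⟩
  · rw [dist_proj]
    apply le_antisymm
    · refine le_ciInf fun g => ?_
      obtain ⟨k, h⟩ := key g.1 g.2
      rw [← h]
      exact ciInf_le (bddBelow_dist x y) k
    · refine le_ciInf fun k => ?_
      obtain ⟨g, hg, h⟩ := key' k
      rw [h]
      exact ciInf_le (f := fun g : figureEightGroup => dist x (H3.mobius g y))
        ⟨0, by rintro _ ⟨g, rfl⟩; exact dist_nonneg⟩ ⟨g, hg⟩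

/-- Charts are inverses of the projection on small balls. For the path metric, project a geodesic to
an almost nearest translate; the projection does not increase length. -/
theorem isHyperbolic3Manifold_figureEight : IsHyperbolic3Manifold FigureEight where
  connected := proj_surjective.connectedSpace continuous_proj
  complete := inferInstance
  locally_hyperbolic a := by
    obtain ⟨x, rfl⟩ := proj_surjective a
    obtain ⟨r, hr, h⟩ := exists_isometric_ball (G := isometryGroup) x
    refine ⟨r, x, hr, ⟨IsometryEquiv.symm ⟨Equiv.ofBijective (fun y => ⟨proj _ y.1, ?_⟩)
      ⟨?_, ?_⟩, ?_⟩⟩⟩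
    · rw [← image_ball]
      exact Set.mem_image_of_mem _ y.2
    · intro y z hyz
      have := congrArg Subtype.val hyz
      apply Subtype.ext
      rw [← dist_eq_zero, ← h _ y.2 _ z.2, dist_eq_zero]
      exact this
    · rintro ⟨b, hb⟩
      rw [← image_ball] at hb
      obtain ⟨y, hy, rfl⟩ := hb
      exact ⟨⟨y, hy⟩, rfl⟩
    · exact Isometry.of_dist_eq fun y z => h _ y.2 _ z.2
  length_metric a b ε hε := by
    obtain ⟨x, rfl⟩ := proj_surjective a
    obtain ⟨y, rfl⟩ := proj_surjective b
    obtain ⟨g, hg⟩ := exists_dist_smul_lt (lt_add_of_pos_right (dist (proj isometryGroup x)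
      (proj isometryGroup y)) hε)
    obtain ⟨γ, hγ⟩ := H3.exists_path_eVariationOn_le x (g • y)
    refine ⟨(γ.map (continuous_proj (G := isometryGroup))).cast rfl (proj_smul g y).symm, ?_⟩
    refine le_trans ?_ (hγ.trans (ENNReal.ofReal_le_ofReal hg.le))
    have := (lipschitzWith_proj (G := isometryGroup) (E := H3)).lipschitzOnWith (s := Set.univ)
      |>.comp_eVariationOn_le (g := γ) (s := Set.univ) (fun _ _ => Set.mem_univ _)
    simpa using this

/-- The symmetry of the figure-8 knot complement induced by the glide reflection. -/
noncomputable def symmetry : FigureEight ≃ᵢ FigureEight := by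
  have hwd : ∀ x y : H3, proj isometryGroup x = proj isometryGroup y →
      proj isometryGroup (glide x) = proj isometryGroup (glide y) := by
    intro x y h
    obtain ⟨g, rfl⟩ := proj_eq_iff.mp h
    obtain ⟨k, hk, rfl⟩ := exists_eq_toIsometryGroup g
    rw [toIsometryGroup_smul, glide_smul, ← toIsometryGroup_smul _ (glideConj_mem hk), proj_smul]
  let h : FigureEight → FigureEight := Quotient.lift (fun x => proj isometryGroup (glide x))
    fun x y hxy => hwd x y (Quotient.sound hxy)
  have hh : ∀ x, h (proj isometryGroup x) = proj isometryGroup (glide x) := fun x => rfl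
  have hinv : ∀ a, h (h a) = a := by
    intro a
    obtain ⟨x, rfl⟩ := proj_surjective a
    rw [hh, hh, glide_glide, ← toIsometryGroup_smul _ (inv_mem genA_mem), proj_smul]
  have hle : ∀ a b, dist (h a) (h b) ≤ dist a b := by
    intro a b
    obtain ⟨x, rfl⟩ := proj_surjective a
    obtain ⟨y, rfl⟩ := proj_surjective b
    refine le_ciInf fun g => ?_
    rw [← proj_smul g y, hh, hh]
    exact (dist_proj_le _ _).trans (dist_glide _ _).le
  exact IsometryEquiv.mk' h h hinv (Isometry.of_dist_eq fun a b =>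
    le_antisymm (hle a b) (by simpa [hinv] using hle (h a) (h b)))

lemma symmetry_proj (x : H3) :
    symmetry (proj isometryGroup x) = proj isometryGroup (glide x) := rfl

lemma symmetry_ne (a : FigureEight) : symmetry a ≠ a := by
  obtain ⟨x, rfl⟩ := proj_surjective a
  rw [symmetry_proj, Ne, eq_comm, proj_eq_iff]
  rintro ⟨g, hg⟩
  obtain ⟨k, hk, rfl⟩ := exists_eq_toIsometryGroup g
  exact glide_ne_smul hk x hg

lemma orderOf_symmetry : orderOf symmetry = 2 := by
  refine orderOf_eq_prime ?_ fun h => symmetry_ne (proj isometryGroup H3.j) (by rw [h]; rfl)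
  ext1 a
  obtain ⟨x, rfl⟩ := proj_surjective a
  rw [sq, IsometryEquiv.mul_apply]
  change symmetry (symmetry _) = proj isometryGroup x
  rw [symmetry_proj, symmetry_proj, glide_glide, ← toIsometryGroup_smul _ (inv_mem genA_mem),
    proj_smul]

/-- The fundamental group of the figure-8 knot complement. -/
noncomputable def fundamentalGroupFigureEight (a : FigureEight) :
    FundamentalGroup FigureEight a ≃* isometryGroupᵐᵒᵖ :=
  (isQuotientCoveringMap (G := isometryGroup) (E := H3)).fundamentalGroupEquiv
    ⟨(proj_surjective a).choose, (proj_surjective a).choose_spec⟩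

end Carrier

namespace Carrier

/-! ### The rank of the figure-8 group -/

lemma HasRank.of_mulEquiv {G H : Type*} [Group G] [Group H] {n : ℕ} (h : HasRank G n)
    (e : G ≃* H) : HasRank H n := by
  obtain ⟨hG, h⟩ := h
  have hH : Group.FG H := Group.fg_of_surjective (f := e.toMonoidHom) e.surjective
  exact ⟨hH, by rw [← h]; exact (Group.rank_congr e).symm⟩

lemma HasRank.eq {G : Type*} [Group G] {n m : ℕ} (h : HasRank G n) (h' : HasRank G m) :
    n = m := by
  obtain ⟨_, h⟩ := h
  obtain ⟨_, h'⟩ := h'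
  rw [← h, ← h']

lemma commute_of_rank_le_one {G : Type*} [Group G] [Group.FG G] (h : Group.rank G ≤ 1) (a b : G) :
    a * b = b * a := by
  obtain ⟨S, hS, hcl⟩ := Group.rank_spec G
  rw [← hS, Finset.card_le_one] at h
  have : IsMulCommutative (Subgroup.closure (S : Set G)) :=
    Subgroup.isMulCommutative_closure fun x hx y hy => by
      rw [h x (by exact_mod_cast hx) y (by exact_mod_cast hy)]
  have ha : a ∈ Subgroup.closure (S : Set G) := by rw [hcl]; trivial
  have hb : b ∈ Subgroup.closure (S : Set G) := by rw [hcl]; trivial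
  exact congrArg Subtype.val (this.is_comm.comm ⟨a, ha⟩ ⟨b, hb⟩)

lemma hasRank_two_of_closure {G : Type*} [Group G] {a b : G}
    (h : Subgroup.closure {a, b} = (⊤ : Subgroup G)) (hab : a * b ≠ b * a) : HasRank G 2 := by
  classical
  have hcl : Subgroup.closure (({a, b} : Finset G) : Set G) = ⊤ := by simpa using h
  have hfg : Group.FG G := ⟨⟨{a, b}, hcl⟩⟩
  refine ⟨hfg, le_antisymm ((Group.rank_le hcl).trans Finset.card_le_two) ?_⟩
  by_contra hlt
  exact hab (commute_of_rank_le_one (by omega) a b)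

lemma closure_isometryGroup : Subgroup.closure
    {toIsometryGroup genA genA_mem, toIsometryGroup genB genB_mem} = ⊤ := by
  have hmap : ∀ g : isometryGroup, g ∈ Subgroup.closure
      {toIsometryGroup genA genA_mem, toIsometryGroup genB genB_mem} := by
    intro g
    obtain ⟨k, hk, rfl⟩ := exists_eq_toIsometryGroup g
    induction hk using Subgroup.closure_induction with
    | mem x hx =>
      rcases hx with rfl | rfl <;> exact Subgroup.subset_closure (by simp)
    | one =>
      have : toIsometryGroup 1 (one_mem _) = 1 := Subtype.ext (map_one toIsometry)
      rw [this]
      exact one_mem _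
    | mul x y hx hy h1 h2 =>
      have : toIsometryGroup (x * y) (mul_mem hx hy) =
          toIsometryGroup x hx * toIsometryGroup y hy := Subtype.ext (map_mul toIsometry x y)
      rw [this]
      exact mul_mem h1 h2
    | inv x hx h1 =>
      have : toIsometryGroup x⁻¹ (inv_mem hx) = (toIsometryGroup x hx)⁻¹ :=
        Subtype.ext (map_inv toIsometry x)
      rw [this]
      exact inv_mem h1
  exact eq_top_iff.mpr fun g _ => hmap g

/-- Rank at most one would make the group commutative. If the generators commuted as isometries,
their commutator would fix `j` and be ±1, which its upper left entry contradicts. -/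
lemma hasRank_isometryGroup : HasRank isometryGroup 2 := by
  refine hasRank_two_of_closure closure_isometryGroup fun h => ?_
  have h1 : toIsometry (genA * genB) = toIsometry (genB * genA) := by
    rw [map_mul, map_mul]
    exact congrArg Subtype.val h
  have h2 : (genB * genA)⁻¹ * (genA * genB) ∈ eisensteinGroup :=
    mul_mem (inv_mem (mul_mem genB_mem genA_mem)) (mul_mem genA_mem genB_mem)
  have h3 : ((genB * genA)⁻¹ * (genA * genB)) • H3.j = H3.j := by
    rw [mul_smul, inv_smul_eq_iff, ← toIsometry_apply, ← toIsometry_apply, h1]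
  rcases eq_one_or_neg_one_of_smul_eq h2 h3 with h4 | h4
  · have := congrArg (fun g : SL(2, Eisenstein) => g 0 0) h4
    revert this; decide
  · have := congrArg (fun g : SL(2, Eisenstein) => g 0 0) h4
    revert this; decide

theorem hasRank_fundamentalGroup_figureEight (a : FigureEight) :
    HasRank (FundamentalGroup FigureEight a) 2 :=
  (hasRank_isometryGroup.of_mulEquiv (MulEquiv.inv' isometryGroup)).of_mulEquiv
    (fundamentalGroupFigureEight a).symm

end Carrier

namespace Carrier

open unitInterval

namespace FiniteGraph

variable {X : Type} [TopologicalSpace X] (Γ : FiniteGraph X)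

/-! ### Continuous maps on finite graphs -/

/-- The disjoint union of the vertices and the edges. -/
abbrev Total := Γ.V ⊕ (Σ _ : Γ.E, I)

/-- The attaching map from the disjoint union of the vertices and the edges. -/
def attach : Γ.Total → X := Sum.elim Subtype.val fun p => Γ.edge p.1 p.2

lemma mem_Ioo_of_notMem {e : Γ.E} {s : I} (h : Γ.edge e s ∉ Γ.V) : s ∈ Set.Ioo (0 : I) 1 := by
  refine ⟨lt_of_le_of_ne s.2.1 ?_, lt_of_le_of_ne s.2.2 ?_⟩
  · rintro h0
    have : s = 0 := h0.symm
    exact h (this ▸ Γ.edge_zero_mem e)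
  · rintro h1
    have : s = 1 := h1
    exact h (this ▸ Γ.edge_one_mem e)

lemma mem_V_or_exists (x : X) : x ∈ Γ.V ∨ ∃ e s, Γ.edge e s = x := by
  rcases Γ.covers x with h | ⟨e, s, -, h⟩
  · exact Or.inl h
  · exact Or.inr ⟨e, s, h⟩

/-- A continuous surjection from a compact space onto a Hausdorff space. Consequently continuity may
be tested edge by edge. -/
lemma isQuotientMap_attach : Topology.IsQuotientMap Γ.attach := by
  have := Γ.t2
  have : Finite Γ.V := Γ.finite_V
  have hc : Continuous Γ.attach := by
    rw [continuous_sum_dom]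
    exact ⟨continuous_subtype_val, continuous_sigma fun e => (Γ.edge e).continuous⟩
  have hs : Function.Surjective Γ.attach := by
    intro x
    rcases Γ.mem_V_or_exists x with h | ⟨e, s, h⟩
    · exact ⟨Sum.inl ⟨x, h⟩, rfl⟩
    · exact ⟨Sum.inr ⟨e, s⟩, h⟩
  exact hc.isClosedMap.isQuotientMap hc hs

lemma continuous_of_edge {Y : Type*} [TopologicalSpace Y] {F : X → Y}
    (h : ∀ e, Continuous fun s => F (Γ.edge e s)) : Continuous F := by
  have := Γ.t2
  have : Finite Γ.V := Γ.finite_V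
  rw [Γ.isQuotientMap_attach.continuous_iff, continuous_sum_dom]
  exact ⟨continuous_of_discreteTopology, continuous_sigma fun e => h e⟩

/-- Continuous maps on the edges which agree at the vertices glue to a continuous map. -/
theorem exists_glue {Y : Type*} [TopologicalSpace Y] (f : X → Y) (g : ∀ _ : Γ.E, C(I, Y))
    (h0 : ∀ e, g e 0 = f (Γ.edge e 0)) (h1 : ∀ e, g e 1 = f (Γ.edge e 1)) :
    ∃ F : C(X, Y), (∀ v ∈ Γ.V, F v = f v) ∧ ∀ e s, F (Γ.edge e s) = g e s := by
  classical
  have hx : ∀ x, ∃ y, (x ∈ Γ.V → y = f x) ∧ ∀ e s, Γ.edge e s = x → y = g e s := by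
    intro x
    by_cases hx : x ∈ Γ.V
    · refine ⟨f x, fun _ => rfl, ?_⟩
      rintro e s rfl
      by_cases hs : s ∈ Set.Ioo (0 : I) 1
      · exact absurd hx (Γ.edge_notMem e s hs)
      · have : s = 0 ∨ s = 1 := by
          by_contra! hne
          exact hs ⟨lt_of_le_of_ne s.2.1 fun h => hne.1 h.symm,
            lt_of_le_of_ne s.2.2 fun h => hne.2 h⟩
        rcases this with rfl | rfl
        · exact (h0 e).symm
        · exact (h1 e).symm
    · obtain ⟨e, s, hs, rfl⟩ := (Γ.covers x).resolve_left hx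
      refine ⟨g e s, fun h => absurd h hx, fun e' s' h => ?_⟩
      obtain ⟨rfl, rfl⟩ := Γ.edge_inj e' e s' (Γ.mem_Ioo_of_notMem (h ▸ hx)) s hs h
      rfl
  choose F hF1 hF2 using hx
  have hF : ∀ e s, F (Γ.edge e s) = g e s := fun e s => hF2 _ e s rfl
  exact ⟨⟨F, Γ.continuous_of_edge fun e => by simp_rw [hF]; exact (g e).continuous⟩,
    fun v hv => hF1 v hv, hF⟩

/-- The interior of an edge is open. -/
lemma isOpen_image_Ioo (e : Γ.E) : IsOpen (Γ.edge e '' Set.Ioo 0 1) := by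
  rw [← Γ.isQuotientMap_attach.isOpen_preimage, isOpen_sum_iff, isOpen_sigma_iff]
  have := Γ.t2
  have : Finite Γ.V := Γ.finite_V
  refine ⟨isOpen_discrete _, fun e' => ?_⟩
  by_cases he : e' = e
  · subst he
    convert (isOpen_Ioo : IsOpen (Set.Ioo (0 : I) 1)) using 1
    ext s
    constructor
    · rintro ⟨s', hs', h⟩
      have hn : Γ.edge e' s ∉ Γ.V := by
        intro hV
        exact Γ.edge_notMem e' s' hs' (by rw [h]; exact hV)
      exact Γ.mem_Ioo_of_notMem hn
    · exact fun hs => ⟨s, hs, rfl⟩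
  · convert isOpen_empty using 1
    ext s
    simp only [Set.mem_preimage, Set.mem_empty_iff_false, iff_false]
    rintro ⟨s', hs', h⟩
    have hn : Γ.edge e' s ∉ Γ.V := by
      intro hV
      exact Γ.edge_notMem e s' hs' (by rw [h]; exact hV)
    exact he (Γ.edge_inj e e' s' hs' s (Γ.mem_Ioo_of_notMem hn) h).1.symm

/-! ### Decomposition of paths -/

/-- The map of the interval collapsing the outer thirds. -/
noncomputable def snapI : C(I, I) :=
  ⟨fun s => Set.projIcc 0 1 zero_le_one (3 * (s : ℝ) - 1),
    continuous_projIcc.comp (by fun_prop)⟩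

lemma snapI_of_le {s : I} (h : (s : ℝ) ≤ 1 / 3) : snapI s = 0 :=
  Set.projIcc_of_le_left zero_le_one (by linarith)

lemma snapI_of_ge {s : I} (h : 2 / 3 ≤ (s : ℝ)) : snapI s = 1 :=
  Set.projIcc_of_right_le zero_le_one (by linarith)

/-- The straight homotopy from the identity to the collapsing map. -/
noncomputable def snapHomotopy (s : I) : C(I, I) :=
  ⟨fun t => Set.Icc.convexComb s (snapI s) t, by fun_prop⟩

/-- The homotopy from the identity to the map collapsing the outer thirds of the edges. -/
lemma exists_snap : ∃ (r : C(X, X)) (H : (ContinuousMap.id X).Homotopy r),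
    (∀ v ∈ Γ.V, ∀ t, H (t, v) = v) ∧
    (∀ e s t, H (t, Γ.edge e s) = Γ.edge e (Set.Icc.convexComb s (snapI s) t)) ∧
    (∀ v ∈ Γ.V, r v = v) ∧ ∀ e s, r (Γ.edge e s) = Γ.edge e (snapI s) := by
  have hc : ∀ e : Γ.E, Continuous fun s : I => ((Γ.edge e).comp (snapHomotopy s)) := by
    intro e
    refine ContinuousMap.continuous_of_continuous_uncurry _ ?_
    have : Continuous fun p : I × I => Set.Icc.convexComb p.1 (snapI p.1) p.2 :=
      Set.Icc.continuous_convexComb_prod.comp (by fun_prop : Continuous fun p : I × I =>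
        (p.1, snapI p.1, p.2))
    exact (Γ.edge e).continuous.comp this
  have e0 : snapI 0 = 0 := snapI_of_le (by norm_num)
  have e1 : snapI 1 = 1 := snapI_of_ge (by norm_num)
  -- Gluing with values in the path space gives joint continuity of the homotopy in both variables.
  obtain ⟨F, hF1, hF2⟩ := Γ.exists_glue (Y := C(I, X)) (fun x => ContinuousMap.const I x)
    (fun e => ⟨_, hc e⟩) (fun e => by ext t; simp [snapHomotopy, e0])
    (fun e => by ext t; simp [snapHomotopy, e1])
  have hF : Continuous fun p : I × X => F p.2 p.1 := by fun_prop
  have hFe : ∀ e s t, F (Γ.edge e s) t = Γ.edge e (Set.Icc.convexComb s (snapI s) t) := by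
    intro e s t; rw [hF2]; rfl
  have hFv : ∀ v ∈ Γ.V, ∀ t, F v t = v := fun v hv t => by rw [hF1 v hv]; rfl
  refine ⟨⟨fun x => F x 1, by fun_prop⟩, ⟨⟨_, hF⟩, fun x => ?_, fun x => rfl⟩, hFv, hFe,
    fun v hv => hFv v hv 1, fun e s => ?_⟩
  · rcases Γ.mem_V_or_exists x with h | ⟨e, s, rfl⟩
    · exact hFv x h 0
    · exact (hFe e s 0).trans (by simp)
  · exact (hFe e s 1).trans (by simp)

/-- A continuous coordinate along an edge, valid in its interior. -/
lemma exists_coordinate (e : Γ.E) : ∃ a b : C(X, ℝ), ∀ s ∈ Set.Ioo (0 : I) 1,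
    b (Γ.edge e s) ≠ 0 ∧ a (Γ.edge e s) / b (Γ.edge e s) = s := by
  classical
  -- The parameter s itself does not extend when the edge is a loop, but s²(1-s) and s(1-s) vanish
  -- at both ends and extend by zero; their quotient is s.
  obtain ⟨a, -, ha⟩ := Γ.exists_glue (fun _ => (0 : ℝ))
    (fun e' => if e' = e then ⟨fun s => (s : ℝ) ^ 2 * (1 - s), by fun_prop⟩ else 0)
    (fun e' => by split_ifs <;> simp) (fun e' => by split_ifs <;> simp)
  obtain ⟨b, -, hb⟩ := Γ.exists_glue (fun _ => (0 : ℝ))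
    (fun e' => if e' = e then ⟨fun s => (s : ℝ) * (1 - s), by fun_prop⟩ else 0)
    (fun e' => by split_ifs <;> simp) (fun e' => by split_ifs <;> simp)
  refine ⟨a, b, fun s hs => ?_⟩
  have h0 : (0 : ℝ) < s := hs.1
  have h1 : (0 : ℝ) < 1 - s := by have : (s : ℝ) < 1 := hs.2; linarith
  rw [ha, hb]
  simp only [if_true, ContinuousMap.coe_mk]
  exact ⟨by positivity, by field_simp⟩

/-- A property of paths which is invariant under homotopy, closed under concatenation, and holds
for constant paths and for paths within an edge, holds for all paths. -/
theorem path_induction {C : ∀ x y : X, Path x y → Prop}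
    (homotopic : ∀ {x y} (p q : Path x y), p.Homotopic q → C x y p → C x y q)
    (const : ∀ {x y} (p : Path x y), (∀ s, p s = x) → C x y p)
    (edge : ∀ {x y} (p : Path x y) (e : Γ.E) (τ : C(I, I)), (∀ s, p s = Γ.edge e (τ s)) → C x y p)
    (trans : ∀ {x y z} (p : Path x y) (q : Path y z), C x y p → C y z q → C x z (p.trans q))
    {x y : X} (p : Path x y) : C x y p := by
  have := Γ.t2
  -- A path may cross vertices infinitely often. Collapsing the outer thirds of edges by r repairs
  -- this: X is covered by the open edges and an open set A which r sends into the vertices. By the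
  -- Lebesgue number lemma, r ∘ p is a finite concatenation of pieces that are constant or inside
  -- one edge.
  obtain ⟨r, H, hv, he, hrv, hre⟩ := Γ.exists_snap
  have htrack : ∀ z, C _ _ (H.evalAt z) ∧ C _ _ (H.evalAt z).symm := by
    intro z
    rcases Γ.mem_V_or_exists z with h | ⟨e, s, rfl⟩
    · refine ⟨const _ fun t => hv z h t, const _ fun t => ?_⟩
      exact (hv z h _).trans (hrv z h).symm
    · exact ⟨edge _ e (snapHomotopy s) fun t => he e s t,
        edge _ e ((snapHomotopy s).comp ⟨unitInterval.symm, continuous_symm⟩) fun t => he e s _⟩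
  -- the collapsed path
  set A : Set X := (⋃ e, Γ.edge e '' {s : I | (1 / 3 : ℝ) ≤ s ∧ (s : ℝ) ≤ 2 / 3})ᶜ with hA
  have hAo : IsOpen A := by
    rw [hA, isOpen_compl_iff]
    refine isClosed_iUnion_of_finite fun e => IsCompact.isClosed ?_
    refine IsCompact.image (IsClosed.isCompact ?_) (Γ.edge e).continuous
    exact (isClosed_le continuous_const continuous_subtype_val).inter
      (isClosed_le continuous_subtype_val continuous_const)
  have hAV : ∀ z ∈ A, r z ∈ Γ.V := by
    intro z hz
    rcases Γ.mem_V_or_exists z with h | ⟨e, s, rfl⟩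
    · rw [hrv z h]; exact h
    · rw [hre]
      by_cases h1 : (s : ℝ) ≤ 1 / 3
      · rw [snapI_of_le h1]; exact Γ.edge_zero_mem e
      · by_cases h2 : 2 / 3 ≤ (s : ℝ)
        · rw [snapI_of_ge h2]; exact Γ.edge_one_mem e
        · exact (hz (Set.mem_iUnion.mpr
            ⟨e, s, ⟨(not_le.mp h1).le, (not_le.mp h2).le⟩, rfl⟩)).elim
  let U : Option Γ.E → Set X := fun o => o.elim A fun e => Γ.edge e '' Set.Ioo 0 1
  have hU : ∀ o, IsOpen (U o) := by
    rintro (_ | e)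
    · exact hAo
    · exact Γ.isOpen_image_Ioo e
  have hcov : ∀ z, ∃ o, z ∈ U o := by
    intro z
    by_cases hz : z ∈ A
    · exact ⟨none, hz⟩
    · rw [hA, Set.notMem_compl_iff, Set.mem_iUnion] at hz
      obtain ⟨e, s, hs, rfl⟩ := hz
      refine ⟨some e, s, ⟨?_, ?_⟩, rfl⟩
      · have : (0 : ℝ) < s := by linarith [hs.1]
        exact this
      · have : (s : ℝ) < 1 := by linarith [hs.2]
        exact this
  obtain ⟨t, ht0, htm, ⟨N, hN⟩, ht⟩ := exists_monotone_Icc_subset_open_cover_unitInterval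
    (c := fun o => p ⁻¹' U o) (fun o => (hU o).preimage p.continuous)
    (fun s _ => Set.mem_iUnion.mpr (hcov (p s)))
  have hpiece : ∀ n, C _ _ ((p.map r.continuous).subpath (t n) (t (n + 1))) := by
    intro n
    obtain ⟨o, ho⟩ := ht n
    have hmem : ∀ s, p (Set.Icc.convexComb (t n) (t (n + 1)) s) ∈ U o := fun s =>
      by
      have h1 := Set.mem_range_self (f := Set.Icc.convexComb (t n) (t (n + 1))) s
      rw [Path.range_subpathAux, Set.uIcc_of_le (htm (Nat.le_succ n))] at h1
      exact ho h1
    set c : I → I := Set.Icc.convexComb (t n) (t (n + 1)) with hc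
    have hcc : Continuous c := by fun_prop
    rcases o with _ | e
    · apply const
      -- The piece has connected image in the finite set of vertices, hence is constant.
      have hfin : (Set.range fun s => r (p (c s))).Finite :=
        Γ.finite_V.subset (by rintro _ ⟨s, rfl⟩; exact hAV _ (hmem s))
      have hpre : IsPreconnected (Set.range fun s => r (p (c s))) :=
        isPreconnected_range (by fun_prop)
      have hsub : (Set.range fun s => r (p (c s))).Subsingleton := by
        by_contra hne
        exact hpre.infinite_of_nontrivial (Set.not_subsingleton_iff.mp hne) hfin
      intro s
      change r (p (c s)) = r (p (t n))
      have : t n = c 0 := by simp [hc]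
      rw [this]
      exact hsub ⟨s, rfl⟩ ⟨0, rfl⟩
    · obtain ⟨a, b, hab⟩ := Γ.exists_coordinate e
      choose τ hτ1 hτ2 using hmem
      have hb : ∀ s, b (p (c s)) ≠ 0 := fun s => by rw [← hτ2]; exact (hab _ (hτ1 s)).1
      have hτ : Continuous τ := by
        rw [continuous_induced_rng]
        have : Continuous fun s => a (p (c s)) / b (p (c s)) :=
          Continuous.div (by fun_prop) (by fun_prop) hb
        refine this.congr fun s => ?_
        rw [← hτ2]
        exact (hab _ (hτ1 s)).2
      refine edge _ e (snapI.comp ⟨τ, hτ⟩) fun s => ?_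
      change r (p (c s)) = _
      rw [← hτ2, hre]
      rfl
  have hind : ∀ n, C _ _ ((p.map r.continuous).subpath (t 0) (t n)) := by
    intro n
    induction n with
    | zero =>
      apply const
      intro s
      rw [Path.subpath_self]
      rfl
    | succ n ih =>
      exact homotopic _ _ ⟨Path.Homotopy.subpathTransSubpath _ _ _ _⟩ (trans _ _ ih (hpiece n))
  have hrp : C _ _ (p.map r.continuous) := by
    have h := hind N
    have key : ∀ (s s' : I), s = 0 → s' = 1 → C _ _ ((p.map r.continuous).subpath s s') →
        C _ _ (p.map r.continuous) := by
      rintro _ _ rfl rfl h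
      rw [Path.subpath_zero_one] at h
      have hcast : ∀ {u v u' v' : X} (q : Path u v) (hu : u' = u) (hv : v' = v),
          C _ _ (q.cast hu hv) → C _ _ q := by
        rintro u v _ _ q rfl rfl h; exact h
      exact hcast _ _ _ h
    exact key _ _ ht0 (hN N le_rfl) h
  -- The path p is homotopic to r ∘ p conjugated by the tracks of the homotopy, and each track is
  -- constant or stays inside one edge.
  have hhom := Path.Homotopic.map_trans_evalAt H p
  refine homotopic (((H.evalAt x).trans (p.map r.continuous)).trans (H.evalAt y).symm) p ?_
    (trans _ _ (trans _ _ (htrack x).1 hrp) (htrack y).2)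
  have h1 := (hhom.symm.hcomp (Path.Homotopic.refl (H.evalAt y).symm))
  refine h1.trans ?_
  have h2 : (((p.map (ContinuousMap.id X).continuous).trans (H.evalAt y)).trans
      (H.evalAt y).symm).Homotopic (p.map (ContinuousMap.id X).continuous) := by
    have h3 : ((p.map (ContinuousMap.id X).continuous).trans
        ((H.evalAt y).trans (H.evalAt y).symm)).Homotopic _ :=
      Path.Homotopic.hcomp (Path.Homotopic.refl _) ⟨(Path.Homotopy.reflTransSymm (H.evalAt y)).symm⟩
    exact (Path.Homotopic.trans ⟨Path.Homotopy.transAssoc _ _ _⟩ h3).trans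
      ⟨Path.Homotopy.transRefl _⟩
  exact h2
end FiniteGraph
end Carrier

namespace Carrier

open unitInterval

/-! ### Displacement of a path along a circle-valued map -/

section Displacement

variable {X : Type*} [TopologicalSpace X] (c : C(X, AddCircle (1 : ℝ)))

lemma exists_lift {x y : X} (p : Path x y) :
    ∃ l : C(I, ℝ), ∀ s, ((l s : ℝ) : AddCircle (1 : ℝ)) = c (p s) := by
  obtain ⟨e, he⟩ := QuotientAddGroup.mk_surjective (c x)
  have h0 : (c.comp p.toContinuousMap) 0 = ((e : ℝ) : AddCircle (1 : ℝ)) := by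
    simpa using he.symm
  exact ⟨(AddCircle.isCoveringMap_coe (1 : ℝ)).liftPath _ e h0,
    congrFun ((AddCircle.isCoveringMap_coe (1 : ℝ)).liftPath_lifts _ e h0)⟩

/-- The total displacement of a path in the universal cover of the circle. -/
noncomputable def displacement {x y : X} (p : Path x y) : ℝ :=
  (exists_lift c p).choose 1 - (exists_lift c p).choose 0

/-- Two lifts to ℝ of the same path in the circle differ by a constant, so the choice of lift is
immaterial. -/
lemma displacement_eq {x y : X} (p : Path x y) (l : C(I, ℝ))
    (h : ∀ s, ((l s : ℝ) : AddCircle (1 : ℝ)) = c (p s)) : displacement c p = l 1 - l 0 := by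
  have hl := (exists_lift c p).choose_spec
  set l' := (exists_lift c p).choose with hl'
  have key : (fun s => l s) = fun s => l' s + (l 0 - l' 0) := by
    refine (AddCircle.isCoveringMap_coe (1 : ℝ)).eq_of_comp_eq (by fun_prop) (by fun_prop) ?_ 0
      (by ring)
    funext s
    have h0 : ((l 0 : ℝ) : AddCircle (1 : ℝ)) = (l' 0 : ℝ) := by rw [h, hl]
    simp only [Function.comp_apply, AddCircle.coe_add, AddCircle.coe_sub, h0, sub_self, add_zero]
    rw [h, hl]
  have h1 : l 1 = l' 1 + (l 0 - l' 0) := congrFun key 1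
  unfold displacement
  rw [← hl', h1]
  ring

lemma displacement_congr {x y : X} {p q : Path x y} (h : p.Homotopic q) :
    displacement c p = displacement c q := by
  obtain ⟨e, he⟩ := QuotientAddGroup.mk_surjective (c x)
  have hp : (p.map c.continuous).toContinuousMap 0 = ((e : ℝ) : AddCircle (1 : ℝ)) := by
    simpa using he.symm
  have hq : (q.map c.continuous).toContinuousMap 0 = ((e : ℝ) : AddCircle (1 : ℝ)) := by
    simpa using he.symm
  have cov := AddCircle.isCoveringMap_coe (1 : ℝ)
  rw [displacement_eq c p (cov.liftPath _ e hp) (congrFun (cov.liftPath_lifts _ e hp)),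
    displacement_eq c q (cov.liftPath _ e hq) (congrFun (cov.liftPath_lifts _ e hq)),
    cov.liftPath_zero, cov.liftPath_zero,
    cov.liftPath_apply_one_eq_of_homotopicRel (h.map c) e hp hq]

lemma displacement_trans {x y z : X} (p : Path x y) (q : Path y z) :
    displacement c (p.trans q) = displacement c p + displacement c q := by
  obtain ⟨l, hl⟩ := exists_lift c p
  obtain ⟨m, hm⟩ := exists_lift c q
  let P : Path (l 0) (l 1) := ⟨l, rfl, rfl⟩
  let Q : Path (l 1) (m 1 + (l 1 - m 0)) :=
    ⟨⟨fun s => m s + (l 1 - m 0), by fun_prop⟩, by simp, rfl⟩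
  have h0 : ((l 1 : ℝ) : AddCircle (1 : ℝ)) = (m 0 : ℝ) := by rw [hl, hm]; simp
  rw [displacement_eq c p l hl, displacement_eq c q m hm,
    displacement_eq c (p.trans q) (P.trans Q).toContinuousMap]
  · simp only [Path.coe_toContinuousMap, Path.source, Path.target]
    ring
  · intro s
    simp only [Path.coe_toContinuousMap, Path.trans_apply]
    split_ifs
    · exact hl _
    · change ((m _ + (l 1 - m 0) : ℝ) : AddCircle (1 : ℝ)) = _
      rw [AddCircle.coe_add, AddCircle.coe_sub, h0, sub_self, add_zero]
      exact hm _

end Displacement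

namespace FiniteGraph

variable {X : Type} [TopologicalSpace X] (Γ : FiniteGraph X)

/-! ### Cellular cochains -/

lemma exists_circleCoord (e : Γ.E) : ∃ c : C(X, AddCircle (1 : ℝ)),
    (∀ s : I, c (Γ.edge e s) = ((s : ℝ) : AddCircle (1 : ℝ))) ∧
    (∀ e', e' ≠ e → ∀ s, c (Γ.edge e' s) = 0) ∧ ∀ v ∈ Γ.V, c v = 0 := by
  classical
  obtain ⟨a, ha⟩ : ∃ a : C(I, AddCircle (1 : ℝ)), ∀ s, a s = ((s : ℝ) : AddCircle (1 : ℝ)) :=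
    ⟨⟨_, (AddCircle.continuous_mk' (1 : ℝ)).comp continuous_subtype_val⟩, fun _ => rfl⟩
  obtain ⟨c, hv, hc⟩ := Γ.exists_glue (fun _ => (0 : AddCircle (1 : ℝ)))
    (fun e' => if e' = e then a else 0)
    (fun e' => by split_ifs <;> simp [ha])
    (fun e' => by split_ifs <;> simp [ha, AddCircle.coe_period])
  exact ⟨c, fun s => by rw [hc, if_pos rfl, ha], fun e' he s => by rw [hc, if_neg he]; rfl,
    hv⟩

/-- The map to the circle collapsing the complement of the edge `e`. -/
noncomputable def circleCoord (e : Γ.E) : C(X, AddCircle (1 : ℝ)) :=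
  (Γ.exists_circleCoord e).choose

/-- The integral of a cellular 1-cochain over a path. -/
noncomputable def integral {x y : X} (p : Path x y) : (Γ.E → ℝ) →ₗ[ℝ] ℝ :=
  ∑ e, displacement (Γ.circleCoord e) p • LinearMap.proj e

lemma integral_apply {x y : X} (p : Path x y) (φ : Γ.E → ℝ) :
    Γ.integral p φ = ∑ e, displacement (Γ.circleCoord e) p * φ e := by
  simp [integral]

lemma integral_congr {x y : X} {p q : Path x y} (h : p.Homotopic q) :
    Γ.integral p = Γ.integral q := by
  simp only [integral, displacement_congr _ h]

lemma integral_trans {x y z : X} (p : Path x y) (q : Path y z) :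
    Γ.integral (p.trans q) = Γ.integral p + Γ.integral q := by
  simp only [integral, displacement_trans, add_smul, Finset.sum_add_distrib]

lemma displacement_of_edge {x y : X} (p : Path x y) {e : Γ.E} (τ : C(I, I))
    (h : ∀ s, p s = Γ.edge e (τ s)) :
    displacement (Γ.circleCoord e) p = τ 1 - τ 0 := by
  refine displacement_eq _ p ⟨fun s => (τ s : ℝ), by fun_prop⟩ fun s => ?_
  rw [h]
  exact ((Γ.exists_circleCoord e).choose_spec.1 _).symm

lemma displacement_of_edge_ne {x y : X} (p : Path x y) {e e' : Γ.E} (he : e ≠ e') (τ : I → I)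
    (h : ∀ s, p s = Γ.edge e (τ s)) :
    displacement (Γ.circleCoord e') p = 0 := by
  refine (displacement_eq _ p 0 fun s => ?_).trans (by simp)
  rw [h]
  exact ((Γ.exists_circleCoord e').choose_spec.2.1 e he _).symm

lemma displacement_of_disjoint {x y : X} (p : Path x y) {e : Γ.E}
    (h : ∀ s t, p s ≠ Γ.edge e t) : displacement (Γ.circleCoord e) p = 0 := by
  refine (displacement_eq _ p 0 fun s => ?_).trans (by simp)
  obtain ⟨-, h2, h3⟩ := (Γ.exists_circleCoord e).choose_spec
  rcases Γ.mem_V_or_exists (p s) with hs | ⟨e', t, hs⟩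
  · exact (h3 _ hs).symm
  · rw [← hs]
    refine (h2 e' ?_ t).symm
    rintro rfl
    exact h s t hs.symm

lemma integral_of_edge {x y : X} (p : Path x y) {e : Γ.E} (τ : C(I, I))
    (h : ∀ s, p s = Γ.edge e (τ s)) (φ : Γ.E → ℝ) :
    Γ.integral p φ = (τ 1 - τ 0) * φ e := by
  rw [integral_apply, Finset.sum_eq_single e]
  · rw [Γ.displacement_of_edge p τ h]
  · intro e' _ he
    rw [Γ.displacement_of_edge_ne p he.symm τ h, zero_mul]
  · simp

lemma integral_const {x y : X} (p : Path x y) (h : ∀ s, p s = x) : Γ.integral p = 0 := by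
  have hy : y = x := by rw [← p.target, h]
  subst hy
  have : p = Path.refl y := by ext s; exact h s
  subst this
  have h2 := Γ.integral_congr (⟨Path.Homotopy.transRefl (Path.refl y)⟩ :
    ((Path.refl y).trans (Path.refl y)).Homotopic _)
  rw [integral_trans] at h2
  simpa using h2

lemma integral_symm {x y : X} (p : Path x y) : Γ.integral p.symm = -Γ.integral p := by
  have h := Γ.integral_congr (⟨Path.Homotopy.reflTransSymm p⟩ : (Path.refl x).Homotopic _)
  rw [integral_trans, Γ.integral_const (Path.refl x) fun _ => rfl] at h
  exact (neg_eq_of_add_eq_zero_right h.symm).symm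

/-- The initial vertex of an edge. -/
def src (e : Γ.E) : Γ.V := ⟨Γ.edge e 0, Γ.edge_zero_mem e⟩

/-- The terminal vertex of an edge. -/
def tgt (e : Γ.E) : Γ.V := ⟨Γ.edge e 1, Γ.edge_one_mem e⟩

/-- The edge `e` as a path. -/
def edgePath (e : Γ.E) : Path (Γ.src e : X) (Γ.tgt e) := ⟨Γ.edge e, rfl, rfl⟩

lemma integral_edgePath (e : Γ.E) (φ : Γ.E → ℝ) : Γ.integral (Γ.edgePath e) φ = φ e := by
  rw [Γ.integral_of_edge (Γ.edgePath e) (e := e) (ContinuousMap.id I) fun _ => rfl]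
  simp

/-- The coboundary of a 0-cochain. -/
def coboundary : (Γ.V → ℝ) →ₗ[ℝ] (Γ.E → ℝ) where
  toFun u e := u (Γ.tgt e) - u (Γ.src e)
  map_add' u v := by ext e; simp; ring
  map_smul' r u := by ext e; simp; ring

lemma coboundary_apply (u : Γ.V → ℝ) (e : Γ.E) :
    Γ.coboundary u e = u (Γ.tgt e) - u (Γ.src e) := rfl

lemma exists_extension (u : Γ.V → ℝ) : ∃ F : C(X, ℝ), (∀ v : Γ.V, F v = u v) ∧
    ∀ e (s : I), F (Γ.edge e s) = (1 - s) * u (Γ.src e) + s * u (Γ.tgt e) := by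
  classical
  obtain ⟨F, hF, hF'⟩ := Γ.exists_glue (fun x => if h : x ∈ Γ.V then u ⟨x, h⟩ else 0)
    (fun e => ⟨fun s : I => (1 - s) * u (Γ.src e) + s * u (Γ.tgt e), by fun_prop⟩)
    (fun e => by simp [Γ.edge_zero_mem, src]) (fun e => by simp [Γ.edge_one_mem, tgt])
  exact ⟨F, fun v => by simp [hF v v.2], hF'⟩

/-- The piecewise linear extension of a 0-cochain. -/
noncomputable def extension (u : Γ.V → ℝ) : C(X, ℝ) := (Γ.exists_extension u).choose

lemma extension_vertex (u : Γ.V → ℝ) (v : Γ.V) : Γ.extension u v = u v :=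
  (Γ.exists_extension u).choose_spec.1 v

lemma extension_edge (u : Γ.V → ℝ) (e : Γ.E) (s : I) :
    Γ.extension u (Γ.edge e s) = (1 - s) * u (Γ.src e) + s * u (Γ.tgt e) :=
  (Γ.exists_extension u).choose_spec.2 e s

/-- The fundamental theorem of calculus on a graph. -/
theorem integral_coboundary (u : Γ.V → ℝ) {x y : X} (p : Path x y) :
    Γ.integral p (Γ.coboundary u) = Γ.extension u y - Γ.extension u x := by
  refine Γ.path_induction (C := fun x y p => Γ.integral p (Γ.coboundary u) =
    Γ.extension u y - Γ.extension u x) ?_ ?_ ?_ ?_ p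
  · intro x y p q h hp
    rwa [← Γ.integral_congr h]
  · intro x y p h
    have hy : y = x := by rw [← p.target, h]
    rw [Γ.integral_const p h, hy]
    simp
  · intro x y p e τ h
    have hx : x = Γ.edge e (τ 0) := by rw [← h, p.source]
    have hy : y = Γ.edge e (τ 1) := by rw [← h, p.target]
    rw [Γ.integral_of_edge p τ h, hx, hy, extension_edge, extension_edge, coboundary_apply]
    ring
  · intro x y z p q hp hq
    rw [integral_trans, LinearMap.add_apply, hp, hq]
    ring

/-! ### Connectedness -/

/-- A path component and its complement are both finite unions of whole edges and vertices, hence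
closed. -/
lemma pathConnectedSpace (Γ : FiniteGraph X) [hX : ConnectedSpace X] : PathConnectedSpace X := by
  have := Γ.t2
  have : Finite Γ.V := Γ.finite_V
  have hcl : ∀ S : Set X, (∀ e s, Γ.edge e s ∈ S ↔ Γ.edge e 0 ∈ S) → IsClosed S := by
    intro S hS
    have : S = (S ∩ Γ.V) ∪ ⋃ e ∈ {e | Γ.edge e 0 ∈ S}, Set.range (Γ.edge e) := by
      ext x
      constructor
      · intro hx
        rcases Γ.mem_V_or_exists x with h | ⟨e, s, rfl⟩
        · exact Or.inl ⟨hx, h⟩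
        · exact Or.inr (Set.mem_biUnion (show _ ∈ {e | Γ.edge e 0 ∈ S} from (hS e s).mp hx)
            ⟨s, rfl⟩)
      · rintro (h | h)
        · exact h.1
        · simp only [Set.mem_iUnion] at h
          obtain ⟨e, he, s, rfl⟩ := h
          exact (hS e s).mpr he
    rw [this]
    refine (Γ.finite_V.subset Set.inter_subset_right).isClosed.union ?_
    exact (Set.toFinite _).isClosed_biUnion fun e _ => (isCompact_range (Γ.edge e).continuous).isClosed
  have hedge : ∀ e s, Joined (Γ.edge e 0) (Γ.edge e s) := fun e s =>
    ⟨⟨⟨fun t => Γ.edge e (t * s), by fun_prop⟩, by simp, by simp⟩⟩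
  obtain ⟨x₀⟩ := hX.toNonempty
  have hS : ∀ e s, Joined x₀ (Γ.edge e s) ↔ Joined x₀ (Γ.edge e 0) := fun e s =>
    ⟨fun h => h.trans (hedge e s).symm, fun h => h.trans (hedge e s)⟩
  have hclopen : IsClopen {x | Joined x₀ x} :=
    ⟨hcl _ hS, isClosed_compl_iff.mp (hcl {x | Joined x₀ x}ᶜ fun e s => not_congr (hS e s))⟩
  have huniv := hclopen.eq_univ ⟨x₀, Joined.refl x₀⟩
  have hj : ∀ x, Joined x₀ x := fun x => by
    have : x ∈ {x | Joined x₀ x} := by rw [huniv]; trivial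
    exact this
  exact ⟨⟨x₀⟩, fun x y => (hj x).symm.trans (hj y)⟩

end FiniteGraph
end Carrier

namespace Carrier

open unitInterval CategoryTheory

/-! ### Spanning trees -/

/-- In a connected graph whose edges are labelled by arrows of a groupoid, the vertices can be
joined to a base vertex so that all edges of a spanning tree become trivial. -/
theorem exists_spanning_tree {V E : Type*} [Fintype V] [Fintype E] (s t : E → V)
    (hconn : ∀ u : V → ℝ, (∀ e, u (s e) = u (t e)) → ∀ v w, u v = u w)
    {C : Type*} [Groupoid C] (o : V → C) (w₀ : V) (a : ∀ e, o (s e) ⟶ o (t e))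
    (q₀ : ∀ w, o w₀ ⟶ o w) :
    ∃ q : ∀ w, o w₀ ⟶ o w, q w₀ = 𝟙 _ ∧
      Fintype.card V ≤ Nat.card {e // q (s e) ≫ a e = q (t e)} + 1 := by
  classical
  suffices h : ∀ n, ∃ q : ∀ w, o w₀ ⟶ o w, q w₀ = 𝟙 _ ∧
      (Fintype.card V ≤ Nat.card {e // q (s e) ≫ a e = q (t e)} + 1 ∨
        n ≤ Nat.card {e // q (s e) ≫ a e = q (t e)}) by
    obtain ⟨q, hq, h | h⟩ := h (Fintype.card E + 1)
    · exact ⟨q, hq, h⟩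
    · have := Finite.card_subtype_le fun e => q (s e) ≫ a e = q (t e)
      rw [Nat.card_eq_fintype_card (α := E)] at this
      omega
  intro n
  induction n with
  | zero => exact ⟨fun w => inv (q₀ w₀) ≫ q₀ w, by simp, Or.inr (Nat.zero_le _)⟩
  | succ n ih =>
    obtain ⟨q, hq, hcard | hcard⟩ := ih
    · exact ⟨q, hq, Or.inl hcard⟩
    by_cases hV : Fintype.card V ≤ Nat.card {e // q (s e) ≫ a e = q (t e)} + 1
    · exact ⟨q, hq, Or.inl hV⟩
    -- a function constant along the edges which are already trivial
    obtain ⟨u, hu, hu0, w₁, hw₁⟩ : ∃ u : V → ℝ,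
        (∀ e, q (s e) ≫ a e = q (t e) → u (s e) = u (t e)) ∧ u w₀ = 0 ∧ ∃ w, u w ≠ 0 := by
      -- One equation for each trivial edge and one for the base vertex: fewer equations than
      -- vertices, so a nonzero solution exists.
      let L : (V → ℝ) →ₗ[ℝ] (Option {e // q (s e) ≫ a e = q (t e)} → ℝ) := LinearMap.pi fun i =>
        i.elim (LinearMap.proj w₀) fun e =>
          (LinearMap.proj (s e.1) : (V → ℝ) →ₗ[ℝ] ℝ) - LinearMap.proj (t e.1)
      have hL : LinearMap.ker L ≠ ⊥ := by
        apply LinearMap.ker_ne_bot_of_finrank_lt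
        rw [Module.finrank_fintype_fun_eq_card, Module.finrank_fintype_fun_eq_card,
          Fintype.card_option, ← Nat.card_eq_fintype_card]
        omega
      obtain ⟨u, hu, hne⟩ := (Submodule.ne_bot_iff _).mp hL
      have hu' : ∀ i, L u i = 0 := fun i => congrFun (LinearMap.mem_ker.mp hu) i
      refine ⟨u, fun e he => ?_, hu' none, Function.ne_iff.mp hne⟩
      have := hu' (some ⟨e, he⟩)
      exact sub_eq_zero.mp this
    obtain ⟨e₀, he₀⟩ : ∃ e, ¬ (u (s e) = 0 ↔ u (t e) = 0) := by
      by_contra! hne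
      have := hconn (fun w => if u w = 0 then 0 else 1) (fun e => by simp only [hne e]) w₀ w₁
      simp [hu0, hw₁] at this
    -- The support of u cuts no trivial edge, so multiplying q by a fixed loop h on the support
    -- keeps these edges trivial. A suitable h makes the crossing edge e₀ trivial as well.
    have key : ∀ h : o w₀ ⟶ o w₀, (∀ q' : ∀ w, o w₀ ⟶ o w,
        (∀ w, q' w = if u w = 0 then q w else h ≫ q w) → q' (s e₀) ≫ a e₀ = q' (t e₀)) →
        ∃ q : ∀ w, o w₀ ⟶ o w, q w₀ = 𝟙 _ ∧
      (Fintype.card V ≤ Nat.card {e // q (s e) ≫ a e = q (t e)} + 1 ∨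
        n + 1 ≤ Nat.card {e // q (s e) ≫ a e = q (t e)}) := by
      intro h hh
      refine ⟨fun w => if u w = 0 then q w else h ≫ q w, by simp [hu0, hq], Or.inr ?_⟩
      refine hcard.trans_lt ?_
      set q' : ∀ w, o w₀ ⟶ o w := fun w => if u w = 0 then q w else h ≫ q w with hq'
      have hsub : {e | q (s e) ≫ a e = q (t e)} ⊂ {e | q' (s e) ≫ a e = q' (t e)} := by
        refine ⟨fun e he => ?_, fun hsub => ?_⟩
        · have h1 := hu e he
          simp only [Set.mem_ofPred_eq] at he
          simp only [Set.mem_ofPred_eq, hq', h1]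
          split_ifs
          · exact he
          · rw [Category.assoc, he]
        · have h1 := hu e₀ (hsub (hh q' fun _ => rfl))
          rw [h1] at he₀
          exact he₀ Iff.rfl
      exact Set.ncard_lt_ncard hsub
    by_cases h0 : u (s e₀) = 0
    · have h1 : u (t e₀) ≠ 0 := fun h => he₀ (by simp [h0, h])
      refine key (q (s e₀) ≫ a e₀ ≫ inv (q (t e₀))) fun q' hq' => ?_
      rw [hq', hq', if_pos h0, if_neg h1]
      simp
    · have h1 : u (t e₀) = 0 := by
        by_contra h
        exact he₀ (by simp [h0, h])
      refine key (q (t e₀) ≫ inv (a e₀) ≫ inv (q (s e₀))) fun q' hq' => ?_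
      rw [hq', hq', if_neg h0, if_pos h1]
      simp

namespace FiniteGraph

variable {X : Type} [TopologicalSpace X] (Γ : FiniteGraph X)

noncomputable instance : Fintype Γ.V := Γ.finite_V.fintype

/-! ### The rank of the fundamental group -/

/-- The integral of a cochain over a homotopy class of paths. -/
noncomputable def integralClass {x y : X} (P : Path.Homotopic.Quotient x y) :
    (Γ.E → ℝ) →ₗ[ℝ] ℝ :=
  Quotient.lift (fun p : Path x y => Γ.integral p) (fun _ _ h => Γ.integral_congr h) P

lemma integralClass_mk {x y : X} (p : Path x y) :
    Γ.integralClass (Path.Homotopic.Quotient.mk p) = Γ.integral p := rfl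

lemma integral_eq_zero_of_closure {x : X} {S : Set (FundamentalGroup X x)}
    (hS : Subgroup.closure S = ⊤) {φ : Γ.E → ℝ} (h : ∀ g ∈ S, Γ.integralClass g φ = 0)
    (p : Path x x) : Γ.integral p φ = 0 := by
  have key : ∀ g ∈ Subgroup.closure S, Γ.integralClass g φ = 0 := by
    intro g hg
    induction hg using Subgroup.closure_induction with
    | mem g hg => exact h g hg
    | one => exact LinearMap.congr_fun (Γ.integral_const (Path.refl x) fun _ => rfl) φ
    | mul g g' _ _ h1 h2 =>
      induction g using Path.Homotopic.Quotient.ind with | mk a =>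
      induction g' using Path.Homotopic.Quotient.ind with | mk b =>
      -- The product in the fundamental group is concatenation in the opposite order.
      have := LinearMap.congr_fun (Γ.integral_trans b a) φ
      refine Eq.trans this ?_
      rw [LinearMap.add_apply, ← integralClass_mk, ← integralClass_mk, h1, h2, add_zero]
    | inv g _ h1 =>
      induction g using Path.Homotopic.Quotient.ind with | mk a =>
      have := LinearMap.congr_fun (Γ.integral_symm a) φ
      refine Eq.trans this ?_
      rw [LinearMap.neg_apply, ← integralClass_mk, h1, neg_zero]
  exact key (Path.Homotopic.Quotient.mk p) (by rw [hS]; trivial)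

/-- A cochain whose integrals over closed paths vanish is a coboundary. -/
theorem exists_coboundary_eq [ConnectedSpace X] {x : X} {φ : Γ.E → ℝ}
    (h : ∀ p : Path x x, Γ.integral p φ = 0) : ∃ u, Γ.coboundary u = φ := by
  have := Γ.pathConnectedSpace
  let q : ∀ y, Path x y := fun y => PathConnectedSpace.somePath x y
  refine ⟨fun w => Γ.integral (q w) φ, funext fun e => ?_⟩
  have h1 := h (((q (Γ.src e)).trans (Γ.edgePath e)).trans (q (Γ.tgt e)).symm)
  rw [integral_trans, integral_trans, integral_symm] at h1
  simp only [LinearMap.add_apply, LinearMap.neg_apply, integral_edgePath] at h1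
  rw [coboundary_apply]
  linarith

lemma eq_of_coboundary_eq_zero [ConnectedSpace X] {u : Γ.V → ℝ} (h : Γ.coboundary u = 0)
    (v w : Γ.V) : u v = u w := by
  have := Γ.pathConnectedSpace
  have h1 := Γ.integral_coboundary u (PathConnectedSpace.somePath (v : X) w)
  rw [h, map_zero, extension_vertex, extension_vertex] at h1
  linarith

lemma nonempty_V [hX : ConnectedSpace X] : Nonempty Γ.V := by
  obtain ⟨x⟩ := hX.toNonempty
  rcases Γ.mem_V_or_exists x with h | ⟨e, -, -⟩
  · exact ⟨x, h⟩
  · exact ⟨Γ.src e⟩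

lemma finrank_ker_coboundary [ConnectedSpace X] :
    Module.finrank ℝ (LinearMap.ker Γ.coboundary) = 1 := by
  obtain ⟨v⟩ := Γ.nonempty_V
  refine (finrank_eq_one_iff_of_nonzero' (⟨fun _ => 1, ?_⟩ : LinearMap.ker Γ.coboundary) ?_).mpr ?_
  · rw [LinearMap.mem_ker]
    ext e
    simp [coboundary_apply]
  · intro h
    simpa using congrFun (congrArg Subtype.val h) v
  · rintro ⟨u, hu⟩
    refine ⟨u v, Subtype.ext (funext fun w => ?_)⟩
    simpa using Γ.eq_of_coboundary_eq_zero hu v w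

lemma finrank_range_coboundary [ConnectedSpace X] :
    Module.finrank ℝ (LinearMap.range Γ.coboundary) + 1 = Fintype.card Γ.V := by
  rw [← Module.finrank_fintype_fun_eq_card (R := ℝ), ← Γ.coboundary.finrank_range_add_finrank_ker,
    finrank_ker_coboundary]

/-- The first Betti number is at most the number of generators of the fundamental group. -/
theorem card_edge_le [ConnectedSpace X] {x : X} {S : Finset (FundamentalGroup X x)}
    (hS : Subgroup.closure (S : Set (FundamentalGroup X x)) = ⊤) :
    Fintype.card Γ.E + 1 ≤ Fintype.card Γ.V + S.card := by
  let L : (Γ.E → ℝ) →ₗ[ℝ] (S → ℝ) := LinearMap.pi fun g => Γ.integralClass g.1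
  -- A cochain with zero integral over the generators has zero integral over all loops, so it is a
  -- coboundary. Comparing dimensions gives the bound.
  have hker : LinearMap.ker L ≤ LinearMap.range Γ.coboundary := by
    intro φ hφ
    obtain ⟨u, hu⟩ := Γ.exists_coboundary_eq (x := x) (φ := φ) fun p =>
      Γ.integral_eq_zero_of_closure hS (fun g hg => congrFun (LinearMap.mem_ker.mp hφ) ⟨g, hg⟩) p
    exact ⟨u, hu⟩
  have h1 := L.finrank_range_add_finrank_ker
  rw [Module.finrank_fintype_fun_eq_card] at h1
  have h2 := Submodule.finrank_mono hker
  have h3 : Module.finrank ℝ (LinearMap.range L) ≤ S.card := by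
    refine (Submodule.finrank_le _).trans ?_
    rw [Module.finrank_fintype_fun_eq_card, Fintype.card_coe]
  have h4 := Γ.finrank_range_coboundary
  omega

instance : ContractibleSpace I :=
  (convex_Icc (0 : ℝ) 1).contractibleSpace ⟨0, by simp⟩

/-- The class of an initial segment of an edge. -/
noncomputable def segment (e : Γ.E) (a : I) :
    (FundamentalGroupoid.mk (Γ.src e : X)) ⟶ (FundamentalGroupoid.mk (Γ.edge e a)) :=
  Path.Homotopic.Quotient.map (Path.Homotopic.Quotient.mk (PathConnectedSpace.somePath 0 a))
    (Γ.edge e)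

lemma map_edge_eq (e : Γ.E) {a b : I} (p q : Path a b) :
    Path.Homotopic.Quotient.map (Path.Homotopic.Quotient.mk p) (Γ.edge e) =
    Path.Homotopic.Quotient.map (Path.Homotopic.Quotient.mk q) (Γ.edge e) := by
  rw [Path.Homotopic.Quotient.eq.mpr (SimplyConnectedSpace.paths_homotopic p q)]

lemma segment_zero (e : Γ.E) : Γ.segment e 0 = 𝟙 _ :=
  Γ.map_edge_eq e _ (Path.refl 0)

lemma segment_one (e : Γ.E) : Γ.segment e 1 = Path.Homotopic.Quotient.mk (Γ.edgePath e) :=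
  Γ.map_edge_eq e _ ⟨ContinuousMap.id I, rfl, rfl⟩

lemma segment_comp (e : Γ.E) {a b : I} (p : Path a b) :
    Γ.segment e a ≫ (Path.Homotopic.Quotient.mk (p.map (Γ.edge e).continuous) :
      FundamentalGroupoid.mk (Γ.edge e a) ⟶ FundamentalGroupoid.mk (Γ.edge e b)) =
    Γ.segment e b := by
  refine Eq.trans ?_ (Γ.map_edge_eq e ((PathConnectedSpace.somePath 0 a).trans p) _)
  rw [← Path.Homotopic.Quotient.mk_map, Path.map_trans]
  rfl

/-- The fundamental group of a connected graph is generated by at most `E - V + 1` elements. -/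
theorem exists_generators [ConnectedSpace X] (v₀ : Γ.V) :
    ∃ S : Finset (FundamentalGroup X (v₀ : X)),
      Subgroup.closure (S : Set (FundamentalGroup X (v₀ : X))) = ⊤ ∧
      S.card + Fintype.card Γ.V ≤ Fintype.card Γ.E + 1 := by
  classical
  have := Γ.pathConnectedSpace
  let o : Γ.V → FundamentalGroupoid X := fun w => ⟨w⟩
  let a : ∀ e, o (Γ.src e) ⟶ o (Γ.tgt e) := fun e =>
    Path.Homotopic.Quotient.mk (Γ.edgePath e)
  obtain ⟨q, hq, hcard⟩ := exists_spanning_tree Γ.src Γ.tgt (fun u hu =>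
    Γ.eq_of_coboundary_eq_zero (u := u) (by ext e; simp [coboundary_apply, hu])) o v₀ a
    (fun w => Path.Homotopic.Quotient.mk (PathConnectedSpace.somePath (v₀ : X) w))
  -- The loop going out through the tree, across e, and back; it is trivial for at least V - 1
  -- edges, so the remaining edges suffice as generators.
  let g : Γ.E → FundamentalGroup X (v₀ : X) := fun e => q (Γ.src e) ≫ a e ≫ inv (q (Γ.tgt e))
  let N : Finset Γ.E := Finset.univ.filter fun e => ¬ q (Γ.src e) ≫ a e = q (Γ.tgt e)
  refine ⟨N.image g, ?_, ?_⟩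
  swap
  · have h1 : (N.image g).card ≤ N.card := Finset.card_image_le
    have h2 : (Finset.univ.filter fun e => q (Γ.src e) ≫ a e = q (Γ.tgt e)).card + N.card =
        Fintype.card Γ.E := Finset.card_filter_add_card_filter_not _
    have h3 : Nat.card {e // q (Γ.src e) ≫ a e = q (Γ.tgt e)} =
        (Finset.univ.filter fun e => q (Γ.src e) ≫ a e = q (Γ.tgt e)).card := by
      rw [Nat.card_eq_fintype_card, Fintype.card_subtype]
    omega
  set H := Subgroup.closure ((N.image g : Finset _) : Set (FundamentalGroup X (v₀ : X))) with hH
  have hg : ∀ e, g e ∈ H := by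
    intro e
    by_cases he : q (Γ.src e) ≫ a e = q (Γ.tgt e)
    · have : g e = 1 := by
        change q (Γ.src e) ≫ a e ≫ inv (q (Γ.tgt e)) = 𝟙 _
        rw [← Category.assoc, he, IsIso.hom_inv_id]
      rw [this]
      exact one_mem _
    · exact Subgroup.subset_closure (by
        simp only [Finset.coe_image]
        exact ⟨e, by simp [N, he], rfl⟩)
  have hcomp : ∀ f f' : FundamentalGroup X (v₀ : X), f ∈ H → f' ∈ H → f ≫ f' ∈ H :=
    fun f f' h h' => Subgroup.mul_mem H h' h
  -- Extends the tree paths to every point of X: inside an edge, follow the tree to its source and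
  -- then the edge. Different descriptions of a point agree modulo H, so path induction applies.
  have hQ : ∀ x, ∃ Q : FundamentalGroupoid.mk (v₀ : X) ⟶ FundamentalGroupoid.mk x,
      (∀ w : Γ.V, ∀ h : (w : X) = x, Q = q w ≫ eqToHom (by rw [← h])) ∧
      ∀ e b, ∀ h : Γ.edge e b = x,
        q (Γ.src e) ≫ Γ.segment e b ≫ eqToHom (by rw [← h]) ≫ inv Q ∈ H := by
    intro x
    by_cases hx : x ∈ Γ.V
    · refine ⟨q ⟨x, hx⟩, ?_, ?_⟩
      · rintro w rfl
        simp
      · rintro e b rfl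
        by_cases hb : b ∈ Set.Ioo (0 : I) 1
        · exact absurd hx (Γ.edge_notMem e b hb)
        · have : b = 0 ∨ b = 1 := by
            by_contra! hne
            exact hb ⟨lt_of_le_of_ne b.2.1 fun h => hne.1 h.symm,
              lt_of_le_of_ne b.2.2 fun h => hne.2 h⟩
          rcases this with rfl | rfl
          · rw [segment_zero]
            have : q (Γ.src e) ≫ 𝟙 _ ≫ eqToHom rfl ≫ inv (q (Γ.src e)) = 𝟙 _ := by simp
            exact this ▸ one_mem H
          · rw [segment_one]
            have : q (Γ.src e) ≫ a e ≫ eqToHom rfl ≫ inv (q (Γ.tgt e)) = g e := by simp [g]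
            exact this ▸ hg e
    · obtain ⟨e, b, hb, rfl⟩ := (Γ.covers x).resolve_left hx
      refine ⟨q (Γ.src e) ≫ Γ.segment e b, ?_, ?_⟩
      · intro w h
        exact absurd (h ▸ w.2) hx
      · intro e' b' h
        obtain ⟨rfl, rfl⟩ := Γ.edge_inj e' e b' (Γ.mem_Ioo_of_notMem (h ▸ hx)) b hb h
        have : q (Γ.src e') ≫ Γ.segment e' b' ≫ eqToHom rfl ≫
            inv (q (Γ.src e') ≫ Γ.segment e' b') = 𝟙 _ := by
          rw [eqToHom_refl, Category.id_comp, ← Category.assoc, IsIso.hom_inv_id]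
        exact this ▸ one_mem H
  choose Q hQ1 hQ2 using hQ
  have hQ2' : ∀ e b, q (Γ.src e) ≫ Γ.segment e b ≫ inv (Q (Γ.edge e b)) ∈ H := by
    intro e b
    have := hQ2 _ e b rfl
    rwa [eqToHom_refl, Category.id_comp] at this
  have hQv : Q v₀ = 𝟙 _ := by
    rw [hQ1 v₀ v₀ rfl, hq]
    exact Category.id_comp _
  have key : ∀ {x y : X} (p : Path x y), Q x ≫ (Path.Homotopic.Quotient.mk p :
      FundamentalGroupoid.mk x ⟶ FundamentalGroupoid.mk y) ≫ inv (Q y) ∈ H := by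
    intro x y p
    refine Γ.path_induction (C := fun x y p => Q x ≫ (Path.Homotopic.Quotient.mk p :
      FundamentalGroupoid.mk x ⟶ FundamentalGroupoid.mk y) ≫ inv (Q y) ∈ H) ?_ ?_ ?_ ?_ p
    · intro x y p p' h hp
      rwa [← Path.Homotopic.Quotient.eq.mpr h]
    · intro x y p h
      have hy : y = x := by rw [← p.target, h]
      subst hy
      have : p = Path.refl y := by ext s; exact h s
      subst this
      have : Q y ≫ 𝟙 _ ≫ inv (Q y) = 𝟙 _ := by simp
      exact this ▸ one_mem H
    · intro x y p e τ h
      have hx : x = Γ.edge e (τ 0) := by rw [← h, p.source]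
      have hy : y = Γ.edge e (τ 1) := by rw [← h, p.target]
      subst hx hy
      let P : Path (τ 0) (τ 1) := ⟨τ, rfl, rfl⟩
      have hp : p = P.map (Γ.edge e).continuous := by ext s; exact h s
      have h1 := Γ.segment_comp e P
      rw [← hp] at h1
      have h2 := hcomp _ _ (inv_mem (hQ2' e (τ 0))) (hQ2' e (τ 1))
      rw [← h1] at h2
      convert h2 using 1
      have : (q (Γ.src e) ≫ Γ.segment e (τ 0) ≫ inv (Q (Γ.edge e (τ 0))) :
          FundamentalGroup X (v₀ : X))⁻¹ =
          Groupoid.inv (q (Γ.src e) ≫ Γ.segment e (τ 0) ≫ inv (Q (Γ.edge e (τ 0)))) := rfl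
      rw [this]
      simp
    · intro x y z p p' h h'
      have := hcomp _ _ h h'
      convert this using 1
      let P : FundamentalGroupoid.mk x ⟶ FundamentalGroupoid.mk y :=
        Path.Homotopic.Quotient.mk p
      let P' : FundamentalGroupoid.mk y ⟶ FundamentalGroupoid.mk z :=
        Path.Homotopic.Quotient.mk p'
      change Q x ≫ (P ≫ P') ≫ inv (Q z) = (Q x ≫ P ≫ inv (Q y)) ≫ Q y ≫ P' ≫ inv (Q z)
      simp
  rw [eq_top_iff]
  intro f _
  induction f using Path.Homotopic.Quotient.ind with | mk p =>
  have h := key p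
  rw [hQv, Category.id_comp, IsIso.inv_id, Category.comp_id] at h
  exact h

end FiniteGraph
end Carrier

namespace Carrier

open unitInterval

/-! ### The Lefschetz number of a self-map of a graph -/

-- In a basis adapted to W the matrix is block triangular.
open Module.Basis in
lemma trace_eq_trace_restrict_add_trace_mapQ {K V : Type*} [Field K] [AddCommGroup V] [Module K V]
    [Module.Finite K V] (W : Submodule K V) (e : V →ₗ[K] V) (he : W ≤ W.comap e) :
    LinearMap.trace K V e =
      LinearMap.trace K W (e.restrict he) + LinearMap.trace K (V ⧸ W) (W.mapQ W e he) := by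
  classical
  let bW := Module.Free.chooseBasis K W
  let bQ := Module.Free.chooseBasis K (V ⧸ W)
  rw [LinearMap.trace_eq_matrix_trace K (sumQuot bW bQ), LinearMap.trace_eq_matrix_trace K bW,
    LinearMap.trace_eq_matrix_trace K bQ]
  simp only [Matrix.trace, Matrix.diag_apply, Fintype.sum_sum_type, LinearMap.toMatrix_apply]
  congr 1
  · refine Finset.sum_congr rfl fun i _ => ?_
    rw [sumQuot_inl]
    exact sumQuot_repr_inl_of_mem bW bQ (e (bW i)) (he (bW i).2) i
  · refine Finset.sum_congr rfl fun j _ => ?_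
    rw [sumQuot_repr_inr, ← sumQuot_inr bW bQ j, W.mapQ_apply]
    rfl

/-- An endomorphism of a plane with a one-sided inverse, such that it and its cube have trace
`1`, does not exist. -/
lemma not_trace_eq_one_of_finrank_two {K V : Type*} [Field K] [CharZero K] [AddCommGroup V]
    [Module K V] (hV : Module.finrank K V = 2) (A B : V →ₗ[K] V) (hAB : A ∘ₗ B = LinearMap.id)
    (h1 : LinearMap.trace K V A = 1) (h3 : LinearMap.trace K V (A ∘ₗ A ∘ₗ A) = 1) : False := by
  have : Module.Finite K V := Module.finite_of_finrank_pos (by omega)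
  let b := Module.finBasisOfFinrankEq K V hV
  have hdet : LinearMap.det A * LinearMap.det B = 1 := by
    rw [← LinearMap.det_comp, hAB, LinearMap.det_id]
  rw [LinearMap.trace_eq_matrix_trace K b, LinearMap.toMatrix_comp b b b,
    LinearMap.toMatrix_comp b b b] at h3
  rw [LinearMap.trace_eq_matrix_trace K b] at h1
  rw [← LinearMap.det_toMatrix b A] at hdet
  set M := LinearMap.toMatrix b b A
  -- Since tr M³ = (tr M)³ - 3 (tr M)(det M), the two traces leave 3 det M = 0.
  have hM : M.det = 0 := by
    rw [Matrix.det_fin_two]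
    rw [Matrix.trace_fin_two] at h1
    simp only [Matrix.trace_fin_two, Matrix.mul_apply, Fin.sum_univ_two] at h3
    have : 3 * (M 0 0 * M 1 1 - M 0 1 * M 1 0) = 0 := by
      have e : M 1 1 = 1 - M 0 0 := by linear_combination h1
      rw [e] at h3 ⊢
      linear_combination -h3
    simpa using this
  rw [hM, zero_mul] at hdet
  exact zero_ne_one hdet

namespace FiniteGraph

variable {X : Type} [TopologicalSpace X] (Γ : FiniteGraph X)

/-- The action of a self-map on cellular 1-cochains. -/
noncomputable def pullback (f : C(X, X)) : (Γ.E → ℝ) →ₗ[ℝ] (Γ.E → ℝ) :=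
  LinearMap.pi fun e => Γ.integral ((Γ.edgePath e).map f.continuous)

lemma pullback_apply (f : C(X, X)) (φ : Γ.E → ℝ) (e : Γ.E) :
    Γ.pullback f φ e = Γ.integral ((Γ.edgePath e).map f.continuous) φ := rfl

/-- The action of a self-map on 0-cochains. -/
noncomputable def pullbackVertex (f : C(X, X)) : (Γ.V → ℝ) →ₗ[ℝ] (Γ.V → ℝ) where
  toFun u v := Γ.extension u (f v)
  map_add' u u' := by
    ext v
    rcases Γ.mem_V_or_exists (f v) with h | ⟨e, s, h⟩
    · have := fun u => Γ.extension_vertex u ⟨f v, h⟩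
      simp only at this
      simp only [this, Pi.add_apply]
    · simp only [← h, extension_edge, Pi.add_apply]
      ring
  map_smul' r u := by
    ext v
    rcases Γ.mem_V_or_exists (f v) with h | ⟨e, s, h⟩
    · have := fun u => Γ.extension_vertex u ⟨f v, h⟩
      simp only at this
      simp only [this, Pi.smul_apply, RingHom.id_apply]
    · simp only [← h, extension_edge, Pi.smul_apply, RingHom.id_apply, smul_eq_mul]
      ring

lemma pullbackVertex_apply (f : C(X, X)) (u : Γ.V → ℝ) (v : Γ.V) :
    Γ.pullbackVertex f u v = Γ.extension u (f v) := rfl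

/-- The map f need not send vertices to vertices. Evaluating the piecewise linear extension at f v
makes the pullbacks a cochain map exactly, with no cellular approximation. -/
lemma pullback_coboundary (f : C(X, X)) (u : Γ.V → ℝ) :
    Γ.pullback f (Γ.coboundary u) = Γ.coboundary (Γ.pullbackVertex f u) := by
  ext e
  rw [pullback_apply, integral_coboundary]
  rfl

lemma range_coboundary_le (f : C(X, X)) : LinearMap.range Γ.coboundary ≤
    (LinearMap.range Γ.coboundary).comap (Γ.pullback f) := by
  rintro _ ⟨u, rfl⟩
  exact ⟨_, (Γ.pullback_coboundary f u).symm⟩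

/-- The first cohomology of the graph. -/
abbrev Cohomology := (Γ.E → ℝ) ⧸ LinearMap.range Γ.coboundary

/-- The action of a self-map on cohomology. -/
noncomputable def cohomologyMap (f : C(X, X)) : Γ.Cohomology →ₗ[ℝ] Γ.Cohomology :=
  Submodule.mapQ _ _ (Γ.pullback f) (Γ.range_coboundary_le f)

lemma finrank_cohomology [ConnectedSpace X] :
    Module.finrank ℝ Γ.Cohomology + Fintype.card Γ.V = Fintype.card Γ.E + 1 := by
  have h1 : Module.finrank ℝ Γ.Cohomology + _ = _ :=
    (LinearMap.range Γ.coboundary).finrank_quotient_add_finrank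
  rw [Module.finrank_fintype_fun_eq_card] at h1
  have h2 := Γ.finrank_range_coboundary
  omega

/-- The first Betti number is the rank of the fundamental group. -/
theorem finrank_cohomology_eq [ConnectedSpace X] {n : ℕ}
    (h : ∀ x, HasRank (FundamentalGroup X x) n) : Module.finrank ℝ Γ.Cohomology = n := by
  have h0 := Γ.finrank_cohomology
  obtain ⟨v⟩ := Γ.nonempty_V
  obtain ⟨S, hS, hcard⟩ := Γ.exists_generators v
  obtain ⟨_, hn⟩ := h (v : X)
  obtain ⟨T, hT, hTcl⟩ := Group.rank_spec (FundamentalGroup X (v : X))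
  have h1 := Γ.card_edge_le hTcl
  have h2 := Group.rank_le hS
  omega

/-- The integral of a cochain over the image of a path, up to a boundary term. -/
lemma exists_integral_map_eq (f : C(X, X)) (φ : Γ.E → ℝ) : ∃ w : X → ℝ,
    ∀ {x y : X} (p : Path x y), Γ.integral (p.map f.continuous) φ =
      Γ.integral p (Γ.pullback f φ) + (w y - w x) := by
  let J : Γ.E → I → ℝ := fun e b =>
    Γ.integral (((PathConnectedSpace.somePath (0 : I) b).map (Γ.edge e).continuous).map
      f.continuous) φ
  have hJ : ∀ e {a b : I} (P : Path a b),
      Γ.integral ((P.map (Γ.edge e).continuous).map f.continuous) φ = J e b - J e a := by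
    intro e a b P
    have h1 := Γ.integral_congr (((SimplyConnectedSpace.paths_homotopic
      ((PathConnectedSpace.somePath (0 : I) a).trans P)
      (PathConnectedSpace.somePath (0 : I) b)).map (Γ.edge e)).map f)
    rw [Path.map_trans, Path.map_trans, integral_trans] at h1
    have h2 := LinearMap.congr_fun h1 φ
    rw [LinearMap.add_apply] at h2
    simp only [J]
    linarith
  have hJ0 : ∀ e, J e 0 = 0 := fun e => by
    have := hJ e (PathConnectedSpace.somePath (0 : I) 0)
    rw [sub_self] at this
    exact this
  have hJ1 : ∀ e, J e 1 = Γ.pullback f φ e := fun e => by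
    have := hJ e (⟨ContinuousMap.id I, rfl, rfl⟩ : Path (0 : I) 1)
    rw [hJ0, sub_zero] at this
    exact this.symm
  -- The correction w measures how far the integral along the image of an edge is from growing
  -- linearly in the parameter; it vanishes at the vertices.
  have hw : ∀ x, ∃ w : ℝ, (x ∈ Γ.V → w = 0) ∧
      ∀ e (b : I), Γ.edge e b = x → w = J e b - b * Γ.pullback f φ e := by
    intro x
    by_cases hx : x ∈ Γ.V
    · refine ⟨0, fun _ => rfl, ?_⟩
      rintro e b rfl
      by_cases hb : b ∈ Set.Ioo (0 : I) 1
      · exact absurd hx (Γ.edge_notMem e b hb)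
      · have : b = 0 ∨ b = 1 := by
          by_contra! hne
          exact hb ⟨lt_of_le_of_ne b.2.1 fun h => hne.1 h.symm,
            lt_of_le_of_ne b.2.2 fun h => hne.2 h⟩
        rcases this with rfl | rfl
        · simp [hJ0]
        · simp [hJ1]
    · obtain ⟨e, b, hb, rfl⟩ := (Γ.covers x).resolve_left hx
      refine ⟨J e b - b * Γ.pullback f φ e, fun h => absurd h hx, fun e' b' h => ?_⟩
      obtain ⟨rfl, rfl⟩ := Γ.edge_inj e' e b' (Γ.mem_Ioo_of_notMem (h ▸ hx)) b hb h
      rfl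
  choose w hw1 hw2 using hw
  refine ⟨w, fun {x y} p => ?_⟩
  refine Γ.path_induction (C := fun x y p => Γ.integral (p.map f.continuous) φ =
      Γ.integral p (Γ.pullback f φ) + (w y - w x)) ?_ ?_ ?_ ?_ p
  · intro x y p q h hp
    rwa [← Γ.integral_congr h, ← Γ.integral_congr (h.map f)]
  · intro x y p h
    have hy : y = x := by rw [← p.target, h]
    rw [Γ.integral_const p h, Γ.integral_const _ fun s => congrArg f (h s), hy]
    simp
  · intro x y p e τ h
    have hx : x = Γ.edge e (τ 0) := by rw [← h, p.source]
    have hy : y = Γ.edge e (τ 1) := by rw [← h, p.target]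
    subst hx hy
    let P : Path (τ 0) (τ 1) := ⟨τ, rfl, rfl⟩
    have hp : p = P.map (Γ.edge e).continuous := by ext s; exact h s
    rw [Γ.integral_of_edge p τ h, hp, hJ, hw2 _ e _ rfl, hw2 _ e _ rfl]
    ring
  · intro x y z p q hp hq
    rw [Path.map_trans, integral_trans, integral_trans, LinearMap.add_apply, LinearMap.add_apply,
      hp, hq]
    ring

/-- On cochains functoriality fails by the boundary term of `exists_integral_map_eq`, which along
the image of an edge is the coboundary of v ↦ w (f v). -/
lemma cohomologyMap_comp (g f : C(X, X)) :
    Γ.cohomologyMap (g.comp f) = Γ.cohomologyMap f ∘ₗ Γ.cohomologyMap g := by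
  apply Submodule.linearMap_qext
  ext1 φ
  change Submodule.Quotient.mk (Γ.pullback (g.comp f) φ) =
    Submodule.Quotient.mk (Γ.pullback f (Γ.pullback g φ))
  rw [Submodule.Quotient.eq]
  obtain ⟨w, hw⟩ := Γ.exists_integral_map_eq g φ
  refine ⟨fun v => w (f v), funext fun e => ?_⟩
  have := hw ((Γ.edgePath e).map f.continuous)
  change _ = Γ.integral (((Γ.edgePath e).map f.continuous).map g.continuous) φ - _
  rw [this, coboundary_apply, pullback_apply]
  ring

lemma cohomologyMap_id : Γ.cohomologyMap (ContinuousMap.id X) = LinearMap.id := by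
  apply Submodule.linearMap_qext
  ext1 φ
  change Submodule.Quotient.mk (Γ.pullback (ContinuousMap.id X) φ) = Submodule.Quotient.mk φ
  congr 1
  ext e
  exact Γ.integral_edgePath e φ

/-- A self-map of a connected graph which moves every edge off itself has trace `1` on the first
cohomology. -/
theorem trace_cohomologyMap [ConnectedSpace X] {f : C(X, X)} (hV : ∀ v : Γ.V, f v ≠ v)
    (hE : ∀ e s t, f (Γ.edge e s) ≠ Γ.edge e t) :
    LinearMap.trace ℝ _ (Γ.cohomologyMap f) = 1 := by
  classical
  have := Γ.pathConnectedSpace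
  -- Diagonal entries vanish because the image of an edge misses that edge, so it has no
  -- displacement along it.
  have h1 : LinearMap.trace ℝ _ (Γ.pullback f) = 0 := by
    rw [LinearMap.trace_eq_matrix_trace ℝ (Pi.basisFun ℝ Γ.E)]
    refine Finset.sum_eq_zero fun e _ => ?_
    rw [Matrix.diag_apply, LinearMap.toMatrix_apply, Pi.basisFun_repr, Pi.basisFun_apply,
      pullback_apply, integral_apply]
    refine Finset.sum_eq_zero fun e' _ => ?_
    by_cases he : e' = e
    · subst he
      rw [Γ.displacement_of_disjoint _ fun s t => hE e' s t, zero_mul]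
    · rw [Pi.single_eq_of_ne he, mul_zero]
  -- The extension of the indicator of v is nonzero only at v and on edges ending at v, and f v
  -- avoids all of these.
  have h0 : LinearMap.trace ℝ _ (Γ.pullbackVertex f) = 0 := by
    rw [LinearMap.trace_eq_matrix_trace ℝ (Pi.basisFun ℝ Γ.V)]
    refine Finset.sum_eq_zero fun v _ => ?_
    rw [Matrix.diag_apply, LinearMap.toMatrix_apply, Pi.basisFun_repr, Pi.basisFun_apply,
      pullbackVertex_apply]
    rcases Γ.mem_V_or_exists (f v) with h | ⟨e, s, h⟩
    · refine (Γ.extension_vertex _ ⟨f v, h⟩).trans (Pi.single_eq_of_ne ?_ _)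
      exact fun h => hV v (congrArg Subtype.val h)
    · rw [← h, extension_edge, Pi.single_eq_of_ne, Pi.single_eq_of_ne]
      · ring
      · rintro rfl
        exact hE e 1 s h.symm
      · rintro rfl
        exact hE e 0 s h.symm
  have hK : LinearMap.ker Γ.coboundary ≤ (LinearMap.ker Γ.coboundary).comap (Γ.pullbackVertex f) := by
    intro u hu
    rw [Submodule.mem_comap, LinearMap.mem_ker, ← pullback_coboundary, LinearMap.mem_ker.mp hu,
      map_zero]
  -- On 0-cochains: 0 = 1 + trace on the quotient by constants. On 1-cochains: 0 = trace on
  -- coboundaries + trace on cohomology. The coboundary identifies the two middle terms.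
  have h2 := trace_eq_trace_restrict_add_trace_mapQ _ _ hK
  have h3 := trace_eq_trace_restrict_add_trace_mapQ _ _ (Γ.range_coboundary_le f)
  have h4 : (Γ.pullbackVertex f).restrict hK = LinearMap.id := by
    ext ⟨u, hu⟩ v
    have hu' := Γ.integral_coboundary u (PathConnectedSpace.somePath (v : X) (f v))
    rw [LinearMap.mem_ker.mp hu, map_zero, extension_vertex] at hu'
    change Γ.extension u (f v) = u v
    linarith
  have h5 : (Γ.pullback f).restrict (Γ.range_coboundary_le f) =
      Γ.coboundary.quotKerEquivRange.conj (Submodule.mapQ _ _ (Γ.pullbackVertex f) hK) := by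
    apply LinearMap.ext
    rintro ⟨_, u, rfl⟩
    apply Subtype.ext
    have hs : Γ.coboundary.quotKerEquivRange.symm ⟨Γ.coboundary u, ⟨u, rfl⟩⟩ =
        Submodule.Quotient.mk u := by
      rw [LinearEquiv.symm_apply_eq]
      rfl
    rw [LinearEquiv.conj_apply_apply, hs, Submodule.mapQ_apply]
    exact Γ.pullback_coboundary f u
  rw [h4, LinearMap.trace_id, finrank_ker_coboundary, h0] at h2
  rw [h5, LinearMap.trace_conj', h1] at h3
  unfold cohomologyMap
  push_cast at h2
  linarith

end FiniteGraph
end Carrier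

namespace Carrier

open unitInterval

namespace FiniteGraph

variable {X : Type} [TopologicalSpace X] (Γ : FiniteGraph X)

/-! ### Subdivision -/

/-- The point `(k + s) / N` of the unit interval. -/
noncomputable def gridMap (N : ℕ) (k : Fin N) : C(I, I) where
  toFun s := ⟨(k + s) / N, by
    have hN : (0 : ℝ) < N := by exact_mod_cast k.pos
    have hk : (k : ℝ) + 1 ≤ N := by exact_mod_cast k.2
    have h0 := s.2.1
    have h1 := s.2.2
    exact ⟨by positivity, by rw [div_le_one hN]; linarith⟩⟩
  continuous_toFun := by fun_prop

lemma coe_gridMap {N : ℕ} (k : Fin N) (s : I) : (gridMap N k s : ℝ) = (k + s) / N := rfl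

lemma gridMap_mem_Ioo {N : ℕ} (k : Fin N) {s : I} (hs : s ∈ Set.Ioo (0 : I) 1) :
    gridMap N k s ∈ Set.Ioo (0 : I) 1 := by
  have hN : (0 : ℝ) < N := by exact_mod_cast k.pos
  have hk : (k : ℝ) + 1 ≤ N := by exact_mod_cast k.2
  have h0 : (0 : ℝ) < s := hs.1
  have h1 : (s : ℝ) < 1 := hs.2
  refine ⟨?_, ?_⟩
  · change (0 : ℝ) < (k + s) / N
    positivity
  · change ((k : ℝ) + s) / N < 1
    rw [div_lt_one hN]
    linarith

lemma gridMap_inj {N : ℕ} {k k' : Fin N} {s s' : I} (hs : s ∈ Set.Ioo (0 : I) 1)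
    (hs' : (s' : ℝ) < 1) (h : gridMap N k s = gridMap N k' s') : k = k' ∧ s = s' := by
  have hN : (0 : ℝ) < N := by exact_mod_cast k.pos
  have h0 : (0 : ℝ) ≤ s' := s'.2.1
  have h1 : (s : ℝ) < 1 := hs.2
  have h2 : (0 : ℝ) < s := hs.1
  have h3 : (k : ℝ) + s = k' + s' := by
    have := congrArg Subtype.val h
    rw [coe_gridMap, coe_gridMap] at this
    field_simp at this
    exact this
  have h4 : (k : ℕ) < (k' : ℕ) + 1 := by
    have : ((k : ℕ) : ℝ) < ((k' : ℕ) : ℝ) + 1 := by linarith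
    exact_mod_cast this
  have h5 : (k' : ℕ) < (k : ℕ) + 1 := by
    have : ((k' : ℕ) : ℝ) < ((k : ℕ) : ℝ) + 1 := by linarith
    exact_mod_cast this
  have h6 : k = k' := by ext; omega
  subst h6
  exact ⟨rfl, Subtype.ext (by linarith)⟩

/-- The graph obtained by dividing every edge into `N` edges. -/
noncomputable def subdivide (N : ℕ) (hN : 0 < N) : FiniteGraph X where
  t2 := Γ.t2
  V := Γ.V ∪ Set.range fun p : Γ.E × Fin N => Γ.edge p.1 (gridMap N p.2 0)
  finite_V := Γ.finite_V.union (Set.finite_range _)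
  E := Γ.E × Fin N
  fintype_E := inferInstance
  edge p := (Γ.edge p.1).comp (gridMap N p.2)
  edge_zero_mem p := Or.inr ⟨p, rfl⟩
  edge_one_mem p := by
    obtain ⟨e, k⟩ := p
    by_cases hk : (k : ℕ) + 1 < N
    · refine Or.inr ⟨(e, ⟨k + 1, hk⟩), ?_⟩
      change Γ.edge e _ = Γ.edge e _
      congr 1
      apply Subtype.ext
      simp [coe_gridMap]
    · have hk' : (k : ℕ) + 1 = N := by omega
      have h1 : gridMap N k 1 = 1 := by
        apply Subtype.ext
        rw [coe_gridMap]
        have : (k : ℝ) + 1 = N := by exact_mod_cast hk'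
        have hN' : (N : ℝ) ≠ 0 := by exact_mod_cast hN.ne'
        simp [this, hN']
      change Γ.edge e (gridMap N k 1) ∈ _
      rw [h1]
      exact Or.inl (Γ.edge_one_mem e)
  edge_notMem := by
    rintro ⟨e, k⟩ s hs (h | ⟨⟨e', k'⟩, h⟩)
    · exact Γ.edge_notMem e _ (gridMap_mem_Ioo k hs) h
    · have h0 := Γ.edge_notMem e _ (gridMap_mem_Ioo k hs)
      have h' : Γ.edge e' (gridMap N k' 0) = Γ.edge e (gridMap N k s) := h
      have h1 := Γ.edge_inj e' e _ (Γ.mem_Ioo_of_notMem (h' ▸ h0)) _ (gridMap_mem_Ioo k hs) h'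
      have h2 := (gridMap_inj hs (s' := 0) (by simp) h1.2.symm).2
      exact absurd h2 hs.1.ne'
  edge_inj := by
    rintro ⟨e, k⟩ ⟨e', k'⟩ s hs s' hs' h
    have h1 := Γ.edge_inj e e' _ (gridMap_mem_Ioo k hs) _ (gridMap_mem_Ioo k' hs') h
    have h2 := gridMap_inj hs (show (s' : ℝ) < 1 from hs'.2) h1.2
    exact ⟨Prod.ext h1.1 h2.1, h2.2⟩
  covers := by
    intro x
    rcases Γ.covers x with h | ⟨e, s, hs, rfl⟩
    · exact Or.inl (Or.inl h)
    have hN' : (0 : ℝ) < N := by exact_mod_cast hN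
    have h0 : (0 : ℝ) < s := hs.1
    have h1 : (s : ℝ) < 1 := hs.2
    have hf := Nat.floor_le (mul_pos h0 hN').le
    have hf' := Nat.lt_floor_add_one ((s : ℝ) * N)
    have hk : ⌊(s : ℝ) * N⌋₊ < N := by
      rw [Nat.floor_lt (mul_pos h0 hN').le]
      nlinarith
    set k : Fin N := ⟨_, hk⟩ with hkdef
    have hk' : ((k : ℕ) : ℝ) = ⌊(s : ℝ) * N⌋₊ := rfl
    have hg : gridMap N k ⟨s * N - k, by constructor <;> linarith⟩ = s := by
      apply Subtype.ext
      rw [coe_gridMap]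
      field_simp
      ring
    by_cases hz : (s : ℝ) * N - k = 0
    · refine Or.inl (Or.inr ⟨(e, k), ?_⟩)
      change Γ.edge e _ = _
      rw [← hg]
      congr 2
      exact Subtype.ext hz.symm
    · refine Or.inr ⟨(e, k), _, ⟨?_, ?_⟩, congrArg (Γ.edge e) hg⟩
      · change (0 : ℝ) < s * N - k
        exact lt_of_le_of_ne (by linarith) (Ne.symm hz)
      · change (s : ℝ) * N - k < 1
        linarith

/-- A map without fixed points moves the edges of sufficiently fine subdivisions off
themselves. -/
lemma eventually_edge_ne (Γ : FiniteGraph X) {f : C(X, X)} (hf : ∀ x, f x ≠ x) :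
    ∀ᶠ N : ℕ in Filter.atTop, ∀ (e : Γ.E) (a b : I), |(a : ℝ) - b| ≤ 1 / N →
      f (Γ.edge e a) ≠ Γ.edge e b := by
  have := Γ.t2
  rw [Filter.eventually_all]
  intro e
  -- On this compact set |a - b| is positive, hence bounded below by some δ; pieces shorter than δ
  -- are moved off themselves.
  have hK : IsCompact {p : I × I | f (Γ.edge e p.1) = Γ.edge e p.2} :=
    (isClosed_eq (by fun_prop) (by fun_prop)).isCompact
  obtain ⟨δ, hδ, h⟩ := hK.exists_forall_le' (f := fun p : I × I => |(p.1 : ℝ) - p.2|) (a := 0)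
    (by fun_prop) (fun p hp => abs_pos.mpr fun h => hf (Γ.edge e p.1) (by
      have h2 : p.1 = p.2 := Subtype.ext (sub_eq_zero.mp h)
      have h1 : f (Γ.edge e p.1) = Γ.edge e p.2 := hp
      rw [h1, h2]))
  have hlim := (tendsto_one_div_atTop_nhds_zero_nat (𝕜 := ℝ)).eventually_lt_const hδ
  filter_upwards [hlim] with N hN a b hab heq
  exact absurd (h (a, b) heq) (not_le.mpr (hab.trans_lt hN))

lemma exists_subdivision (Γ : FiniteGraph X) {f g : C(X, X)} (hf : ∀ x, f x ≠ x)
    (hg : ∀ x, g x ≠ x) : ∃ Δ : FiniteGraph X,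
      (∀ e s t, f (Δ.edge e s) ≠ Δ.edge e t) ∧ ∀ e s t, g (Δ.edge e s) ≠ Δ.edge e t := by
  obtain ⟨N, ⟨h1, h2⟩, hN⟩ := (((Γ.eventually_edge_ne hf).and (Γ.eventually_edge_ne hg)).and
    (Filter.eventually_gt_atTop 0)).exists
  have hclose : ∀ (k : Fin N) (s t : I), |(gridMap N k s : ℝ) - gridMap N k t| ≤ 1 / N := by
    intro k s t
    have hN' : (0 : ℝ) < N := by exact_mod_cast hN
    rw [coe_gridMap, coe_gridMap, ← sub_div, abs_div, abs_of_pos hN']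
    gcongr
    rw [abs_le]
    have := s.2.1
    have := s.2.2
    have := t.2.1
    have := t.2.2
    constructor <;> linarith
  exact ⟨Γ.subdivide N hN, fun e s t => h1 e.1 _ _ (hclose e.2 s t),
    fun e s t => h2 e.1 _ _ (hclose e.2 s t)⟩

/-- A homeomorphism of a connected graph of rank two cannot be fixed-point free together with its
third iterate. -/
theorem exists_fixed_point [ConnectedSpace X] (Γ : FiniteGraph X)
    (hX : ∀ x, HasRank (FundamentalGroup X x) 2) (η : X ≃ₜ X) (h1 : ∀ x, η x ≠ x)
    (h3 : ∀ x, η (η (η x)) ≠ x) : False := by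
  let f : C(X, X) := η
  let g : C(X, X) := η.symm
  -- A single subdivision serves both η and its cube, so that both traces refer to the same
  -- cohomology space.
  obtain ⟨Δ, hf, hf3⟩ := Γ.exists_subdivision (f := f) (g := f.comp (f.comp f)) h1 h3
  refine not_trace_eq_one_of_finrank_two (Δ.finrank_cohomology_eq hX) (Δ.cohomologyMap f)
    (Δ.cohomologyMap g) ?_ (Δ.trace_cohomologyMap (fun v => h1 v) hf) ?_
  · rw [← cohomologyMap_comp, ← cohomologyMap_id]
    congr 1
    ext x
    exact η.symm_apply_apply x
  · rw [← cohomologyMap_comp, ← cohomologyMap_comp]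
    exact Δ.trace_cohomologyMap (fun v => h3 v) hf3

end FiniteGraph

/-! ### Composition with an isometry -/

variable {M : Type*} [MetricSpace M] {X : Type} [TopologicalSpace X]

lemma graphLength_compIsometry (Γ : FiniteGraph X) (h : M ≃ᵢ M) (f : C(X, M)) :
    graphLength Γ (compIsometry h f) = graphLength Γ f := by
  refine Finset.sum_congr rfl fun e _ => ?_
  unfold edgeLength eVariationOn
  refine iSup_congr fun p => Finset.sum_congr rfl fun i _ => ?_
  exact h.isometry.edist_eq _ _

lemma IsCarrierGraph.compIsometry {Γ : FiniteGraph X} {f : C(X, M)} (hf : IsCarrierGraph Γ f)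
    {n : ℕ} (hM : ∀ x : M, HasRank (FundamentalGroup M x) n) (h : M ≃ᵢ M) :
    IsCarrierGraph Γ (compIsometry h f) where
  connected := hf.connected
  surjective x c := by
    induction c using Path.Homotopic.Quotient.ind with | mk p =>
    let q : Path (f x) (f x) := (p.map h.symm.continuous).cast (h.symm_apply_apply _).symm
      (h.symm_apply_apply _).symm
    obtain ⟨g, hg⟩ := hf.surjective x (Path.Homotopic.Quotient.mk q)
    refine ⟨g, ?_⟩
    induction g using Path.Homotopic.Quotient.ind with | mk r =>
    have hrq : (r.map f.continuous).Homotopic q := Path.Homotopic.Quotient.exact hg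
    have hqp : q.map h.continuous = p := by
      ext s
      exact h.apply_symm_apply _
    have := hrq.map (⟨h, h.continuous⟩ : C(M, M))
    exact Path.Homotopic.Quotient.eq.mpr (this.trans (by rw [← hqp]))
  rank_eq x := by
    obtain ⟨m, h1, h2⟩ := hf.rank_eq x
    obtain rfl := h2.eq (hM _)
    exact ⟨m, h1, hM _⟩
  rectifiable e := by
    have : edgeLength Γ (Carrier.compIsometry h f) e = edgeLength Γ f e := by
      unfold edgeLength eVariationOn
      refine iSup_congr fun p => Finset.sum_congr rfl fun i _ => ?_
      exact h.isometry.edist_eq _ _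
    rw [this]
    exact hf.rectifiable e

lemma IsMinimalLength.compIsometry {Γ : FiniteGraph X} {f : C(X, M)} (hf : IsMinimalLength Γ f)
    {n : ℕ} (hM : ∀ x : M, HasRank (FundamentalGroup M x) n) (h : M ≃ᵢ M) :
    IsMinimalLength Γ (compIsometry h f) := by
  refine ⟨hf.1.compIsometry hM h, fun Y _ Δ g hg => ?_⟩
  rw [graphLength_compIsometry]
  exact hf.2 Y Δ g hg

/-- Composing a carrier graph of rank two with a fixed-point-free isometry of finite order not
divisible by `3` changes its strong equivalence class. -/
theorem IsCarrierGraph.not_stronglyEquivalent {Γ : FiniteGraph X} {f : C(X, M)}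
    (hf : IsCarrierGraph Γ f) (hM : ∀ x : M, HasRank (FundamentalGroup M x) 2) {h : M ≃ᵢ M}
    (hfix : ∀ x, h x ≠ x) (h3 : ¬ 3 ∣ orderOf h) :
    ¬ StronglyEquivalent (Carrier.compIsometry h f) f := by
  rintro ⟨η, hη⟩
  have hη' : ∀ x, f (η x) = h (f x) := fun x => (hη x).symm
  have := hf.connected
  refine FiniteGraph.exists_fixed_point Γ (fun x => ?_) η (fun x hx => ?_) fun x hx => ?_
  · obtain ⟨n, h1, h2⟩ := hf.rank_eq x
    obtain rfl := h2.eq (hM _)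
    exact h1
  · exact hfix (f x) (by rw [← hη', hx])
  · have hcube : (h ^ 3) (f x) = f x := by
      change h (h (h (f x))) = f x
      rw [← hη', ← hη', ← hη', hx]
    -- As 3 is prime to the order, h is a power of h³ and would fix whatever h³ fixes.
    obtain ⟨m, hm⟩ := exists_pow_eq_self_of_coprime
      ((Nat.Prime.coprime_iff_not_dvd Nat.prime_three).mpr h3)
    have hpow : ∀ m : ℕ, ((h ^ 3) ^ m) (f x) = f x := by
      intro m
      induction m with
      | zero => rfl
      | succ m ih =>
        rw [pow_succ, IsometryEquiv.mul_apply, hcube, ih]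
    exact hfix (f x) (by rw [← hm]; exact hpow m)

end Carrier

namespace Carrier

open unitInterval OrbitSpace

/-! ### Graphs labelled by group elements -/

section Labelled

variable {G V : Type*} [Group G]

/-- A family of sets of group elements, indexed by the vertices, is compatible with the labelled
edge `a`. -/
def EdgeRel (P : V → G → Prop) (a : V × G × V) : Prop := ∀ h, P a.1 h ↔ P a.2.2 (h * a.2.1)

/-- The vertices in `S` lie in one component of the covering graph determined by the labels. -/
def FullOn (S : Finset V) (L : List (V × G × V)) : Prop :=
  ∀ P : V → G → Prop, (∀ a ∈ L, EdgeRel P a) → ∀ v ∈ S, ∀ w ∈ S, ∀ g g', P v g ↔ P w g'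

/-- The length of an equivariant map of the covering graph with geodesic edges. -/
noncomputable def labelLength {E : Type*} [MetricSpace E] [MulAction G E] (x : V → E)
    (L : List (V × G × V)) : ℝ :=
  (L.map fun a => dist (x a.1) (a.2.1 • x a.2.2)).sum

end Labelled

variable {G E : Type*} [Group G] [MetricSpace E] [MulAction G E] [FreeIsometricAction G E]

lemma FreeIsometricAction.eq_of_smul_eq {g g' : G} {x : E} (h : g • x = g' • x) : g = g' := by
  obtain ⟨δ, hδ, h'⟩ := FreeIsometricAction.exists_le_dist (G := G) x
  by_contra hne
  have h1 := h' (g⁻¹ * g') fun h1 => hne (inv_mul_eq_one.mp h1)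
  rw [mul_smul, ← h, inv_smul_smul, dist_self] at h1
  linarith

/-- The endpoints of a lift are at most as far apart as the path is long. -/
lemma edist_le_eVariationOn_proj (l : C(I, E)) :
    edist (l 0) (l 1) ≤ eVariationOn (fun s => proj G (l s)) Set.univ := by
  -- Cut the lift into pieces inside balls on which the projection is isometric; the partition sum
  -- downstairs then equals the one upstairs.
  choose r hr hiso using fun x : E => exists_isometric_ball (G := G) x
  obtain ⟨t, ht0, htm, ⟨N, hN⟩, ht⟩ := exists_monotone_Icc_subset_open_cover_unitInterval
    (c := fun x : E => l ⁻¹' Metric.ball x (r x))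
    (fun x => Metric.isOpen_ball.preimage l.continuous)
    (fun s _ => Set.mem_iUnion.mpr ⟨l s, Metric.mem_ball_self (hr _)⟩)
  have h1 : edist (l (t 0)) (l (t N)) ≤ ∑ i ∈ Finset.range N, edist (l (t i)) (l (t (i + 1))) :=
    edist_le_range_sum_edist (fun i => l (t i)) N
  rw [ht0, hN N le_rfl] at h1
  refine h1.trans ?_
  refine le_trans (le_of_eq ?_) (eVariationOn.sum_le (n := N) htm fun i => Set.mem_univ _)
  refine Finset.sum_congr rfl fun i _ => ?_
  obtain ⟨x, hx⟩ := ht i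
  have ha : l (t i) ∈ Metric.ball x (r x) := hx ⟨le_rfl, htm (Nat.le_succ i)⟩
  have hb : l (t (i + 1)) ∈ Metric.ball x (r x) := hx ⟨htm (Nat.le_succ i), le_rfl⟩
  rw [edist_comm, edist_dist, edist_dist, hiso x _ hb _ ha]

lemma exists_lift_proj {a b : OrbitSpace G E} (p : Path a b) {x : E} (hx : proj G x = a) :
    ∃ l : C(I, E), (∀ s, proj G (l s) = p s) ∧ l 0 = x := by
  have cov := (isQuotientCoveringMap (G := G) (E := E)).isCoveringMap
  obtain ⟨l, h1, h2⟩ := cov.exists_path_lifts p.toContinuousMap x (by simp [hx])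
  exact ⟨l, congrFun h1, h2⟩

lemma eq_of_lift_proj {l l' : C(I, E)} (h : ∀ s, proj G (l s) = proj G (l' s))
    (h0 : l 0 = l' 0) : l = l' := by
  have cov := (isQuotientCoveringMap (G := G) (E := E)).isCoveringMap
  exact DFunLike.coe_injective (cov.eq_of_comp_eq l.continuous l'.continuous (funext h) 0 h0)

/-- Lifting the edges of a carrier graph gives a labelled graph. -/
theorem exists_labels {X : Type} [TopologicalSpace X] [ConnectedSpace X] [PathConnectedSpace E]
    (Γ : FiniteGraph X) (f : C(X, OrbitSpace G E))
    (hf : ∀ x, Function.Surjective (FundamentalGroup.map f x)) :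
    ∃ (x : Γ.V → E) (γ : Γ.E → G),
      FullOn Finset.univ (Finset.univ.toList.map fun e => (Γ.src e, γ e, Γ.tgt e)) ∧
      ∀ e, edist (x (Γ.src e)) (γ e • x (Γ.tgt e)) ≤ edgeLength Γ f e := by
  have := Γ.pathConnectedSpace
  choose x hx using fun v : Γ.V => proj_surjective (G := G) (f v)
  -- Each edge is lifted from the chosen point over its source; the label records which translate of
  -- the point over its target is reached.
  have hl := fun e => exists_lift_proj ((Γ.edgePath e).map f.continuous) (hx (Γ.src e))
  choose l hl hl0 using hl
  have hl1 : ∀ e, ∃ g : G, l e 1 = g • x (Γ.tgt e) := fun e => by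
    rw [← proj_eq_iff, hl, hx, Path.target]
  choose γ hγ using hl1
  refine ⟨x, γ, ?_, fun e => ?_⟩
  swap
  · rw [← hγ, ← hl0]
    refine (edist_le_eVariationOn_proj (G := G) (l e)).trans_eq ?_
    unfold edgeLength
    congr 1
    funext s
    exact hl e s
  intro P hP
  have hP' : ∀ e g, P (Γ.src e) g ↔ P (Γ.tgt e) (g * γ e) := fun e g =>
    hP (Γ.src e, γ e, Γ.tgt e) (List.mem_map_of_mem (Finset.mem_toList.mpr (Finset.mem_univ e))) g
  -- Spreads the invariant family P from vertices to the fibres over all of X, so that it can be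
  -- transported along arbitrary lifted paths. Surjectivity on fundamental groups then joins any two
  -- points of one fibre.
  have hQ : ∀ z : X, ∃ Q : E → Prop, (∀ v : Γ.V, v = z → ∀ g, Q (g • x v) ↔ P v g) ∧
      ∀ e b, Γ.edge e b = z → ∀ g, Q (g • l e b) ↔ P (Γ.src e) g := by
    intro z
    have hex : ∀ (y : E) (R : G → Prop) (g : G), (∃ g', g • y = g' • y ∧ R g') ↔ R g := by
      refine fun y R g => ⟨?_, fun h => ⟨g, rfl, h⟩⟩
      rintro ⟨g', h, h'⟩
      rwa [FreeIsometricAction.eq_of_smul_eq h]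
    by_cases hz : z ∈ Γ.V
    · refine ⟨fun y => ∃ g, y = g • x ⟨z, hz⟩ ∧ P ⟨z, hz⟩ g, ?_, ?_⟩
      · rintro v rfl g
        exact hex _ _ g
      · rintro e b rfl g
        by_cases hb : b ∈ Set.Ioo (0 : I) 1
        · exact absurd hz (Γ.edge_notMem e b hb)
        · have : b = 0 ∨ b = 1 := by
            by_contra! hne
            exact hb ⟨lt_of_le_of_ne b.2.1 fun h => hne.1 h.symm,
              lt_of_le_of_ne b.2.2 fun h => hne.2 h⟩
          rcases this with rfl | rfl
          · rw [hl0]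
            exact hex _ _ g
          · rw [hγ, ← mul_smul, hP']
            exact hex _ _ (g * γ e)
    · obtain ⟨e, b, hb, rfl⟩ := (Γ.covers z).resolve_left hz
      refine ⟨fun y => ∃ g, y = g • l e b ∧ P (Γ.src e) g, ?_, ?_⟩
      · intro v hv
        exact absurd (hv ▸ v.2) hz
      · intro e' b' h
        obtain ⟨rfl, rfl⟩ := Γ.edge_inj e' e b' (Γ.mem_Ioo_of_notMem (h ▸ hz)) b hb h
        exact hex _ _
  choose Q hQ1 hQ2 using hQ
  have key : ∀ {z z' : X} (p : Path z z') (m : C(I, E)), (∀ s, proj G (m s) = f (p s)) →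
      (Q z (m 0) ↔ Q z' (m 1)) := by
    intro z z' p
    refine Γ.path_induction (C := fun z z' p => ∀ m : C(I, E), (∀ s, proj G (m s) = f (p s)) →
      (Q z (m 0) ↔ Q z' (m 1))) ?_ ?_ ?_ ?_ p
    · intro z z' p q h hp m hm
      obtain ⟨m', hm', h0⟩ := exists_lift_proj (p.map f.continuous) (x := m 0) (by rw [hm]; simp)
      have cov := (isQuotientCoveringMap (G := G) (E := E)).isCoveringMap
      have hq := cov.eq_liftPath_iff' (γ := (q.map f.continuous).toContinuousMap) (e := m 0)
        (γ_0 := by rw [hm]; rfl) |>.mpr ⟨funext hm, rfl⟩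
      have hp' := cov.eq_liftPath_iff' (γ := (p.map f.continuous).toContinuousMap) (e := m 0)
        (γ_0 := by rw [hm]; simp) |>.mpr ⟨funext hm', h0⟩
      have h1 : m 1 = m' 1 := by
        rw [hq, hp']
        exact cov.liftPath_apply_one_eq_of_homotopicRel (h.symm.map f) _ _ _
      rw [h1, ← h0]
      exact hp m' hm'
    · intro z z' p h m hm
      have hz : z' = z := by rw [← p.target, h]
      have : m = ContinuousMap.const I (m 0) :=
        eq_of_lift_proj (G := G) (fun s => by rw [hm, h, ContinuousMap.const_apply, hm, h]) rfl
      rw [hz, this]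
      rfl
    · intro z z' p e τ h m hm
      have hz : z = Γ.edge e (τ 0) := by rw [← h, p.source]
      have hz' : z' = Γ.edge e (τ 1) := by rw [← h, p.target]
      obtain ⟨g, hg⟩ : ∃ g : G, m 0 = g • l e (τ 0) := by
        rw [← proj_eq_iff, hm, hl, h]
        rfl
      have hcont : Continuous fun s => g • l e (τ s) :=
        (isometry_smul E g).continuous.comp (by fun_prop)
      have hm' : m = ⟨fun s => g • l e (τ s), hcont⟩ := by
        refine eq_of_lift_proj (G := G) (fun s => ?_) hg
        rw [hm, h]
        exact ((proj_smul _ _).trans (hl e (τ s))).symm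
      rw [hm']
      simp only [ContinuousMap.coe_mk]
      rw [hQ2 z e _ hz.symm, hQ2 z' e _ hz'.symm]
    · intro z z' z'' p q hp hq m hm
      obtain ⟨m₁, h₁, h₁0⟩ := exists_lift_proj (p.map f.continuous) (x := m 0) (by rw [hm]; simp)
      obtain ⟨m₂, h₂, h₂0⟩ := exists_lift_proj (q.map f.continuous) (x := m₁ 1) (by rw [h₁]; simp)
      let p₁ : Path (m₁ 0) (m₁ 1) := ⟨m₁, rfl, rfl⟩
      let p₂ : Path (m₁ 1) (m₂ 1) := ⟨m₂, h₂0, rfl⟩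
      have hm' : m = (p₁.trans p₂).toContinuousMap := by
        refine eq_of_lift_proj (G := G) (fun s => ?_) (by simp [h₁0])
        rw [hm]
        simp only [Path.coe_toContinuousMap, Path.trans_apply]
        split_ifs
        · exact (h₁ _).symm
        · exact (h₂ _).symm
      have h0 : m 0 = m₁ 0 := h₁0.symm
      have h1 : m 1 = m₂ 1 := by rw [hm']; simp
      rw [h0, h1, hp m₁ h₁, ← h₂0]
      exact hq m₂ h₂
  -- all lifts of a point lie in the same class
  have hsame : ∀ (v : Γ.V) (g g' : G), P v g → P v g' := by
    intro v g g' h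
    let m : Path (g • x v) (g' • x v) := PathConnectedSpace.somePath _ _
    let c : Path (f v) (f v) := (m.map (continuous_proj (G := G))).cast
      (by rw [proj_smul, hx]) (by rw [proj_smul, hx])
    obtain ⟨a, ha⟩ := hf v (Path.Homotopic.Quotient.mk c)
    induction a using Path.Homotopic.Quotient.ind with | mk r =>
    have hr : (r.map f.continuous).Homotopic c := Path.Homotopic.Quotient.exact ha
    obtain ⟨m', hm', h0⟩ := exists_lift_proj (r.map f.continuous) (x := g • x v)
      (by rw [proj_smul, hx])
    have cov := (isQuotientCoveringMap (G := G) (E := E)).isCoveringMap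
    have e1 := cov.eq_liftPath_iff' (γ := (r.map f.continuous).toContinuousMap) (e := g • x v)
      (γ_0 := by rw [proj_smul, hx]; simp) |>.mpr ⟨funext hm', h0⟩
    have e2 := cov.eq_liftPath_iff' (γ := c.toContinuousMap) (e := g • x v)
      (γ_0 := by rw [proj_smul, hx]; simp) (Γ := m.toContinuousMap) |>.mpr
        ⟨funext fun s => rfl, m.source⟩
    have h1 : m' 1 = g' • x v := by
      rw [← m.target]
      change m' 1 = m.toContinuousMap 1
      rw [e1, e2]
      exact cov.liftPath_apply_one_eq_of_homotopicRel hr _ _ _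
    have h2 := key r m' hm'
    rw [h0, h1, hQ1 v v rfl, hQ1 v v rfl] at h2
    exact h2.mp h
  have hall : ∀ (v w : Γ.V) (g g' : G), P v g → P w g' := by
    intro v w g g' h
    let p : Path (v : X) w := PathConnectedSpace.somePath _ _
    obtain ⟨m, hm, h0⟩ := exists_lift_proj (p.map f.continuous) (x := g • x v)
      (by rw [proj_smul, hx])
    obtain ⟨k, hk⟩ : ∃ k : G, m 1 = k • x w := by
      rw [← proj_eq_iff, hm, hx, Path.target]
    have h2 := key p m hm
    rw [h0, hk, hQ1 v v rfl, hQ1 w w rfl] at h2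
    exact hsame w _ _ (h2.mp h)
  exact fun v _ w _ g g' => ⟨hall v w g g', hall w v g' g⟩

end Carrier

namespace Carrier

/-! ### Reduction to labelled graphs with two vertices -/

section Labelled

variable {G V : Type*}

open Classical in
/-- The number of edge ends at a vertex. -/
noncomputable def labelDegree (w : V) (L : List (V × G × V)) : ℕ :=
  (L.map fun a => (if a.1 = w then 1 else 0) + if a.2.2 = w then 1 else 0).sum

lemma sum_labelDegree {S : Finset V} {L : List (V × G × V)}
    (hL : ∀ a ∈ L, a.1 ∈ S ∧ a.2.2 ∈ S) : ∑ w ∈ S, labelDegree w L = 2 * L.length := by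
  classical
  induction L with
  | nil => simp [labelDegree]
  | cons a L ih =>
    have h1 := hL a List.mem_cons_self
    have h2 := ih fun b hb => hL b (List.mem_cons_of_mem a hb)
    simp only [labelDegree, List.map_cons, List.sum_cons, Finset.sum_add_distrib,
      Finset.sum_ite_eq, h1.1, h1.2, if_true, List.length_cons] at h2 ⊢
    omega

variable [Group G]

lemma EdgeRel.flip {P : V → G → Prop} {a : V × G × V} (h : EdgeRel P (a.2.2, a.2.1⁻¹, a.1)) :
    EdgeRel P a := fun g => by
  have := h (g * a.2.1)
  simp only [mul_inv_cancel_right] at this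
  exact this.symm

variable {E : Type*} [MetricSpace E] [MulAction G E]

lemma labelLength_cons (x : V → E) (a : V × G × V) (L : List (V × G × V)) :
    labelLength x (a :: L) = dist (x a.1) (a.2.1 • x a.2.2) + labelLength x L := by
  simp [labelLength]

lemma labelLength_append (x : V → E) (L L' : List (V × G × V)) :
    labelLength x (L ++ L') = labelLength x L + labelLength x L' := by
  simp [labelLength]

/-- A labelled graph with two vertices: an edge with trivial label joining them, and two further
edges, with labels `a` and `b`. -/
structure ThetaGraph (G E : Type*) where
  /-- the label of the second edge -/
  a : G
  /-- the label of the third edge -/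
  b : G
  /-- the positions of the vertices -/
  x : Bool → E
  /-- the endpoints of the second edge -/
  i : Bool × Bool
  /-- the endpoints of the third edge -/
  j : Bool × Bool

namespace ThetaGraph

/-- The sum of the lengths of the three edges. -/
noncomputable def length (D : ThetaGraph G E) : ℝ :=
  dist (D.x false) (D.x true) + dist (D.x D.i.1) (D.a • D.x D.i.2) +
    dist (D.x D.j.1) (D.b • D.x D.j.2)

/-- The labels generate the group. -/
def Generates (D : ThetaGraph G E) : Prop := Subgroup.closure {D.a, D.b} = ⊤

/-- Missing edges are filled in by loops with trivial label, which have length zero and do not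
change the generated subgroup. -/
lemma exists_of_list (x : Bool → E) (L : List (Bool × G × Bool)) (hL : L.length ≤ 2)
    (h : Subgroup.closure {g | ∃ a ∈ L, a.2.1 = g} = ⊤) :
    ∃ D : ThetaGraph G E, D.Generates ∧
      D.length ≤ dist (x false) (x true) + labelLength x L := by
  match L with
  | [] =>
    refine ⟨⟨1, 1, x, (false, false), (false, false)⟩, ?_, by simp [length, labelLength]⟩
    rw [Generates, eq_top_iff, ← h]
    exact Subgroup.closure_mono (by simp)
  | [r] =>
    refine ⟨⟨r.2.1, 1, x, (r.1, r.2.2), (false, false)⟩, ?_, by simp [length, labelLength]⟩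
    rw [Generates, eq_top_iff, ← h]
    refine Subgroup.closure_mono ?_
    rintro g ⟨a, ha, rfl⟩
    simp at ha
    simp [ha]
  | [r, s] =>
    refine ⟨⟨r.2.1, s.2.1, x, (r.1, r.2.2), (s.1, s.2.2)⟩, ?_,
      by simp [length, labelLength, add_assoc]⟩
    rw [Generates, eq_top_iff, ← h]
    refine Subgroup.closure_mono ?_
    rintro g ⟨a, ha, rfl⟩
    simp only [List.mem_cons, List.not_mem_nil, or_false] at ha
    rcases ha with rfl | rfl <;> simp
  | _ :: _ :: _ :: _ => simp at hL

/-- The case of a labelled graph with one vertex. -/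
lemma exists_of_singleton {x : V → E} {v : V} {L : List (V × G × V)}
    (hL : ∀ a ∈ L, a.1 = v ∧ a.2.2 = v) (hfull : FullOn {v} L) (hlen : L.length ≤ 2) :
    ∃ D : ThetaGraph G E, D.Generates ∧ D.length ≤ labelLength x L := by
  set L' : List (Bool × G × Bool) := L.map fun a => (false, a.2.1, false) with hL'
  have hcl : ∀ a ∈ L, a.2.1 ∈ Subgroup.closure {g | ∃ a ∈ L', a.2.1 = g} := fun a ha =>
    Subgroup.subset_closure ⟨(false, a.2.1, false), List.mem_map_of_mem ha, rfl⟩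
  obtain ⟨D, hD, hD'⟩ := exists_of_list (fun _ => x v) L' (by simpa [hL'] using hlen) (by
      rw [eq_top_iff]
      intro g _
      refine (hfull (fun _ h => h ∈ Subgroup.closure {g | ∃ a ∈ L', a.2.1 = g}) (fun a ha h => ?_) v (by simp) v (by simp)
        1 g).mp (one_mem _)
      exact (Subgroup.mul_mem_cancel_right _ (hcl a ha)).symm)
  refine ⟨D, hD, hD'.trans_eq ?_⟩
  simp only [hL', dist_self, zero_add, labelLength, List.map_map]
  congr 1
  refine List.map_congr_left fun a ha => ?_
  simp [hL a ha]

end ThetaGraph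

variable [IsIsometricSMul G E]

/-- The edges at a vertex can be oriented away from it. -/
lemma exists_star (x : V → E) (w : V) (L : List (V × G × V)) : ∃ A R : List (V × G × V),
    (∀ a ∈ A, a.1 = w) ∧ (∀ a ∈ R, a.1 ≠ w ∧ a.2.2 ≠ w) ∧
    (∀ P : V → G → Prop, (∀ a ∈ A ++ R, EdgeRel P a) → ∀ a ∈ L, EdgeRel P a) ∧
    (∀ S : Finset V, (∀ a ∈ L, a.1 ∈ S ∧ a.2.2 ∈ S) → ∀ a ∈ A ++ R, a.1 ∈ S ∧ a.2.2 ∈ S) ∧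
    labelLength x (A ++ R) = labelLength x L ∧ (A ++ R).length = L.length ∧
    labelDegree w A = labelDegree w L := by
  classical
  induction L with
  | nil => exact ⟨[], [], by simp, by simp, by simp, by simp, rfl, rfl, rfl⟩
  | cons a L ih =>
    obtain ⟨A, R, h1, h2, h3, h4, h5, h6, h7⟩ := ih
    have key : ∀ b : V × G × V, b.1 = w → (∀ P : V → G → Prop, EdgeRel P b → EdgeRel P a) →
        (∀ S : Finset V, a.1 ∈ S ∧ a.2.2 ∈ S → b.1 ∈ S ∧ b.2.2 ∈ S) →
        dist (x b.1) (b.2.1 • x b.2.2) = dist (x a.1) (a.2.1 • x a.2.2) →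
        labelDegree w [b] = labelDegree w [a] → ∃ A R : List (V × G × V),
        (∀ a ∈ A, a.1 = w) ∧ (∀ a ∈ R, a.1 ≠ w ∧ a.2.2 ≠ w) ∧
        (∀ P : V → G → Prop, (∀ a ∈ A ++ R, EdgeRel P a) → ∀ b ∈ a :: L, EdgeRel P b) ∧
        (∀ S : Finset V, (∀ b ∈ a :: L, b.1 ∈ S ∧ b.2.2 ∈ S) →
          ∀ a ∈ A ++ R, a.1 ∈ S ∧ a.2.2 ∈ S) ∧
        labelLength x (A ++ R) = labelLength x (a :: L) ∧ (A ++ R).length = (a :: L).length ∧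
        labelDegree w A = labelDegree w (a :: L) := by
      intro b hb hP hS hd hdeg
      refine ⟨b :: A, R, ?_, h2, ?_, ?_, ?_, ?_, ?_⟩
      · simpa [hb] using h1
      · intro P hAR c hc
        rcases List.mem_cons.mp hc with rfl | hc
        · exact hP P (hAR b (by simp))
        · exact h3 P (fun a ha => hAR a (List.mem_cons_of_mem b ha)) c hc
      · intro S hS' c hc
        rcases List.mem_cons.mp hc with rfl | hc
        · exact hS S (hS' a (by simp))
        · exact h4 S (fun b hb => hS' b (List.mem_cons_of_mem a hb)) c hc
      · rw [List.cons_append, labelLength_cons, labelLength_cons, h5, hd]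
      · simp [← h6]
      · simp only [labelDegree, List.map_cons, List.sum_cons, List.map_nil, List.sum_nil,
          add_zero] at hdeg h7 ⊢
        rw [hdeg, h7]
    by_cases ha : a.1 = w
    · exact key a ha (fun _ h => h) (fun _ h => h) rfl rfl
    by_cases ha' : a.2.2 = w
    · refine key (a.2.2, a.2.1⁻¹, a.1) ha' (fun _ h => h.flip) (fun _ h => h.symm) ?_ ?_
      · rw [← dist_smul a.2.1, smul_inv_smul, dist_comm]
      · simp [labelDegree, add_comm]
    · refine ⟨A, a :: R, h1, ?_, ?_, ?_, ?_, ?_, ?_⟩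
      · intro c hc
        rcases List.mem_cons.mp hc with rfl | hc
        · exact ⟨ha, ha'⟩
        · exact h2 c hc
      · intro P hAR c hc
        rcases List.mem_cons.mp hc with rfl | hc
        · exact hAR c (by simp)
        · refine h3 P (fun b hb => hAR b ?_) c hc
          rw [List.mem_append] at hb ⊢
          exact hb.imp_right (List.mem_cons_of_mem a)
      · intro S hS' c hc
        rw [List.mem_append, List.mem_cons, or_left_comm] at hc
        rcases hc with rfl | hc
        · exact hS' c (by simp)
        · exact h4 S (fun b hb => hS' b (List.mem_cons_of_mem a hb)) c (List.mem_append.mpr hc)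
      · rw [labelLength_cons, ← h5, labelLength_append, labelLength_append, labelLength_cons]
        ring
      · simp only [List.length_append, List.length_cons] at h6 ⊢
        omega
      · rw [h7]
        simp [labelDegree, ha, ha']

namespace ThetaGraph

/-- The case of a labelled graph with two vertices. -/
lemma exists_of_pair {x : V → E} {v w : V} (hvw : v ≠ w) {g : G} {L : List (V × G × V)}
    (hL : ∀ a ∈ L, (a.1 = v ∨ a.1 = w) ∧ (a.2.2 = v ∨ a.2.2 = w))
    (hfull : ∀ P : V → G → Prop, EdgeRel P (v, g, w) → (∀ a ∈ L, EdgeRel P a) →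
      ∀ k k', P v k ↔ P v k') (hlen : L.length ≤ 2) :
    ∃ D : ThetaGraph G E, D.Generates ∧ D.length ≤ labelLength x ((v, g, w) :: L) := by
  classical
  -- A change of lifts: replacing x w by its translate under g makes the joining edge trivially
  -- labelled and alters the other labels accordingly, without changing lengths.
  let u : V → G := fun z => if z = w then g else 1
  have huv : u v = 1 := if_neg hvw
  have huw : u w = g := if_pos rfl
  let y : Bool → E := fun i => if i then g • x w else x v
  have hy : ∀ z, z = v ∨ z = w → y (decide (z = w)) = u z • x z := by
    rintro z (rfl | rfl)
    · simp [y, huv, hvw]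
    · simp [y, huw]
  set L' : List (Bool × G × Bool) :=
    L.map fun a => (decide (a.1 = w), u a.1 * a.2.1 * (u a.2.2)⁻¹, decide (a.2.2 = w)) with hL'
  have hcl : ∀ a ∈ L, u a.1 * a.2.1 * (u a.2.2)⁻¹ ∈
      Subgroup.closure {g | ∃ a ∈ L', a.2.1 = g} := fun a ha =>
    Subgroup.subset_closure ⟨(_, u a.1 * a.2.1 * (u a.2.2)⁻¹, _), List.mem_map_of_mem ha, rfl⟩
  have hrel : ∀ a ∈ L,
      EdgeRel (fun z h => h * (u z)⁻¹ ∈ Subgroup.closure {g | ∃ a ∈ L', a.2.1 = g}) a := by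
    intro a ha h
    have e : h * a.2.1 * (u a.2.2)⁻¹ = h * (u a.1)⁻¹ * (u a.1 * a.2.1 * (u a.2.2)⁻¹) := by group
    simp only [e]
    exact (Subgroup.mul_mem_cancel_right _ (hcl a ha)).symm
  obtain ⟨D, hD, hD'⟩ := exists_of_list y L' (by simpa [hL'] using hlen) (by
    rw [eq_top_iff]
    intro k _
    have := (hfull _ (fun h => by simp only [huv, huw, mul_inv_cancel_right, inv_one, mul_one])
      hrel 1 k).mp (by rw [huv, inv_one, mul_one]; exact one_mem _)
    rwa [huv, inv_one, mul_one] at this)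
  refine ⟨D, hD, hD'.trans_eq ?_⟩
  rw [labelLength_cons]
  congr 1
  simp only [hL', labelLength, List.map_map]
  congr 1
  refine List.map_congr_left fun a ha => ?_
  simp only [Function.comp_apply, hy _ (hL a ha).1, hy _ (hL a ha).2]
  rw [smul_smul, inv_mul_cancel_right, mul_smul, dist_smul]

/-- Removing vertices of degree at most two. -/
theorem exists_of_fullOn (x : V → E) (n : ℕ) : ∀ (S : Finset V) (L : List (V × G × V)),
    S.card = n + 1 → (∀ a ∈ L, a.1 ∈ S ∧ a.2.2 ∈ S) → FullOn S L → L.length ≤ S.card + 1 →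
    ∃ D : ThetaGraph G E, D.Generates ∧ D.length ≤ labelLength x L := by
  classical
  induction n with
  | zero =>
    intro S L hS hL hfull hlen
    obtain ⟨v, rfl⟩ := Finset.card_eq_one.mp hS
    exact exists_of_singleton (fun a ha => by simpa using hL a ha) hfull hlen
  | succ n ih =>
    intro S L hS hL hfull hlen
    -- With n + 2 vertices and at most n + 3 edges the degrees sum to at most 2n + 6, which is less
    -- than 3(n + 2) as soon as n > 0.
    obtain ⟨w, hw, hdeg⟩ : ∃ w ∈ S, n = 0 ∨ labelDegree w L ≤ 2 := by
      rcases n.eq_zero_or_pos with rfl | hn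
      · obtain ⟨w, hw⟩ := Finset.card_pos.mp (by omega : 0 < S.card)
        exact ⟨w, hw, Or.inl rfl⟩
      · obtain ⟨w, hw, h⟩ := Finset.exists_lt_of_sum_lt (s := S) (f := fun w => labelDegree w L)
          (g := fun _ => 3) (by rw [sum_labelDegree hL, Finset.sum_const, smul_eq_mul]; omega)
        exact ⟨w, hw, Or.inr (by omega)⟩
    obtain ⟨v, hv, hvw⟩ := Finset.exists_mem_ne (by omega : 1 < S.card) w
    obtain ⟨A, R, hA, hR, hP, hAS, hAlen, hAl, hAdeg⟩ := exists_star x w L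
    have hAS := hAS S hL
    -- If w had only loops, the predicate singling out w would be invariant, against connectedness.
    obtain ⟨a, ha, haw⟩ : ∃ a ∈ A, a.2.2 ≠ w := by
      by_contra! h
      have := hfull (fun z _ => z = w) (hP _ fun a ha k => ?_) w hw v hv 1 1
      · exact hvw (this.mp rfl)
      · rcases List.mem_append.mp ha with ha | ha
        · exact iff_of_true (hA a ha) (h a ha)
        · exact iff_of_false (hR a ha).1 (hR a ha).2
    obtain ⟨A₁, A₂, rfl⟩ := List.append_of_mem ha
    obtain ⟨w', g, u⟩ := a
    have hw' : w = w' := (hA _ ha).symm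
    subst hw'
    simp only at haw
    have hu : u ∈ S := (hAS _ (List.mem_append_left R ha)).2
    have hlenL : labelLength x L = dist (x w) (g • x u) + (labelLength x (A₁ ++ A₂) +
        labelLength x R) := by
      rw [← hAlen, labelLength_append, labelLength_append, labelLength_append, labelLength_cons]
      ring
    have hlL : L.length = 1 + ((A₁ ++ A₂).length + R.length) := by
      rw [← hAl]
      simp only [List.length_append, List.length_cons]
      ring
    have hrel : ∀ P : V → G → Prop, EdgeRel P (w, g, u) → (∀ a ∈ A₁ ++ A₂, EdgeRel P a) →
        (∀ a ∈ R, EdgeRel P a) → ∀ a ∈ L, EdgeRel P a := by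
      intro P h1 h2 h3
      refine hP P fun a ha => ?_
      simp only [List.mem_append, List.mem_cons] at ha h2
      rcases ha with (ha | rfl | ha) | ha
      · exact h2 a (Or.inl ha)
      · exact h1
      · exact h2 a (Or.inr ha)
      · exact h3 a ha
    have hmem : ∀ a ∈ A₁ ++ A₂, a ∈ A₁ ++ (w, g, u) :: A₂ := fun a ha => by
      simp only [List.mem_append, List.mem_cons] at ha ⊢
      tauto
    have hdegA : labelDegree w L = 1 + labelDegree w (A₁ ++ A₂) := by
      rw [← hAdeg]
      simp only [labelDegree, List.map_append, List.sum_append, List.map_cons, List.sum_cons,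
        if_true, if_neg haw]
      ring
    rcases n.eq_zero_or_pos with rfl | hn
    · -- two vertices remain
      have hS2 : S = {w, u} := by
        symm
        apply Finset.eq_of_subset_of_card_le
        · intro z hz
          rcases Finset.mem_insert.mp hz with rfl | hz
          · exact hw
          · rw [Finset.mem_singleton.mp hz]; exact hu
        · rw [hS, Finset.card_pair haw.symm]
      have hmem2 : ∀ a ∈ A₁ ++ A₂ ++ R, (a.1 = w ∨ a.1 = u) ∧ (a.2.2 = w ∨ a.2.2 = u) := by
        intro a ha
        have := hAS a (by
          rw [List.mem_append] at ha ⊢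
          exact ha.imp_left (hmem a))
        simpa [hS2] using this
      obtain ⟨D, hD, hD'⟩ := exists_of_pair (x := x) (g := g) haw.symm hmem2
        (fun P h1 h2 => hfull P (hrel P h1 (fun a ha => h2 a (List.mem_append_left _ ha))
          fun a ha => h2 a (List.mem_append_right _ ha)) w hw w hw) (by
          rw [List.length_append]; omega)
      refine ⟨D, hD, hD'.trans_eq ?_⟩
      rw [labelLength_cons, labelLength_append, hlenL]
    have hdeg := hdeg.resolve_left hn.ne'
    have hcard : (S.erase w).card = n + 1 := by rw [Finset.card_erase_of_mem hw, hS]; rfl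
    have hRS : ∀ a ∈ R, a.1 ∈ S.erase w ∧ a.2.2 ∈ S.erase w := fun a ha => by
      have h1 := hAS a (List.mem_append_right _ ha)
      have h2 := hR a ha
      exact ⟨Finset.mem_erase.mpr ⟨h2.1, h1.1⟩, Finset.mem_erase.mpr ⟨h2.2, h1.2⟩⟩
    match hB : A₁ ++ A₂ with
    | [] =>
      rw [hB] at hlL hlenL hrel
      have hfull' : FullOn (S.erase w) R := by
        intro P hPR
        -- Here w is a leaf. An invariant family on the smaller graph extends over w uniquely
        -- through the deleted edge, so connectedness is inherited.
        let P' : V → G → Prop := fun z h => if z = w then P u (h * g) else P z h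
        have hP' : ∀ z, z ≠ w → P' z = P z := fun z hz => by
          funext h; simp [P', hz]
        have := hfull P' (hrel P' (fun h => by simp [P', haw]) (by simp) fun a ha h => by
          rw [hP' _ (hR a ha).1, hP' _ (hR a ha).2]
          exact hPR a ha h)
        intro y hy z hz h h'
        have := this y (Finset.mem_of_mem_erase hy) z (Finset.mem_of_mem_erase hz) h h'
        rwa [hP' _ (Finset.ne_of_mem_erase hy), hP' _ (Finset.ne_of_mem_erase hz)] at this
      obtain ⟨D, hD, hD'⟩ := ih (S.erase w) R hcard hRS hfull' (by
        simp only [List.length_nil] at hlL; omega)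
      refine ⟨D, hD, hD'.trans ?_⟩
      rw [hlenL]
      have := dist_nonneg (x := x w) (y := g • x u)
      simp only [labelLength, List.map_nil, List.sum_nil, zero_add]
      linarith
    | [b] =>
      rw [hB] at hlL hlenL hrel hdegA
      have hb : b ∈ A₁ ++ A₂ := by rw [hB]; simp
      have hbw : b.1 = w := hA _ (hmem b hb)
      have hb2 : b.2.2 ≠ w := fun h => by
        have : labelDegree w [b] = 2 := by simp [labelDegree, hbw, h]
        omega
      have hbS := (hAS b (List.mem_append_left _ (hmem b hb))).2
      -- Here w has degree two: its two edges are merged into one carrying the composite label, and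
      -- the triangle inequality shows that the length does not increase.
      have hmem' : ∀ a ∈ (u, g⁻¹ * b.2.1, b.2.2) :: R, a.1 ∈ S.erase w ∧ a.2.2 ∈ S.erase w := by
        intro a ha
        rcases List.mem_cons.mp ha with rfl | ha
        · exact ⟨Finset.mem_erase.mpr ⟨haw, hu⟩, Finset.mem_erase.mpr ⟨hb2, hbS⟩⟩
        · exact hRS a ha
      have hfull' : FullOn (S.erase w) ((u, g⁻¹ * b.2.1, b.2.2) :: R) := by
        intro P hPR
        let P' : V → G → Prop := fun z h => if z = w then P u (h * g) else P z h
        have hP' : ∀ z, z ≠ w → P' z = P z := fun z hz => by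
          funext h; simp [P', hz]
        have hPb := hPR _ List.mem_cons_self
        have hb' : EdgeRel P' b := fun h => by
          rw [hbw, hP' _ hb2]
          have := hPb (h * g)
          simp only [mul_assoc, mul_inv_cancel_left] at this
          simpa [P'] using this
        have := hfull P' (hrel P' (fun h => by simp [P', haw]) (by simpa using hb')
          fun a ha h => by
            rw [hP' _ (hR a ha).1, hP' _ (hR a ha).2]
            exact hPR a (List.mem_cons_of_mem _ ha) h)
        intro y hy z hz h h'
        have := this y (Finset.mem_of_mem_erase hy) z (Finset.mem_of_mem_erase hz) h h'
        rwa [hP' _ (Finset.ne_of_mem_erase hy), hP' _ (Finset.ne_of_mem_erase hz)] at this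
      obtain ⟨D, hD, hD'⟩ := ih (S.erase w) ((u, g⁻¹ * b.2.1, b.2.2) :: R) hcard hmem' hfull' (by
        simp only [List.length_cons, List.length_nil] at hlL ⊢; omega)
      refine ⟨D, hD, hD'.trans ?_⟩
      rw [hlenL, labelLength_cons, labelLength_cons, hbw]
      simp only [labelLength, List.map_nil, List.sum_nil]
      have h1 : dist (x u) ((g⁻¹ * b.2.1) • x b.2.2) = dist (g • x u) (b.2.1 • x b.2.2) := by
        rw [← dist_smul g, ← mul_smul, mul_inv_cancel_left]
      have h2 := dist_triangle_left (g • x u) (b.2.1 • x b.2.2) (x w)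
      rw [h1]
      linarith
    | b :: c :: T =>
      exfalso
      have hb : b ∈ A₁ ++ A₂ := by rw [hB]; simp
      have hc : c ∈ A₁ ++ A₂ := by rw [hB]; simp
      rw [hB] at hdegA
      simp [labelDegree, hA _ (hmem b hb), hA _ (hmem c hc)] at hdegA hdeg
      omega

end ThetaGraph

end Labelled

end Carrier

namespace Carrier

/-! ### A shortest labelled graph for the figure-8 knot complement -/

lemma toIsometryGroup_congr {g h : SL(2, Eisenstein)} (hg : g ∈ eisensteinGroup)
    (hh : h ∈ eisensteinGroup) (e : g = h) : toIsometryGroup g hg = toIsometryGroup h hh := by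
  subst e
  rfl

/-- Two elements which generate a conjugate of the figure-8 group are not both upper
triangular. -/
lemma lower_ne_zero_of_closure {a b : SL(2, Eisenstein)} (ha : a ∈ eisensteinGroup)
    (hb : b ∈ eisensteinGroup)
    (h : Subgroup.closure {toIsometryGroup a ha, toIsometryGroup b hb} = ⊤)
    (k : SL(2, Eisenstein)) : (k * a * k⁻¹) 1 0 ≠ 0 ∨ (k * b * k⁻¹) 1 0 ≠ 0 := by
  by_contra! h0
  obtain ⟨g, hg, hgk⟩ := exists_conj_lower_ne_zero k
  have key : ∀ s ∈ Subgroup.closure {toIsometryGroup a ha, toIsometryGroup b hb},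
      ∃ m, ∃ hm : m ∈ eisensteinGroup, s = toIsometryGroup m hm ∧ (k * m * k⁻¹) 1 0 = 0 := by
    intro s hs
    induction hs using Subgroup.closure_induction with
    | mem s hs =>
      rcases hs with rfl | rfl
      · exact ⟨a, ha, rfl, h0.1⟩
      · exact ⟨b, hb, rfl, h0.2⟩
    | one => exact ⟨1, one_mem _, Subtype.ext (map_one toIsometry).symm, by simp⟩
    | mul s t _ _ hs ht =>
      obtain ⟨m, hm, rfl, hm0⟩ := hs
      obtain ⟨n, hn, rfl, hn0⟩ := ht
      refine ⟨m * n, mul_mem hm hn, Subtype.ext (map_mul toIsometry m n).symm, ?_⟩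
      have : k * (m * n) * k⁻¹ = (k * m * k⁻¹) * (k * n * k⁻¹) := by group
      rw [this, SL_mul_apply, hm0, hn0]
      simp
    | inv s _ hs =>
      obtain ⟨m, hm, rfl, hm0⟩ := hs
      refine ⟨m⁻¹, inv_mem hm, Subtype.ext (map_inv toIsometry m).symm, ?_⟩
      have : k * m⁻¹ * k⁻¹ = (k * m * k⁻¹)⁻¹ := by group
      rw [this, (SL_inv_apply _).2.2.1, hm0, neg_zero]
  obtain ⟨m, hm, hgm, hm0⟩ := key (toIsometryGroup g hg) (by rw [h]; trivial)
  -- Equality as isometries determines the matrix only up to sign, which does not affect the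
  -- vanishing of an entry.
  have hfix : (m⁻¹ * g) • H3.j = H3.j := by
    rw [mul_smul, inv_smul_eq_iff, ← toIsometryGroup_smul g hg, ← toIsometryGroup_smul m hm, hgm]
  rcases eq_one_or_neg_one_of_smul_eq (mul_mem (inv_mem hm) hg) hfix with h1 | h1
  · rw [inv_mul_eq_one] at h1
    exact hgk (h1 ▸ hm0)
  · have h2 : g = m * -1 := by rw [← h1, mul_inv_cancel_left]
    have h3 : k * g * k⁻¹ = -(k * m * k⁻¹) := by rw [h2]; simp
    exact hgk (by rw [h3, Matrix.SpecialLinearGroup.coe_neg, Matrix.neg_apply, hm0, neg_zero])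

/-- The length of a labelled graph with labels in `SL(2, ℤ[ω])`. -/
noncomputable def edgeSum (a b : SL(2, Eisenstein)) (i j : Bool × Bool) (y : Bool → H3) : ℝ :=
  dist (y false) (y true) + dist (y i.1) (a • y i.2) + dist (y j.1) (b • y j.2)

lemma continuous_edgeSum (a b : SL(2, Eisenstein)) (i j : Bool × Bool) :
    Continuous (edgeSum a b i j) := by
  have h : ∀ (g : SL(2, Eisenstein)) (l : Bool), Continuous fun y : Bool → H3 => g • y l :=
    fun g l => (isometry_smul H3 g).continuous.comp (continuous_apply l)
  unfold edgeSum
  exact (((continuous_apply _).dist (continuous_apply _)).add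
    ((continuous_apply _).dist (h _ _))).add ((continuous_apply _).dist (h _ _))

lemma edgeSum_conj (k a b : SL(2, Eisenstein)) (i j : Bool × Bool) (y : Bool → H3) :
    edgeSum (k * a * k⁻¹) (k * b * k⁻¹) i j (fun l => k • y l) = edgeSum a b i j y := by
  have h : ∀ (g : SL(2, Eisenstein)) (x y : H3), dist (k • x) ((k * g * k⁻¹) • k • y) =
      dist x (g • y) := fun g x y => by
    rw [smul_smul, inv_mul_cancel_right, mul_smul, dist_smul]
  simp only [edgeSum, h, dist_smul]

lemma dist_false_le {y : Bool → H3} {R : ℝ} (h : dist (y false) (y true) ≤ R) (l : Bool) :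
    dist (y false) (y l) ≤ R := by
  cases l
  · rw [dist_self]
    exact dist_nonneg.trans h
  · exact h

/-- The factor 3 allows a detour of length at most R to each endpoint of the edge, besides the edge
itself. -/
lemma dist_smul_le_of_edgeSum_le {a b : SL(2, Eisenstein)} {i j : Bool × Bool} {y : Bool → H3}
    {R : ℝ} (h : edgeSum a b i j y ≤ R) :
    dist (y false) (y true) ≤ R ∧ dist (y false) (a • y false) ≤ 3 * R ∧
      dist (y false) (b • y false) ≤ 3 * R := by
  have h0 := dist_nonneg (x := y false) (y := y true)
  have h1 := dist_nonneg (x := y i.1) (y := a • y i.2)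
  have h2 := dist_nonneg (x := y j.1) (y := b • y j.2)
  unfold edgeSum at h
  have key : ∀ (g : SL(2, Eisenstein)) (l m : Bool), dist (y l) (g • y m) ≤ R →
      dist (y false) (g • y false) ≤ 3 * R := by
    intro g l m hg
    have h3 := dist_triangle4 (y false) (y l) (g • y m) (g • y false)
    rw [dist_smul, dist_comm (y m)] at h3
    have h4 := dist_false_le (y := y) (R := R) (by linarith) l
    have h5 := dist_false_le (y := y) (R := R) (by linarith) m
    linarith
  exact ⟨by linarith, key a _ _ (by linarith), key b _ _ (by linarith)⟩

/-- The labels generate a conjugate of the figure-8 group. -/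
def GeneratesConjugate (a b : SL(2, Eisenstein)) : Prop :=
  ∃ k : SL(2, Eisenstein), ∃ (ha : k⁻¹ * a * k ∈ eisensteinGroup)
    (hb : k⁻¹ * b * k ∈ eisensteinGroup),
    Subgroup.closure {toIsometryGroup _ ha, toIsometryGroup _ hb} = ⊤

/-- Every labelled graph can be moved so that a vertex lies in a compact set. -/
lemma ThetaGraph.exists_conj {D : ThetaGraph isometryGroup H3} (hD : D.Generates) {R : ℝ}
    (hR : D.length ≤ R) : ∃ (a b : SL(2, Eisenstein)) (y : Bool → H3), GeneratesConjugate a b ∧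
      edgeSum a b D.i D.j y = D.length ∧ ‖(y false).z‖ ≤ 1 ∧ 1 / 2 ≤ (y false).t ∧
      (y false).t ≤ Real.exp (3 * R) := by
  obtain ⟨a, ha, hDa⟩ := exists_eq_toIsometryGroup D.a
  obtain ⟨b, hb, hDb⟩ := exists_eq_toIsometryGroup D.b
  obtain ⟨k, hk1, hk2⟩ := exists_smul_mem_fundamental (D.x false)
  have hlen : edgeSum (k * a * k⁻¹) (k * b * k⁻¹) D.i D.j (fun l => k • D.x l) = D.length := by
    rw [edgeSum_conj, ThetaGraph.length, hDa, hDb]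
    rfl
  unfold ThetaGraph.Generates at hD
  rw [hDa, hDb] at hD
  have e : ∀ g : SL(2, Eisenstein), k⁻¹ * (k * g * k⁻¹) * k = g := fun g => by group
  refine ⟨k * a * k⁻¹, k * b * k⁻¹, fun l => k • D.x l,
    ⟨k, by rwa [e], by rwa [e], ?_⟩, hlen, hk1, hk2, ?_⟩
  · rw [toIsometryGroup_congr _ ha (e a), toIsometryGroup_congr _ hb (e b), hD]
  · obtain ⟨-, h1, h2⟩ := dist_smul_le_of_edgeSum_le (hlen.trans_le hR)
    -- One of the labels does not fix the cusp, yet it moves the vertex by at most 3R, which bounds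
    -- the height.
    rcases lower_ne_zero_of_closure ha hb hD k with h | h
    · exact t_le_of_dist_smul_le h h1
    · exact t_le_of_dist_smul_le h h2

lemma exists_dist_j_le (T : ℝ) : ∃ ρ : ℝ, 0 ≤ ρ ∧ ∀ x : H3, ‖x.z‖ ≤ 1 → 1 / 2 ≤ x.t → x.t ≤ T →
    dist x H3.j ≤ ρ := by
  refine ⟨Real.arcosh (1 + (1 + (T + 1) ^ 2)), Real.arcosh_nonneg (by nlinarith [sq_nonneg (T + 1)]),
    fun x hz ht hT => ?_⟩
  rw [H3.dist_def]
  have h1 := H3.one_le_coshDist x H3.j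
  rw [Real.arcosh_le_arcosh (by linarith) (by nlinarith [sq_nonneg (T + 1)])]
  unfold H3.coshDist H3.j
  simp only [sub_zero, mul_one]
  have h2 : ‖x.z‖ ^ 2 ≤ 1 := by nlinarith [norm_nonneg x.z]
  have h3 : (x.t - 1) ^ 2 ≤ (T + 1) ^ 2 := by nlinarith
  have h4 : (‖x.z‖ ^ 2 + (x.t - 1) ^ 2) / (2 * x.t) ≤ ‖x.z‖ ^ 2 + (x.t - 1) ^ 2 :=
    div_le_self (by positivity) (by linarith)
  linarith

/-- There is a shortest labelled graph whose labels generate the figure-8 group. -/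
theorem exists_shortest_thetaGraph : ∃ D : ThetaGraph isometryGroup H3, D.Generates ∧
    ∀ D' : ThetaGraph isometryGroup H3, D'.Generates → D.length ≤ D'.length := by
  let D₀ : ThetaGraph isometryGroup H3 := ⟨toIsometryGroup genA genA_mem,
    toIsometryGroup genB genB_mem, fun _ => H3.j, (false, false), (false, false)⟩
  have hD₀ : D₀.Generates := closure_isometryGroup
  set R := D₀.length with hR
  obtain ⟨ρ, hρ0, hρ⟩ := exists_dist_j_le (Real.exp (3 * R))
  -- The normalized vertex is within ρ of `j` and is moved by at most 3R, so every relevant label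
  -- lies in this finite set. The other vertex is at most R away, whence the radius of K.
  let F : Set SL(2, Eisenstein) := {g | dist H3.j (g • H3.j) ≤ 2 * ρ + 3 * R}
  have hF : F.Finite := finite_dist_smul_le _ _ _
  have hR0 : 0 ≤ R := by rw [hR, ThetaGraph.length]; positivity
  let K : Set (Bool → H3) := Set.pi Set.univ fun _ => Metric.closedBall H3.j (ρ + R)
  have hK : IsCompact K := isCompact_univ_pi fun _ => isCompact_closedBall _ _
  have hKne : K.Nonempty := ⟨fun _ => H3.j, fun _ _ => Metric.mem_closedBall_self (by linarith)⟩
  let τ := (SL(2, Eisenstein) × SL(2, Eisenstein)) × (Bool × Bool) × (Bool × Bool)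
  let S : Set τ := {s | (s.1.1 ∈ F ∧ s.1.2 ∈ F) ∧ GeneratesConjugate s.1.1 s.1.2}
  have hS : S.Finite := ((hF.prod hF).prod Set.finite_univ).subset
    fun s hs => ⟨⟨hs.1.1, hs.1.2⟩, trivial⟩
  -- For each combinatorial type the positions are optimized over K first; afterwards the best of
  -- the finitely many types is chosen.
  choose y hyK hy using fun s : τ => hK.exists_isMinOn hKne
    (continuous_edgeSum s.1.1 s.1.2 s.2.1 s.2.2).continuousOn
  -- short labelled graphs are represented in the compact family
  have key : ∀ D : ThetaGraph isometryGroup H3, D.Generates → D.length ≤ R → ∃ s ∈ S,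
      edgeSum s.1.1 s.1.2 s.2.1 s.2.2 (y s) ≤ D.length := by
    intro D hD hDR
    obtain ⟨a, b, x, hab, hlen, h1, h2, h3⟩ := ThetaGraph.exists_conj hD hDR
    obtain ⟨h4, h5, h6⟩ := dist_smul_le_of_edgeSum_le (hlen.trans_le hDR)
    have h7 := hρ _ h1 h2 h3
    have hmem : ∀ g : SL(2, Eisenstein), dist (x false) (g • x false) ≤ 3 * R → g ∈ F := by
      intro g hg
      have := dist_triangle4 H3.j (x false) (g • x false) (g • H3.j)
      rw [dist_smul, dist_comm H3.j (x false)] at this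
      change dist _ _ ≤ _
      linarith
    refine ⟨⟨⟨a, b⟩, D.i, D.j⟩, ⟨⟨hmem a h5, hmem b h6⟩, hab⟩, ?_⟩
    rw [← hlen]
    refine hy ⟨⟨a, b⟩, D.i, D.j⟩ fun l _ => ?_
    have h8 := dist_false_le h4 l
    have h9 := dist_triangle (x l) (x false) H3.j
    rw [Metric.mem_closedBall]
    rw [dist_comm (x l) (x false)] at h9
    linarith
  obtain ⟨s₀, hs₀, -⟩ := key D₀ hD₀ le_rfl
  obtain ⟨⟨⟨a, b⟩, i, j⟩, ⟨-, k, ha, hb, hab⟩, hmin⟩ := Set.exists_min_image S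
    (fun s => edgeSum s.1.1 s.1.2 s.2.1 s.2.2 (y s)) hS ⟨s₀, hs₀⟩
  set z := y ⟨⟨a, b⟩, i, j⟩ with hz
  refine ⟨⟨toIsometryGroup _ ha, toIsometryGroup _ hb, fun l => k⁻¹ • z l, i, j⟩, hab,
    fun D' hD' => ?_⟩
  have hlen : ThetaGraph.length (⟨toIsometryGroup _ ha, toIsometryGroup _ hb,
      fun l => k⁻¹ • z l, i, j⟩ : ThetaGraph isometryGroup H3) = edgeSum a b i j z := by
    rw [← edgeSum_conj k⁻¹, inv_inv]
    rfl
  rw [hlen]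
  rcases le_total D'.length R with h | h
  · obtain ⟨s, hs, hs'⟩ := key D' hD' h
    exact (hmin s hs).trans hs'
  · obtain ⟨s, hs, hs'⟩ := key D₀ hD₀ le_rfl
    exact (hmin s hs).trans (hs'.trans h)

end Carrier

namespace Carrier

open OrbitSpace

/-! ### Carrier graphs of rank two and theta graphs -/

/-- A carrier graph of rank two in a quotient space is at least as long as some generating theta
graph. -/
theorem IsCarrierGraph.exists_thetaGraph {G E : Type*} [Group G] [MetricSpace E] [MulAction G E]
    [FreeIsometricAction G E] [PathConnectedSpace E]
    (hM : ∀ x : OrbitSpace G E, HasRank (FundamentalGroup (OrbitSpace G E) x) 2)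
    {X : Type} [TopologicalSpace X] {Γ : FiniteGraph X} {f : C(X, OrbitSpace G E)}
    (hf : IsCarrierGraph Γ f) :
    ∃ D : ThetaGraph G E, D.Generates ∧ ENNReal.ofReal D.length ≤ graphLength Γ f := by
  classical
  have := hf.connected
  obtain ⟨v⟩ := Γ.nonempty_V
  have hX : HasRank (FundamentalGroup X v) 2 := by
    obtain ⟨n, h1, h2⟩ := hf.rank_eq v
    rwa [h2.eq (hM _)] at h1
  obtain ⟨_, hX⟩ := hX
  obtain ⟨S, hS, hcl⟩ := Group.rank_spec (FundamentalGroup X (v : X))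
  -- Rank two means at most V + 1 edges, exactly the bound under which vertices can be eliminated.
  have hcard := Γ.card_edge_le hcl
  obtain ⟨x, γ, hfull, hlen⟩ := exists_labels Γ f hf.surjective
  obtain ⟨D, hD, hDl⟩ := ThetaGraph.exists_of_fullOn x (Fintype.card Γ.V - 1) Finset.univ _
    (by rw [Finset.card_univ]; have := Fintype.card_pos_iff.mpr ⟨v⟩; omega) (by simp) hfull (by
      rw [List.length_map, Finset.length_toList, Finset.card_univ, Finset.card_univ]
      omega)
  refine ⟨D, hD, (ENNReal.ofReal_le_ofReal hDl).trans ?_⟩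
  rw [labelLength, List.map_map, Finset.sum_map_toList,
    ENNReal.ofReal_sum_of_nonneg (by intros; exact dist_nonneg)]
  refine Finset.sum_le_sum fun e _ => ?_
  rw [Function.comp_apply, ← edist_dist]
  exact hlen e

end Carrier

namespace Carrier

open unitInterval OrbitSpace

/-! ### The topological realization of a finite graph -/

lemma FiniteGraph.pathConnectedSpace_of_joined {X : Type} [TopologicalSpace X] (Γ : FiniteGraph X) {v₀ : X}
    (h : ∀ v ∈ Γ.V, Joined v₀ v) : PathConnectedSpace X := by
  have key : ∀ x, Joined v₀ x := by
    intro x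
    rcases Γ.covers x with hx | ⟨e, s, -, rfl⟩
    · exact h x hx
    · exact (h _ (Γ.edge_zero_mem e)).trans
        ⟨(PathConnectedSpace.somePath (0 : I) s).map (Γ.edge e).continuous⟩
  exact ⟨⟨v₀⟩, fun x y => (key x).symm.trans (key y)⟩

section Realization

variable {V E : Type} [DecidableEq V] [DecidableEq E] (s t : E → V)

/-- The point of the realization belonging to a vertex. -/
def vertexPoint (v : V) : (V → ℝ) × (E → ℝ) × (E → ℝ) := (Pi.single v 1, 0, 0)

/-- The point of the realization with parameter `r` on the edge `e`. -/
def edgePoint (e : E) (r : ℝ) : (V → ℝ) × (E → ℝ) × (E → ℝ) :=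
  (Pi.single (s e) (1 - r) + Pi.single (t e) r, Pi.single e (r * (1 - r)),
    Pi.single e (r ^ 2 * (1 - r)))

/-- A realization of the graph with edges `e` from `s e` to `t e` in a euclidean space. -/
def Realization : Type :=
  {p : (V → ℝ) × (E → ℝ) × (E → ℝ) //
    (∃ v, vertexPoint v = p) ∨ ∃ (e : E) (r : I), edgePoint s t e r = p}

namespace Realization

instance : TopologicalSpace (Realization s t) := inferInstanceAs (TopologicalSpace (Subtype _))

/-- The vertices of the realization. -/
def vertex (v : V) : Realization s t := ⟨vertexPoint v, Or.inl ⟨v, rfl⟩⟩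

lemma vertex_injective : Function.Injective (vertex s t) := by
  intro v w h
  have h1 := congrFun (congrArg (fun p : Realization s t => p.1.1) h) v
  by_contra hne
  simp [vertex, vertexPoint, hne] at h1

/-- The edges of the realization. -/
def edge (e : E) : C(I, Realization s t) where
  toFun r := ⟨edgePoint s t e r, Or.inr ⟨e, r, rfl⟩⟩
  continuous_toFun := by
    refine Continuous.subtype_mk ?_ _
    unfold edgePoint
    refine Continuous.prodMk (Continuous.add ?_ ?_) (Continuous.prodMk ?_ ?_)
    · exact (continuous_single (s e)).comp (by fun_prop)
    · exact (continuous_single (t e)).comp (by fun_prop)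
    · exact (continuous_single e).comp (by fun_prop)
    · exact (continuous_single e).comp (by fun_prop)

lemma coe_edge (e : E) (r : I) : (edge s t e r).1 = edgePoint s t e r := rfl

lemma edge_zero (e : E) : edge s t e 0 = vertex s t (s e) := by
  apply Subtype.ext
  simp [coe_edge, vertex, edgePoint, vertexPoint]

lemma edge_one (e : E) : edge s t e 1 = vertex s t (t e) := by
  apply Subtype.ext
  simp [coe_edge, vertex, edgePoint, vertexPoint]

lemma mul_pos_of_mem {r : I} (hr : r ∈ Set.Ioo (0 : I) 1) : 0 < (r : ℝ) * (1 - r) := by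
  have h0 : (0 : ℝ) < r := hr.1
  have h1 : (r : ℝ) < 1 := hr.2
  exact mul_pos h0 (by linarith)

variable [Fintype V] [Fintype E]

/-- The graph structure of the realization. -/
def graph : FiniteGraph (Realization s t) where
  t2 := inferInstanceAs (T2Space (Subtype _))
  V := Set.range (vertex s t)
  finite_V := Set.finite_range _
  E := E
  fintype_E := inferInstance
  edge := edge s t
  edge_zero_mem e := ⟨s e, (edge_zero s t e).symm⟩
  edge_one_mem e := ⟨t e, (edge_one s t e).symm⟩
  edge_notMem := by
    rintro e r hr ⟨v, hv⟩
    have h1 := congrFun (congrArg (fun p : Realization s t => p.1.2.1) hv) e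
    simp only [vertex, vertexPoint, coe_edge, edgePoint, Pi.single_eq_same,
      Pi.zero_apply] at h1
    exact (mul_pos_of_mem hr).ne h1
  edge_inj := by
    intro e e' r hr r' hr' h
    have h1 := congrFun (congrArg (fun p : Realization s t => p.1.2.1) h) e
    have h2 := congrFun (congrArg (fun p : Realization s t => p.1.2.2) h) e
    have hr0 := mul_pos_of_mem hr
    simp only [coe_edge, edgePoint, Pi.single_eq_same] at h1 h2
    by_cases he : e = e'
    · subst he
      simp only [Pi.single_eq_same] at h1 h2
      refine ⟨rfl, Subtype.ext ?_⟩
      -- The quotient of the last two coordinates, r²(1-r) by r(1-r), recovers r even when the edge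
      -- is a loop.
      refine mul_right_cancel₀ hr0.ne' ?_
      linear_combination h2 - (r' : ℝ) * h1
    · rw [Pi.single_eq_of_ne he] at h1
      exact absurd h1 hr0.ne'
  covers := by
    rintro ⟨p, ⟨v, rfl⟩ | ⟨e, r, rfl⟩⟩
    · exact Or.inl ⟨v, rfl⟩
    · by_cases h0 : r = 0
      · subst h0
        exact Or.inl ⟨s e, (edge_zero s t e).symm⟩
      by_cases h1 : r = 1
      · subst h1
        exact Or.inl ⟨t e, (edge_one s t e).symm⟩
      · exact Or.inr ⟨e, r, ⟨unitInterval.pos_iff_ne_zero.mpr h0,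
          unitInterval.lt_one_iff_ne_one.mpr h1⟩, rfl⟩

lemma card_V : Fintype.card (graph s t).V = Fintype.card V :=
  Fintype.card_congr (Equiv.ofInjective _ (vertex_injective s t)).symm

variable {G A : Type*} [Group G] [MetricSpace A] [MulAction G A] [FreeIsometricAction G A]
  (x : V → A) (γ : E → G) (p : ∀ e, Path (x (s e)) (γ e • x (t e)))

/-- The map of the realization determined by a labelling of the edges and by paths. -/
lemma exists_map : ∃ F : C(Realization s t, OrbitSpace G A),
    (∀ v, F (vertex s t v) = proj G (x v)) ∧ ∀ e r, F (edge s t e r) = proj G (p e r) := by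
  by_cases hV : Nonempty V
  · have h0 : ∀ e : E, proj G (p e 0) =
        proj G (x (Function.invFun (vertex s t) (edge s t e 0))) := fun e => by
      rw [edge_zero, Function.leftInverse_invFun (vertex_injective s t), (p e).source]
    have h1 : ∀ e : E, proj G (p e 1) =
        proj G (x (Function.invFun (vertex s t) (edge s t e 1))) := fun e => by
      rw [edge_one, Function.leftInverse_invFun (vertex_injective s t), (p e).target, proj_smul]
    obtain ⟨F, hF1, hF2⟩ := (graph s t).exists_glue
      (fun z => proj G (x (Function.invFun (vertex s t) z)))
      (fun e => (⟨proj G, continuous_proj⟩ : C(A, OrbitSpace G A)).comp (p e).toContinuousMap)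
      h0
      h1
    refine ⟨F, fun v => ?_, hF2⟩
    rw [hF1 _ ⟨v, rfl⟩, Function.leftInverse_invFun (vertex_injective s t)]
  · have : IsEmpty (Realization s t) := ⟨fun z => by
      obtain ⟨p, ⟨v, rfl⟩ | ⟨e, r, rfl⟩⟩ := z
      exacts [hV ⟨v⟩, hV ⟨s e⟩]⟩
    exact ⟨⟨isEmptyElim, continuous_of_const fun z => isEmptyElim z⟩,
      fun v => (hV ⟨v⟩).elim, fun e => (hV ⟨s e⟩).elim⟩

end Realization

end Realization

end Carrier

namespace Carrier

open unitInterval OrbitSpace CategoryTheory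

/-! ### The carrier graph of a theta graph -/

/-- Surjectivity on fundamental groups does not depend on the base point. -/
lemma surjective_map_of_pathConnected {X Y : Type*} [TopologicalSpace X] [TopologicalSpace Y]
    [PathConnectedSpace X] (f : C(X, Y)) {x₀ : X}
    (h : Function.Surjective (FundamentalGroup.map f x₀)) (x : X) :
    Function.Surjective (FundamentalGroup.map f x) := by
  intro c
  let u : FundamentalGroupoid.mk x₀ ⟶ FundamentalGroupoid.mk x :=
    Path.Homotopic.Quotient.mk (PathConnectedSpace.somePath x₀ x)
  let u' := (FundamentalGroupoid.map f).map u
  let c' : (FundamentalGroupoid.map f).obj ⟨x⟩ ⟶ (FundamentalGroupoid.map f).obj ⟨x⟩ := c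
  obtain ⟨d, hd⟩ := h (u' ≫ c' ≫ Groupoid.inv u')
  let d' : FundamentalGroupoid.mk x₀ ⟶ FundamentalGroupoid.mk x₀ := d
  have hd' : (FundamentalGroupoid.map f).map d' = u' ≫ c' ≫ Groupoid.inv u' := hd
  refine ⟨Groupoid.inv u ≫ d' ≫ u, ?_⟩
  change (FundamentalGroupoid.map f).map (Groupoid.inv u ≫ d' ≫ u) = c'
  have hu : (FundamentalGroupoid.map f).map (Groupoid.inv u) = Groupoid.inv u' := by
    rw [Groupoid.inv_eq_inv, Groupoid.inv_eq_inv, Functor.map_inv]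
  rw [Functor.map_comp, Functor.map_comp, hd', hu]
  change Groupoid.inv u' ≫ (u' ≫ c' ≫ Groupoid.inv u') ≫ u' = c'
  rw [Category.assoc, Category.assoc, Groupoid.inv_comp, Category.comp_id, ← Category.assoc,
    Groupoid.inv_comp, Category.id_comp]

section

variable {G A : Type*} [Group G]

/-- The trivially labelled edge identifies the predicates at the two vertices; the elements whose
right translation preserves the common predicate then include the labels, hence the subgroup they
generate. -/
lemma ThetaGraph.Generates.fullOn {D : ThetaGraph G A} (hD : D.Generates)
    {P : Bool → G → Prop} (h0 : EdgeRel P (false, 1, true))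
    (h1 : EdgeRel P (D.i.1, D.a, D.i.2)) (h2 : EdgeRel P (D.j.1, D.b, D.j.2))
    (v : Bool) (g g' : G) (h : P v g) : P v g' := by
  have hP : ∀ v g, P v g ↔ P false g := by
    rintro (_ | _) g
    · rfl
    · simpa using (h0 g).symm
  have key : ∀ k ∈ Subgroup.closure {D.a, D.b}, ∀ g, P false g ↔ P false (g * k) := by
    intro k hk
    induction hk using Subgroup.closure_induction with
    | mem k hk =>
      intro g
      rcases hk with rfl | rfl
      · rw [← hP D.i.1, h1 g, hP]
      · rw [← hP D.j.1, h2 g, hP]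
    | one => simp
    | mul k l _ _ hk hl => intro g; rw [hk, hl, mul_assoc]
    | inv k _ hk => intro g; rw [hk (g * k⁻¹), inv_mul_cancel_right]
  have hmem : g⁻¹ * g' ∈ Subgroup.closure {D.a, D.b} := by rw [hD]; trivial
  rw [hP] at h ⊢
  simpa using (key _ hmem g).mp h

variable [MetricSpace A] [MulAction G A] [FreeIsometricAction G A]
  {X : Type*} [TopologicalSpace X]

/-- A path in `A` and a path in `X` have the same image in the orbit space. -/
def Covers (F : C(X, OrbitSpace G A)) (a b : A) (z w : X) : Prop :=
  ∃ (l : Path a b) (q : Path z w), ∀ r, proj G (l r) = F (q r)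

variable {F : C(X, OrbitSpace G A)}

lemma Covers.refl {a : A} {z : X} (h : proj G a = F z) : Covers F a a z z :=
  ⟨Path.refl a, Path.refl z, fun _ => h⟩

lemma Covers.symm {a b : A} {z w : X} (h : Covers F a b z w) : Covers F b a w z := by
  obtain ⟨l, q, h⟩ := h
  exact ⟨l.symm, q.symm, fun r => h (σ r)⟩

lemma Covers.trans {a b c : A} {z w y : X} (h : Covers F a b z w) (h' : Covers F b c w y) :
    Covers F a c z y := by
  obtain ⟨l, q, h⟩ := h
  obtain ⟨l', q', h'⟩ := h'
  refine ⟨l.trans l', q.trans q', fun r => ?_⟩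
  rw [Path.trans_apply, Path.trans_apply]
  split_ifs
  exacts [h _, h' _]

lemma Covers.smul {a b : A} {z w : X} (h : Covers F a b z w) (g : G) :
    Covers F (g • a) (g • b) z w := by
  obtain ⟨l, q, h⟩ := h
  exact ⟨l.map (isometry_smul A g).continuous, q, fun r => (proj_smul g (l r)).trans (h r)⟩

/-- If all translates of a point can be reached, then the map is surjective on fundamental
groups. -/
lemma surjective_of_covers [SimplyConnectedSpace A] {a : A} {z : X} (hz : proj G a = F z)
    (h : ∀ g : G, Covers F a (g • a) z z) : Function.Surjective (FundamentalGroup.map F z) := by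
  intro c
  induction c using Path.Homotopic.Quotient.ind with | mk p =>
  obtain ⟨m, hm, hm0⟩ := exists_lift_proj p hz
  obtain ⟨g, hg⟩ : ∃ g : G, m 1 = g • a := by
    rw [← proj_eq_iff, hm, p.target, hz]
  obtain ⟨l, q, hl⟩ := h g
  refine ⟨Path.Homotopic.Quotient.mk q, Path.Homotopic.Quotient.eq.mpr ?_⟩
  let m' : Path a (g • a) := ⟨m, hm0, hg⟩
  have e1 : q.map F.continuous = (l.map (continuous_proj (G := G))).cast hz.symm
      (by rw [proj_smul, hz]) := by
    ext r
    exact (hl r).symm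
  have e2 : p = (m'.map (continuous_proj (G := G))).cast hz.symm (by rw [proj_smul, hz]) := by
    ext r
    exact (hm r).symm
  -- The lift of the given loop and the lift of the loop coming from X have the same endpoints in a
  -- simply connected space.
  have h3 := (SimplyConnectedSpace.paths_homotopic l m').map
    (⟨proj G, continuous_proj⟩ : C(A, OrbitSpace G A))
  obtain ⟨H⟩ := h3
  change (q.map F.continuous).Homotopic p
  rw [e1, e2]
  exact ⟨H⟩

/-- A generating theta graph in a simply connected space is realized by a carrier graph of at most
the same length. -/
theorem ThetaGraph.Generates.exists_isCarrierGraph [SimplyConnectedSpace A]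
    (hpath : ∀ x y : A, ∃ γ : Path x y, eVariationOn γ Set.univ ≤ ENNReal.ofReal (dist x y))
    (hM : ∀ x : OrbitSpace G A, HasRank (FundamentalGroup (OrbitSpace G A) x) 2)
    {D : ThetaGraph G A} (hD : D.Generates) :
    ∃ (X : Type) (_ : TopologicalSpace X) (Γ : FiniteGraph X) (f : C(X, OrbitSpace G A)),
      IsCarrierGraph Γ f ∧ graphLength Γ f ≤ ENNReal.ofReal D.length := by
  let s : Fin 3 → Bool := ![false, D.i.1, D.j.1]
  let t : Fin 3 → Bool := ![true, D.i.2, D.j.2]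
  let γ : Fin 3 → G := ![1, D.a, D.b]
  choose p hp using fun e => hpath (D.x (s e)) (γ e • D.x (t e))
  obtain ⟨F, hFv, hFe⟩ := Realization.exists_map s t D.x γ p
  let Γ := Realization.graph s t
  let o : Bool → Realization s t := Realization.vertex s t
  let q : ∀ e, Path (o (s e)) (o (t e)) := fun e =>
    ⟨Realization.edge s t e, Realization.edge_zero s t e, Realization.edge_one s t e⟩
  have hconn : PathConnectedSpace (Realization s t) := by
    refine Γ.pathConnectedSpace_of_joined (v₀ := o false) ?_
    rintro _ ⟨_ | _, rfl⟩
    · exact Joined.refl _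
    · exact ⟨q 0⟩
  have hlen : ∀ e, edgeLength Γ F e ≤ ENNReal.ofReal (dist (D.x (s e)) (γ e • D.x (t e))) := by
    intro e
    refine le_trans ?_ (hp e)
    have h1 : (fun r => F (Γ.edge e r)) = proj G ∘ p e := funext fun r => hFe e r
    have h2 := ((lipschitzWith_proj (G := G) (E := A)).lipschitzOnWith
      (s := Set.univ)).comp_eVariationOn_le (g := p e) (s := Set.univ) (Set.mapsTo_univ _ _)
    rw [edgeLength, h1]
    simpa using h2
  -- Being reachable by a path of the graph is an invariant predicate, so generation of the group
  -- makes every translate of the base point reachable.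
  have hedge : ∀ e, EdgeRel (fun v g => Covers F (D.x false) (g • D.x v) (o false) (o v))
      (s e, γ e, t e) := by
    intro e g
    have h1 : Covers F (g • D.x (s e)) ((g * γ e) • D.x (t e)) (o (s e)) (o (t e)) := by
      rw [mul_smul]
      exact Covers.smul ⟨p e, q e, fun r => (hFe e r).symm⟩ g
    exact ⟨fun h => h.trans h1, fun h => h.trans h1.symm⟩
  have hsurj : ∀ x, Function.Surjective (FundamentalGroup.map F x) :=
    surjective_map_of_pathConnected F <|
      surjective_of_covers (hFv false).symm fun g => hD.fullOn
        (P := fun v g => Covers F (D.x false) (g • D.x v) (o false) (o v))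
        (hedge 0) (hedge 1) (hedge 2) false 1 g
        (by simpa using Covers.refl (hFv false).symm)
  refine ⟨Realization s t, inferInstance, Γ, F, ⟨inferInstance, hsurj, fun x => ?_, fun e => ?_⟩, ?_⟩
  · refine ⟨2, ?_, hM _⟩
    obtain ⟨S, hS, hcard⟩ := Γ.exists_generators ⟨o false, false, rfl⟩
    rw [Realization.card_V, Fintype.card_bool] at hcard
    have hE : Fintype.card Γ.E = 3 := Fintype.card_fin 3
    have hfg : Group.FG (FundamentalGroup (Realization s t) (o false)) := ⟨⟨S, hS⟩⟩
    have h1 : Group.rank (FundamentalGroup (Realization s t) (o false)) ≤ 2 :=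
      (Group.rank_le hS).trans (by omega)
    obtain ⟨_, h2⟩ := hM (F (o false))
    -- Three edges and two vertices give rank at most two; surjecting onto a group of rank two gives
    -- at least two.
    have h3 := Group.rank_le_of_surjective (FundamentalGroup.map F (o false)) (hsurj _)
    exact HasRank.of_mulEquiv ⟨hfg, le_antisymm h1 (h2 ▸ h3)⟩
      (FundamentalGroup.fundamentalGroupMulEquivOfPathConnected (o false) x)
  · exact ((hlen e).trans_lt ENNReal.ofReal_lt_top).ne
  · calc graphLength Γ F ≤ ∑ e : Fin 3, ENNReal.ofReal (dist (D.x (s e)) (γ e • D.x (t e))) :=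
          Finset.sum_le_sum fun e _ => hlen e
      _ = ENNReal.ofReal D.length := by
        rw [← ENNReal.ofReal_sum_of_nonneg (by intros; exact dist_nonneg), Fin.sum_univ_three]
        simp [s, t, γ, ThetaGraph.length]

end

/-- The figure-8 knot complement has a minimal length carrier graph. -/
theorem exists_isMinimalLength_figureEight :
    ∃ (X : Type) (_ : TopologicalSpace X) (Γ : FiniteGraph X) (f : C(X, FigureEight)),
      IsMinimalLength Γ f := by
  obtain ⟨D, hD, hmin⟩ := exists_shortest_thetaGraph
  obtain ⟨X, _, Γ, f, hf, hlen⟩ := hD.exists_isCarrierGraph H3.exists_path_eVariationOn_le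
    hasRank_fundamentalGroup_figureEight
  refine ⟨X, _, Γ, f, hf, fun Y _ Δ g hg => ?_⟩
  obtain ⟨D', hD', hlen'⟩ := hg.exists_thetaGraph hasRank_fundamentalGroup_figureEight
  exact hlen.trans ((ENNReal.ofReal_le_ofReal (hmin D' hD')).trans hlen')

end Carrier

/-! ### The main theorem -/

theorem mainTheorem4 :
    -- composing with the isometry
    (∀ (M : Type*) [MetricSpace M], Carrier.IsHyperbolic3Manifold M →
      (∀ x : M, Carrier.HasRank (FundamentalGroup M x) 2) →
      ∀ (X : Type) [TopologicalSpace X] (Γ : Carrier.FiniteGraph X) (f : C(X, M)),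
        Carrier.IsMinimalLength Γ f →
        ∀ h : M ≃ᵢ M, (∀ x, h x ≠ x) → IsOfFinOrder h → ¬ 3 ∣ orderOf h →
          Carrier.IsMinimalLength Γ (Carrier.compIsometry h f) ∧
          ¬ Carrier.StronglyEquivalent (Carrier.compIsometry h f) f) ∧
    -- the figure-8 knot complement satisfies the hypotheses (with an isometry of order 2), so its
    -- minimal length carrier graphs are not unique
    (∃ (M : Type) (_ : MetricSpace M), Carrier.IsFigureEightComplement M ∧
      Carrier.IsHyperbolic3Manifold M ∧
      (∀ x : M, Carrier.HasRank (FundamentalGroup M x) 2) ∧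
      (∃ h : M ≃ᵢ M, (∀ x, h x ≠ x) ∧ orderOf h = 2) ∧
      ∃ (X : Type) (_ : TopologicalSpace X) (Γ : Carrier.FiniteGraph X) (f : C(X, M))
        (Y : Type) (_ : TopologicalSpace Y) (Δ : Carrier.FiniteGraph Y) (g : C(Y, M)),
        Carrier.IsMinimalLength Γ f ∧ Carrier.IsMinimalLength Δ g ∧
        ¬ Carrier.StronglyEquivalent f g) := by
  refine ⟨fun M _ _ hrank X _ Γ f hf h hfix _ h3 =>
    ⟨hf.compIsometry hrank h, hf.1.not_stronglyEquivalent hrank hfix h3⟩, ?_⟩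
  obtain ⟨X, _, Γ, f, hf⟩ := Carrier.exists_isMinimalLength_figureEight
  exact ⟨Carrier.FigureEight, inferInstance, Carrier.isFigureEightComplement,
    Carrier.isHyperbolic3Manifold_figureEight, Carrier.hasRank_fundamentalGroup_figureEight,
    ⟨Carrier.symmetry, Carrier.symmetry_ne, Carrier.orderOf_symmetry⟩,
    X, _, Γ, Carrier.compIsometry Carrier.symmetry f, X, _, Γ, f,
    hf.compIsometry Carrier.hasRank_fundamentalGroup_figureEight Carrier.symmetry, hf,
    hf.1.not_stronglyEquivalent Carrier.hasRank_fundamentalGroup_figureEight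
      Carrier.symmetry_ne (by rw [Carrier.orderOf_symmetry]; decide)⟩
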